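/- Let $\mathbb F$ be an algebraically closed field of characteristic $0$ and let $n\ge 2$. Let $P(n)$ be the Lie superalgebra of all block matrices $$\begin{pmatrix} a & b\\ c & -a^{\top}\end{pmatrix},\qquad a,b,c\in M_{n+1}(\mathbb F),\quad \operatorname{tr}a=0,\ b=b^{\top},\ c=-c^{\top},$$ with the supercommutator as bracket; its even part consists of the block diagonal and its odd part of the block antidiagonal matrices. A grading on $P(n)$ by an abelian group $G$ is a decomposition $\Gamma: P(n)=\bigoplus_{g\in G}P(n)_g$ into subsuperspaces with $[P(n)_g,P(n)_h]\subseteq P(n)_{g+h}$; its support is $\{g : P(n)_g\neq 0\}$. A grading is fine if it has no proper refinement among the gradings by abelian groups, where $\Gamma'$ is a proper refinement of $\Gamma$ if every nonzero component of $\Gamma'$ is contained in a component of $\Gamma$, at least one of them properly. Two gradings are equivalent if some automorphism of the superalgebra $P(n)$ maps the nonzero components of the first bijectively onto the nonzero components of the second. The universal group of $\Gamma$ is the abelian group generated by the support of $\Gamma$ with defining relations $s_1+s_2=s_3$ whenever $0\neq[P(n)_{s_1},P(n)_{s_2}]\subseteq P(n)_{s_3}$. For $\ell\ge 0$ let $T_{(\ell)}=\mathbb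 Z_2^{2\ell}$ and $\beta_{(\ell)}(x,y)=(-1)^{\sum_{i=1}^{2\ell}x_iy_{2\ell-i+1}}$. Write $T_{(\ell)}=A\oplus B$, where $A$ (resp. $B$) consists of the elements supported on the first (resp. last) $\ell$ coordinates, and for $a\in A$, $b\in B$ let $$X_{a+b}=\sum_{b'\in B}\beta_{(\ell)}(a,b+b')\,E_{b+b',\,b'},$$ a matrix of size $2^\ell$ with rows and columns indexed by $B$. These matrices form a basis of $M_{2^\ell}(\mathbb F)$. Suppose $2^\ell$ divides $n+1$ and put $k=(n+1)/2^\ell$. Let $e_1,\dots,e_k$ be the standard basis of $\mathbb Z^k$ and let $\langle e_0\rangle$ be an infinite cyclic group. Identify $M_{n+1}(\mathbb F)$ with $M_k(\mathbb F)\otimes M_{2^\ell}(\mathbb F)$ by the Kronecker product. Give $M_{2n+2}(\mathbb F)$ the grading by $T_{(\ell)}\times\mathbb Z^k\times\langle e_0\rangle$ in which the element $E_{ij}\otimes X_t$ ($1\le i,j\le k$, $t\in T_{(\ell)}$) has degree $e_i+t-e_j$ in the upper left block, $e_i+t+e_j-e_0$ in the upper right block, $-e_i+t-e_j+e_0$ in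 the lower left block and $-e_i+t+e_j$ in the lower right block. Let $\Gamma_P(\ell)$ be the restriction of this grading to $P(n)$. Put $\mathbb Z^k_0=\{x\in\mathbb Z^k : x_1+\dots+x_k=0\}$ and $$G_{(\ell)}=(T_{(\ell)}\times\mathbb Z^k_0)\oplus\langle 2e_1-e_0\rangle\ \subseteq\ T_{(\ell)}\times\mathbb Z^k\times\langle e_0\rangle .$$ **Theorem.** For every fine grading $\Gamma$ on $P(n)$ by an abelian group there is a unique $\ell\ge 0$ such that $2^\ell$ divides $n+1$ and $\Gamma$ is equivalent to $\Gamma_P(\ell)$. Conversely, for every $\ell\ge 0$ such that $2^\ell$ divides $n+1$, $\Gamma_P(\ell)$ is a fine grading on $P(n)$, and $G_{(\ell)}$ is its universal group, i.e. the identity on the support extends to an isomorphism from the universal group of $\Gamma_P(\ell)$ onto $G_{(\ell)}$. Moreover, $G_{(\ell)}\cong\mathbb Z_2^{2\ell}\times\mathbb Z^k$. -/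

import Mathlib

universe u v w

/-! ### Lie superalgebras -/

/-- A Lie superalgebra structure on a vector space `L` over a field `F` (of characteristic
different from 2 and 3): a decomposition into an even and an odd part, and a bilinear bracket
that is even, super-skew-symmetric and satisfies the super Jacobi identity. -/
structure LieSuperalgebra (F : Type*) (L : Type*) [Field F] [AddCommGroup L] [Module F L] where
  parity : ZMod 2 → Submodule F L
  isCompl : IsCompl (parity 0) (parity 1)
  bracket : L →ₗ[F] L →ₗ[F] L
  bracket_mem : ∀ (i j : ZMod 2) (x y : L), x ∈ parity i → y ∈ parity j →
    bracket x y ∈ parity (i + j)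
  skew : ∀ (i j : ZMod 2) (x y : L), x ∈ parity i → y ∈ parity j →
    bracket x y = -((-1 : F) ^ (i.val * j.val) • bracket y x)
  jacobi : ∀ (i j : ZMod 2) (x y z : L), x ∈ parity i → y ∈ parity j →
    bracket x (bracket y z) =
      bracket (bracket x y) z + (-1 : F) ^ (i.val * j.val) • bracket y (bracket x z)

namespace LieSuperalgebra

section General

variable {F : Type*} {L : Type*} [Field F] [AddCommGroup L] [Module F L]

/-- The subsuperalgebra structure on a subsuperspace `W` closed under the bracket. -/
def restrict (S : LieSuperalgebra F L) (W : Submodule F L)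
    (hsuper : W ≤ (W ⊓ S.parity 0) ⊔ (W ⊓ S.parity 1))
    (hbracket : ∀ x ∈ W, ∀ y ∈ W, S.bracket x y ∈ W) : LieSuperalgebra F W where
  parity i := (S.parity i).comap W.subtype
  isCompl := by
    constructor
    · rw [Submodule.disjoint_def]
      intro x h0 h1
      exact Subtype.ext ((Submodule.disjoint_def.1 S.isCompl.disjoint) x.1 h0 h1)
    · rw [codisjoint_iff_le_sup]
      intro x _
      obtain ⟨y, hy, z, hz, h⟩ := Submodule.mem_sup.1 (hsuper x.2)
      exact Submodule.mem_sup.2 ⟨⟨y, hy.1⟩, hy.2, ⟨z, hz.1⟩, hz.2, Subtype.ext h⟩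
  bracket := LinearMap.mk₂ F (fun x y => ⟨S.bracket x.1 y.1, hbracket x.1 x.2 y.1 y.2⟩)
    (fun _ _ _ => Subtype.ext (by simp)) (fun _ _ _ => Subtype.ext (by simp))
    (fun _ _ _ => Subtype.ext (by simp)) (fun _ _ _ => Subtype.ext (by simp))
  bracket_mem i j x y hx hy := S.bracket_mem i j x.1 y.1 hx hy
  skew i j x y hx hy := Subtype.ext (S.skew i j x.1 y.1 hx hy)
  jacobi i j x y z hx hy := Subtype.ext (S.jacobi i j x.1 y.1 z.1 hx hy)

/-! ### Gradings by abelian groups -/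

variable (S : LieSuperalgebra F L)

/-- `Γ` is a grading of the Lie superalgebra by the abelian group `G` (written additively):
a direct sum decomposition into subsuperspaces labelled by `G` and compatible with the bracket. -/
structure IsGrading {G : Type*} [AddCommGroup G] (Γ : G → Submodule F L) : Prop where
  indep : iSupIndep Γ
  iSup_eq_top : ⨆ g, Γ g = ⊤
  subsuperspace : ∀ g, Γ g = (Γ g ⊓ S.parity 0) ⊔ (Γ g ⊓ S.parity 1)
  bracket_mem : ∀ (g h : G) (x y : L), x ∈ Γ g → y ∈ Γ h → S.bracket x y ∈ Γ (g + h)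

/-- The support of a grading. -/
def support {G : Type*} (Γ : G → Submodule F L) : Set G := {g | Γ g ≠ ⊥}

/-- A linear bijection is an automorphism of the superalgebra if it preserves the parity and
the bracket. -/
def IsAut (φ : L ≃ₗ[F] L) : Prop :=
  (∀ i, (S.parity i).map (φ : L →ₗ[F] L) = S.parity i) ∧
    ∀ x y, φ (S.bracket x y) = S.bracket (φ x) (φ y)

/-- Equivalence of gradings: an automorphism of the superalgebra carries the (nonzero)
components of one bijectively to the components of the other. -/
def Equivalent {G H : Type*} (Γ : G → Submodule F L) (Δ : H → Submodule F L) : Prop :=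
  ∃ φ : L ≃ₗ[F] L, S.IsAut φ ∧
    ∃ α : support Γ ≃ support Δ, ∀ s : support Γ, (Γ s).map (φ : L →ₗ[F] L) = Δ (α s)

/-- `Δ` is a proper refinement of `Γ`: every component of `Δ` lies in a component of `Γ`, and
at least one of them is strictly smaller. -/
def IsProperRefinement {G H : Type*} (Δ : H → Submodule F L) (Γ : G → Submodule F L) : Prop :=
  (∀ t ∈ support Δ, ∃ s ∈ support Γ, Δ t ≤ Γ s) ∧ ∃ t ∈ support Δ, ∃ s ∈ support Γ, Δ t < Γ s

/-- A fine grading: a grading by an abelian group without proper refinements among the gradings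
by abelian groups. The universe of the groups grading the refinements is a parameter. -/
def IsFine.{z, a, b, c} {F : Type a} {L : Type b} [Field F] [AddCommGroup L] [Module F L]
    (S : LieSuperalgebra F L) {G : Type c} [AddCommGroup G] (Γ : G → Submodule F L) : Prop :=
  S.IsGrading Γ ∧ ∀ (H : Type z) [AddCommGroup H] (Δ : H → Submodule F L),
    S.IsGrading Δ → ¬ IsProperRefinement Δ Γ

/-- The defining relations `s₁ + s₂ = s₃`, one for all `s₁, s₂, s₃` in the support with
`0 ≠ [Γ s₁, Γ s₂] ⊆ Γ s₃`, as elements of the free abelian group on the support. -/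
def universalRelations {G : Type*} (Γ : G → Submodule F L) :
    Set (FreeAbelianGroup (support Γ)) :=
  {r | ∃ s₁ s₂ s₃ : support Γ,
    (∃ x ∈ Γ s₁, ∃ y ∈ Γ s₂, S.bracket x y ≠ 0) ∧
    (∀ x ∈ Γ s₁, ∀ y ∈ Γ s₂, S.bracket x y ∈ Γ s₃) ∧
    r = FreeAbelianGroup.of s₁ + FreeAbelianGroup.of s₂ - FreeAbelianGroup.of s₃}

/-- The universal abelian grading group. -/
abbrev UniversalGroup {G : Type*} (Γ : G → Submodule F L) : Type _ :=
  FreeAbelianGroup (support Γ) ⧸ AddSubgroup.closure (S.universalRelations Γ)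

/-- The canonical map from the support to the universal abelian grading group. -/
def toUniversal {G : Type*} (Γ : G → Submodule F L) (s : support Γ) : S.UniversalGroup Γ :=
  QuotientAddGroup.mk (FreeAbelianGroup.of s)

end General

end LieSuperalgebra

/-! ### The Lie superalgebra `P(n)` -/

namespace Periplectic

open Matrix

section Construction

variable (F : Type*) [Field F] (I : Type*)

/-- The matrices of `M(m, m)`, with even index set `I` (first summand) and odd index set `I`. -/
abbrev Mat : Type _ := Matrix (I ⊕ I) (I ⊕ I) F

/-- The even part (block diagonal) and the odd part (block antidiagonal) of `M(m, m)`. -/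
def matParity (i : ZMod 2) : Submodule F (Mat F I) where
  carrier := {x | if i = 0 then x.toBlocks₁₂ = 0 ∧ x.toBlocks₂₁ = 0
    else x.toBlocks₁₁ = 0 ∧ x.toBlocks₂₂ = 0}
  add_mem' := by
    intro x y hx hy
    split_ifs with h <;> simp_all [← Matrix.ext_iff, toBlocks₁₁, toBlocks₁₂, toBlocks₂₁, toBlocks₂₂]
  zero_mem' := by
    split_ifs with h <;> simp [← Matrix.ext_iff, toBlocks₁₁, toBlocks₁₂, toBlocks₂₁, toBlocks₂₂]
  smul_mem' := by
    intro c x hx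
    split_ifs with h <;> simp_all [← Matrix.ext_iff, toBlocks₁₁, toBlocks₁₂, toBlocks₂₁, toBlocks₂₂]

variable {F I}

/-- The even component of a matrix. -/
def ev (x : Mat F I) : Mat F I := fromBlocks x.toBlocks₁₁ 0 0 x.toBlocks₂₂

/-- The odd component of a matrix. -/
def od (x : Mat F I) : Mat F I := fromBlocks 0 x.toBlocks₁₂ x.toBlocks₂₁ 0

theorem ev_add_od (x : Mat F I) : ev x + od x = x := by
  conv_rhs => rw [← fromBlocks_toBlocks x]
  simp [ev, od, fromBlocks_add]

theorem ev_add (x y : Mat F I) : ev (x + y) = ev x + ev y := by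
  ext (i | i) (j | j) <;> simp [ev, toBlocks₁₁, toBlocks₂₂]

theorem od_add (x y : Mat F I) : od (x + y) = od x + od y := by
  ext (i | i) (j | j) <;> simp [od, toBlocks₁₂, toBlocks₂₁]

theorem ev_smul (c : F) (x : Mat F I) : ev (c • x) = c • ev x := by
  ext (i | i) (j | j) <;> simp [ev, toBlocks₁₁, toBlocks₂₂]

theorem od_smul (c : F) (x : Mat F I) : od (c • x) = c • od x := by
  ext (i | i) (j | j) <;> simp [od, toBlocks₁₂, toBlocks₂₁]

theorem mem_matParity_zero {x : Mat F I} :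
    x ∈ matParity F I 0 ↔ x.toBlocks₁₂ = 0 ∧ x.toBlocks₂₁ = 0 := by
  simp [matParity]

theorem mem_matParity_one {x : Mat F I} :
    x ∈ matParity F I 1 ↔ x.toBlocks₁₁ = 0 ∧ x.toBlocks₂₂ = 0 := by
  simp [matParity]

theorem ev_mem (x : Mat F I) : ev x ∈ matParity F I 0 := by
  simp [mem_matParity_zero, ev]

theorem od_mem (x : Mat F I) : od x ∈ matParity F I 1 := by
  simp [mem_matParity_one, od]

theorem of_even {x : Mat F I} (hx : x ∈ matParity F I 0) : ev x = x ∧ od x = 0 := by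
  rw [mem_matParity_zero] at hx
  have h : od x = 0 := by simp [od, hx.1, hx.2]
  exact ⟨by simpa [h] using ev_add_od x, h⟩

theorem of_odd {x : Mat F I} (hx : x ∈ matParity F I 1) : ev x = 0 ∧ od x = x := by
  rw [mem_matParity_one] at hx
  have h : ev x = 0 := by simp [ev, hx.1, hx.2]
  exact ⟨h, by simpa [h] using ev_add_od x⟩

variable [Fintype I]

/-- The supercommutator: on homogeneous elements it is `x * y - (-1) ^ (|x| |y|) * y * x`. -/
def superBracket : Mat F I →ₗ[F] Mat F I →ₗ[F] Mat F I :=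
  LinearMap.mk₂ F
    (fun x y => x * y - (ev y * ev x + ev y * od x + od y * ev x - od y * od x))
    (fun x₁ x₂ y => by simp only [ev_add, od_add]; noncomm_ring)
    (fun c x y => by simp only [ev_smul, od_smul, smul_mul_assoc, mul_smul_comm, smul_sub, smul_add])
    (fun x y₁ y₂ => by simp only [ev_add, od_add]; noncomm_ring)
    (fun c x y => by simp only [ev_smul, od_smul, smul_mul_assoc, mul_smul_comm, smul_sub, smul_add])

theorem superBracket_apply (x y : Mat F I) : superBracket x y =
    x * y - (ev y * ev x + ev y * od x + od y * ev x - od y * od x) := rfl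

theorem superBracket_even_left {x : Mat F I} (hx : x ∈ matParity F I 0) (y : Mat F I) :
    superBracket x y = x * y - y * x := by
  rw [superBracket_apply, (of_even hx).1, (of_even hx).2]
  simp [← add_mul, ev_add_od]

theorem superBracket_even_right {y : Mat F I} (hy : y ∈ matParity F I 0) (x : Mat F I) :
    superBracket x y = x * y - y * x := by
  rw [superBracket_apply, (of_even hy).1, (of_even hy).2]
  simp [← mul_add, ev_add_od]

theorem superBracket_odd {x y : Mat F I} (hx : x ∈ matParity F I 1) (hy : y ∈ matParity F I 1) :
    superBracket x y = x * y + y * x := by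
  rw [superBracket_apply, (of_odd hx).1, (of_odd hx).2, (of_odd hy).1, (of_odd hy).2]
  simp

theorem zmod_two (i : ZMod 2) : i = 0 ∨ i = 1 := by
  revert i
  decide

theorem mul_mem_matParity {i j : ZMod 2} {x y : Mat F I} (hx : x ∈ matParity F I i)
    (hy : y ∈ matParity F I j) : x * y ∈ matParity F I (i + j) := by
  rw [← fromBlocks_toBlocks x, ← fromBlocks_toBlocks y, fromBlocks_multiply]
  fin_cases i <;> fin_cases j
  · change _ ∈ matParity F I 0
    have hx := mem_matParity_zero.1 hx
    have hy := mem_matParity_zero.1 hy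
    simp [mem_matParity_zero, hx, hy]
  · change _ ∈ matParity F I 1
    have hx := mem_matParity_zero.1 hx
    have hy := mem_matParity_one.1 hy
    simp [mem_matParity_one, hx, hy]
  · change _ ∈ matParity F I 1
    have hx := mem_matParity_one.1 hx
    have hy := mem_matParity_zero.1 hy
    simp [mem_matParity_one, hx, hy]
  · change _ ∈ matParity F I 0
    have hx := mem_matParity_one.1 hx
    have hy := mem_matParity_one.1 hy
    simp [mem_matParity_zero, hx, hy]

/-- On homogeneous elements the bracket is `x * y - (-1) ^ (|x| |y|) * y * x`. -/
theorem superBracket_of_mem {i j : ZMod 2} {x y : Mat F I} (hx : x ∈ matParity F I i)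
    (hy : y ∈ matParity F I j) :
    superBracket x y = x * y - (-1 : F) ^ (i.val * j.val) • (y * x) := by
  rcases zmod_two i with rfl | rfl <;> rcases zmod_two j with rfl | rfl
  · simp [superBracket_even_left hx]
  · simp [superBracket_even_left hx]
  · simp [superBracket_even_right hy]
  · rw [superBracket_odd hx hy]
    change _ = x * y - (-1 : F) ^ (1 * 1) • (y * x)
    simp

theorem superBracket_mem {i j : ZMod 2} {x y : Mat F I} (hx : x ∈ matParity F I i)
    (hy : y ∈ matParity F I j) : superBracket x y ∈ matParity F I (i + j) := by
  rw [superBracket_of_mem hx hy]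
  refine Submodule.sub_mem _ (mul_mem_matParity hx hy) (Submodule.smul_mem _ _ ?_)
  rw [add_comm]
  exact mul_mem_matParity hy hx

theorem superBracket_jacobi {i j : ZMod 2} {x y : Mat F I} (z : Mat F I)
    (hx : x ∈ matParity F I i) (hy : y ∈ matParity F I j) :
    superBracket x (superBracket y z) = superBracket (superBracket x y) z +
      (-1 : F) ^ (i.val * j.val) • superBracket y (superBracket x z) := by
  suffices H : ∀ k : ZMod 2, ∀ z ∈ matParity F I k, superBracket x (superBracket y z) =
      superBracket (superBracket x y) z +
        (-1 : F) ^ (i.val * j.val) • superBracket y (superBracket x z) by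
    rw [← ev_add_od z]
    simp only [map_add, smul_add]
    rw [H 0 _ (ev_mem z), H 1 _ (od_mem z)]
    abel
  intro k z hz
  rw [superBracket_of_mem hx (superBracket_mem hy hz), superBracket_of_mem hy hz,
    superBracket_of_mem (superBracket_mem hx hy) hz, superBracket_of_mem hx hy,
    superBracket_of_mem hy (superBracket_mem hx hz), superBracket_of_mem hx hz]
  have e1 : (1 : ZMod 2) + 1 = 0 := rfl
  have v0 : (0 : ZMod 2).val = 0 := rfl
  have v1 : (1 : ZMod 2).val = 1 := rfl
  rcases zmod_two i with rfl | rfl <;> rcases zmod_two j with rfl | rfl <;>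
    rcases zmod_two k with rfl | rfl <;>
    simp only [e1, v0, v1, add_zero, zero_add, mul_zero, mul_one, pow_zero, pow_one,
      one_smul, neg_smul] <;> noncomm_ring

variable (F I)

/-- The Lie superalgebra `M(m, m)^(-)`: matrices with the supercommutator. -/
def gl : LieSuperalgebra F (Mat F I) where
  parity := matParity F I
  isCompl := by
    constructor
    · rw [Submodule.disjoint_def]
      intro x h0 h1
      rw [← (of_even h0).1, (of_odd h1).1]
    · rw [codisjoint_iff_le_sup]
      intro x _
      exact Submodule.mem_sup.2 ⟨_, ev_mem x, _, od_mem x, ev_add_od x⟩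
  bracket := superBracket
  bracket_mem i j x y hx hy := superBracket_mem hx hy
  skew i j x y hx hy := by
    rw [superBracket_of_mem hx hy, superBracket_of_mem hy hx, mul_comm j.val, smul_sub, smul_smul,
      ← pow_add, ← two_mul, pow_mul]
    simp
  jacobi i j x y z hx hy := superBracket_jacobi z hx hy

/-- The underlying space of the Lie superalgebra `P(n)`, `n + 1 = |I|`: the block matrices
`(a, b; c, -aᵀ)` with `tr a = 0`, `b` symmetric and `c` skew-symmetric. -/
def space : Submodule F (Mat F I) where
  carrier := {x | x.toBlocks₁₁.trace = 0 ∧ x.toBlocks₁₂ᵀ = x.toBlocks₁₂ ∧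
    x.toBlocks₂₁ᵀ = -x.toBlocks₂₁ ∧ x.toBlocks₂₂ = -x.toBlocks₁₁ᵀ}
  add_mem' := by
    rintro x y ⟨h1, h2, h3, h4⟩ ⟨k1, k2, k3, k4⟩
    have e11 : (x + y).toBlocks₁₁ = x.toBlocks₁₁ + y.toBlocks₁₁ := rfl
    have e12 : (x + y).toBlocks₁₂ = x.toBlocks₁₂ + y.toBlocks₁₂ := rfl
    have e21 : (x + y).toBlocks₂₁ = x.toBlocks₂₁ + y.toBlocks₂₁ := rfl
    have e22 : (x + y).toBlocks₂₂ = x.toBlocks₂₂ + y.toBlocks₂₂ := rfl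
    refine ⟨?_, ?_, ?_, ?_⟩
    · rw [e11, trace_add, h1, k1, add_zero]
    · rw [e12, transpose_add, h2, k2]
    · rw [e21, transpose_add, h3, k3, neg_add]
    · rw [e22, e11, transpose_add, h4, k4, neg_add]
  zero_mem' := ⟨trace_zero _ _, by ext; rfl, by ext; simp [toBlocks₂₁], by
    ext; simp [toBlocks₂₂, toBlocks₁₁]⟩
  smul_mem' := by
    rintro c x ⟨h1, h2, h3, h4⟩
    have e11 : (c • x).toBlocks₁₁ = c • x.toBlocks₁₁ := rfl
    have e12 : (c • x).toBlocks₁₂ = c • x.toBlocks₁₂ := rfl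
    have e21 : (c • x).toBlocks₂₁ = c • x.toBlocks₂₁ := rfl
    have e22 : (c • x).toBlocks₂₂ = c • x.toBlocks₂₂ := rfl
    refine ⟨?_, ?_, ?_, ?_⟩
    · rw [e11, trace_smul, h1, smul_zero]
    · rw [e12, transpose_smul, h2]
    · rw [e21, transpose_smul, h3, smul_neg]
    · rw [e22, e11, transpose_smul, h4, smul_neg]

theorem mem_space {a b c d : Matrix I I F} : fromBlocks a b c d ∈ space F I ↔
    a.trace = 0 ∧ bᵀ = b ∧ cᵀ = -c ∧ d = -aᵀ := by
  rw [← SetLike.mem_coe]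
  simp [space]

theorem space_super : space F I ≤
    (space F I ⊓ (gl F I).parity 0) ⊔ (space F I ⊓ (gl F I).parity 1) := by
  intro x hx
  have hx' := hx
  rw [← fromBlocks_toBlocks x, mem_space] at hx'
  obtain ⟨h1, h2, h3, h4⟩ := hx'
  refine Submodule.mem_sup.2 ⟨ev x, ⟨?_, ev_mem x⟩, od x, ⟨?_, od_mem x⟩, ev_add_od x⟩
  · exact (mem_space F I).2 ⟨h1, by simp, by simp, h4⟩
  · exact (mem_space F I).2 ⟨by simp, h2, h3, by simp⟩

theorem trace_mul_eq_zero [CharZero F] {b c : Matrix I I F} (hb : bᵀ = b) (hc : cᵀ = -c) :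
    (b * c).trace = 0 := by
  have h : (b * c).trace = -(b * c).trace := by
    conv_lhs => rw [← trace_transpose, transpose_mul, hb, hc, neg_mul, trace_neg, trace_mul_comm]
  exact self_eq_neg.1 h

theorem space_bracket [CharZero F] :
    ∀ x ∈ space F I, ∀ y ∈ space F I, (gl F I).bracket x y ∈ space F I := by
  intro x hx y hy
  change superBracket x y ∈ _
  obtain ⟨a, b, c, d, rfl⟩ : ∃ a b c d, x = fromBlocks a b c d :=
    ⟨_, _, _, _, (fromBlocks_toBlocks x).symm⟩
  obtain ⟨a', b', c', d', rfl⟩ : ∃ a b c d, y = fromBlocks a b c d :=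
    ⟨_, _, _, _, (fromBlocks_toBlocks y).symm⟩
  obtain ⟨h1, h2, h3, rfl⟩ := (mem_space F I).1 hx
  obtain ⟨k1, k2, k3, rfl⟩ := (mem_space F I).1 hy
  have e : superBracket (fromBlocks a b c (-aᵀ)) (fromBlocks a' b' c' (-a'ᵀ)) =
      fromBlocks (a * a' - a' * a + b * c' + b' * c) (a * b' - b * a'ᵀ - a' * b + b' * aᵀ)
        (c * a' - aᵀ * c' - c' * a + a'ᵀ * c)
        (c * b' + aᵀ * a'ᵀ - a'ᵀ * aᵀ + c' * b) := by
    rw [superBracket_apply]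
    simp only [ev, od, toBlocks_fromBlocks₁₁, toBlocks_fromBlocks₁₂, toBlocks_fromBlocks₂₁,
      toBlocks_fromBlocks₂₂, fromBlocks_multiply, fromBlocks_add, fromBlocks_neg, sub_eq_add_neg]
    congr 1 <;> noncomm_ring
  rw [e, mem_space]
  refine ⟨?_, ?_, ?_, ?_⟩
  · rw [trace_add, trace_add, trace_sub, trace_mul_comm a a', sub_self,
      trace_mul_eq_zero F I h2 k3, trace_mul_eq_zero F I k2 h3]
    simp
  · simp only [transpose_add, transpose_sub, transpose_mul, transpose_transpose, h2, k2]
    noncomm_ring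
  · simp only [transpose_add, transpose_sub, transpose_mul, transpose_transpose, h3, k3]
    noncomm_ring
  · simp only [transpose_add, transpose_sub, transpose_mul, h2, h3, k2, k3]
    noncomm_ring

end Construction

/-- The Lie superalgebra `P(n)`, as a subsuperalgebra of `M(n + 1, n + 1)^(-)`. -/
def P (F : Type*) [Field F] [CharZero F] (n : ℕ) :
    LieSuperalgebra F (space F (Fin (n + 1))) :=
  (gl F (Fin (n + 1))).restrict (space F (Fin (n + 1))) (space_super F _) (space_bracket F _)

/-! ### The gradings `Γ_P(T, β, γ, g₀)` -/

section Gradings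

open scoped Kronecker

variable {F : Type*} [Field F]

/-- Let `D = M_B(F)` be graded with components spanned by `X t`, `t : T`, where `X t` has degree
`ι t`. Via the Kronecker product and the labelling `e` of rows and columns, `M_k(F) ⊗ D` is
identified with `M_{n+1}(F)`. The component of degree `g` of the grading of `M(n + 1, n + 1)` with
`deg (E_ij ⊗ d)` equal to `γ i + deg d - γ j`, `γ i + deg d + γ j - g₀`, `-γ i + deg d - γ j + g₀`
and `-γ i + deg d + γ j` in the upper left, upper right, lower left and lower right block. -/
def matComponent {G T B : Type*} [AddCommGroup G] {k n : ℕ} (X : T → Matrix B B F) (ι : T → G)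
    (γ : Fin k → G) (g₀ : G) (e : Fin k × B ≃ Fin (n + 1)) (g : G) :
    Submodule F (Mat F (Fin (n + 1))) :=
  let E : Fin k → Fin k → T → Matrix (Fin (n + 1)) (Fin (n + 1)) F :=
    fun i j t => Matrix.reindex e e (Matrix.single i j (1 : F) ⊗ₖ X t)
  Submodule.span F
    ({x | ∃ i j t, g = γ i + ι t - γ j ∧ x = fromBlocks (E i j t) 0 0 0} ∪
     {x | ∃ i j t, g = γ i + ι t + γ j - g₀ ∧ x = fromBlocks 0 (E i j t) 0 0} ∪
     {x | ∃ i j t, g = -γ i + ι t - γ j + g₀ ∧ x = fromBlocks 0 0 (E i j t) 0} ∪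
     {x | ∃ i j t, g = -γ i + ι t + γ j ∧ x = fromBlocks 0 0 0 (E i j t)})

/-- The restriction of the previous grading to `P(n)`. -/
def gammaP {G T B : Type*} [AddCommGroup G] {k n : ℕ} (X : T → Matrix B B F) (ι : T → G)
    (γ : Fin k → G) (g₀ : G) (e : Fin k × B ≃ Fin (n + 1)) (g : G) :
    Submodule F (space F (Fin (n + 1))) :=
  (matComponent X ι γ g₀ e g).comap (space F (Fin (n + 1))).subtype

/-! ### The gradings `Γ_P(ℓ)` -/

/-- The elementary 2-group `T_(ℓ)` of rank `2ℓ`. -/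
abbrev T (ℓ : ℕ) : Type := Fin (2 * ℓ) → ZMod 2

variable (F) in
/-- The bicharacter `β_(ℓ)(x, y) = (-1) ^ ∑ x_i y_{2ℓ-i+1}` (indices from `1` to `2ℓ`). -/
def beta (ℓ : ℕ) (x y : T ℓ) : F := (-1) ^ (∑ i, x i * y i.rev).val

/-- The subgroup `B` of `T_(ℓ)` of the elements supported on the last `ℓ` coordinates, given by
these coordinates. It is isotropic for `β_(ℓ)`, and so is its complement `A`, supported on the first
`ℓ` coordinates. -/
abbrev B (ℓ : ℕ) : Type := Fin ℓ → ZMod 2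

/-- The inclusion of `B` into `T_(ℓ)`. -/
def inclB {ℓ : ℕ} (b : B ℓ) : T ℓ := fun i =>
  if h : ℓ ≤ i.val then b ⟨i.val - ℓ, by have := i.isLt; omega⟩ else 0

/-- The projection of `T_(ℓ) = A × B` to `A`, as an endomorphism of `T_(ℓ)`. -/
def projA {ℓ : ℕ} (t : T ℓ) : T ℓ := fun i => if i.val < ℓ then t i else 0

/-- The projection of `T_(ℓ) = A × B` to `B`. -/
def projB {ℓ : ℕ} (t : T ℓ) : B ℓ := fun i => t ⟨ℓ + i.val, by have := i.isLt; omega⟩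

variable (F) in
/-- The standard realization of the graded division algebra associated to `(T_(ℓ), β_(ℓ))`: for
`t = ab`, the matrix `X_t = ∑_{b'} β(a, b b') E_{b b', b'}`. -/
def X (ℓ : ℕ) (t : T ℓ) : Matrix (B ℓ) (B ℓ) F :=
  Matrix.of fun r c => if r = projB t + c then beta F ℓ (projA t) (inclB r) else 0

/-- The standard labelling of the rows and columns of a Kronecker product of a `k × k` matrix and
a matrix with rows and columns indexed by `B`. -/
def labelling {n ℓ k : ℕ} (h : k * 2 ^ ℓ = n + 1) : Fin k × B ℓ ≃ Fin (n + 1) :=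
  ((Equiv.refl (Fin k)).prodCongr (finFunctionFinEquiv (m := 2) (n := ℓ))).trans
    (finProdFinEquiv.trans (finCongr h))

/-- The group `T_(ℓ) × ℤ^k × ⟨e₀⟩`, with `⟨e₀⟩` infinite cyclic. -/
abbrev BigGroup (ℓ k : ℕ) : Type := T ℓ × (Fin k → ℤ) × ℤ

/-- The elements `e_1, …, e_k` (here indexed from `0`). -/
def e {ℓ k : ℕ} (i : Fin k) : BigGroup ℓ k := (0, Pi.single i 1, 0)

/-- The element `e₀`. -/
def e₀ {ℓ k : ℕ} : BigGroup ℓ k := (0, 0, 1)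

variable (F) in
/-- The grading `Γ_P(ℓ, k) = Γ_P(T_(ℓ), β_(ℓ), (e_1, …, e_k), e₀)` on `P(n)`, where
`k * 2 ^ ℓ = n + 1`. -/
def fineGammaP {n ℓ k : ℕ} (h : k * 2 ^ ℓ = n + 1) :
    BigGroup ℓ k → Submodule F (space F (Fin (n + 1))) :=
  gammaP (X F ℓ) (fun t => (t, 0, 0)) e e₀ (labelling h)

/-- The subgroup `T_(ℓ) × ℤ^k_0` of `T_(ℓ) × ℤ^k × ⟨e₀⟩`, where `ℤ^k_0` consists of the vectors
with zero sum of coordinates. -/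
def zeroSumGroup (ℓ k : ℕ) : AddSubgroup (BigGroup ℓ k) where
  carrier := {g | ∑ i, g.2.1 i = 0 ∧ g.2.2 = 0}
  add_mem' := by
    rintro a b ⟨h1, h2⟩ ⟨k1, k2⟩
    simp [Finset.sum_add_distrib, h1, h2, k1, k2]
  zero_mem' := by simp
  neg_mem' := by
    rintro a ⟨h1, h2⟩
    simp [h1, h2]

/-- The group `G_(ℓ) = (T_(ℓ) × ℤ^k_0) ⊕ ⟨2 e_1 - e₀⟩`, for `k ≥ 1`. -/
def fineGroup (ℓ k : ℕ) (hk : 0 < k) : AddSubgroup (BigGroup ℓ k) :=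
  zeroSumGroup ℓ k ⊔ AddSubgroup.zmultiples (2 • e ⟨0, hk⟩ - e₀)

theorem pos_of_mul_eq {n ℓ k : ℕ} (h : k * 2 ^ ℓ = n + 1) : 0 < k := by
  rcases Nat.eq_zero_or_pos k with rfl | hk
  · simp at h
  · exact hk

end Gradings

end Periplectic

/-! Characters turn gradings into commuting automorphisms. As F is algebraically closed of
characteristic 0, the homomorphisms χ : G → Fˣ separate the points of every abelian group G. Each
acts on a G-graded algebra by the automorphism multiplying degree g by χ(g), and a subspace on which
all of these are scalar lies in a single component (`le_component_of_scalar`).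

Every automorphism of P(n) is conjugation by diag(u, (u⁻¹)ᵀ) with u invertible and unique up to sign
(`exists_eq_ad`, `eq_or_eq_neg_of_ad_eq`). The odd elements whose only nonzero block is vvᵀ in the
upper right are recognized by the bracket alone (`isRankOne_iff`). So an automorphism induces a
linear map on symmetric matrices that preserves the squares vvᵀ and their tangent spaces; such a map
is a congruence b ↦ u b uᵀ (`exists_congruence_of_isSymm`), and once it is undone the automorphism
is trivial (`eq_refl_of_fixes_upperRight`).

A grading therefore yields diagonalizable matrices u commuting up to sign. A noncommuting pair can
be rescaled to anticommuting involutions, which split off a tensor factor M_2; by induction on the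
dimension some basis brings all u to the form diag(p) ⊗ X_s (`exists_monomial_basis`). The
conjugations by all diag(p) ⊗ X_s act by scalars on the components of Γ_P(ℓ). Hence every grading is
refined by a grading equivalent to some Γ_P(ℓ) (`exists_refinement`), and a fine grading coincides
with this refinement.

Conversely, an invertible matrix commuting up to sign with all diag(p) ⊗ X_s is itself of this form
(`exists_eq_monomialUnit`). The automorphisms coming from a refinement of Γ_P(ℓ) commute with the
conjugations by diag(p) ⊗ X_s, so they are again such conjugations and act by scalars on the
components of Γ_P(ℓ); the refinement is not proper. For the same reason every character of the
universal group is induced from T_(ℓ) × ℤ^k × ⟨e₀⟩, so the universal group embeds there, as the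
subgroup generated by the support, which is G_(ℓ). Its torsion subgroup has order 4^ℓ, which
determines ℓ. -/

set_option linter.unusedSectionVars false

/-! ### Gradings, characters and diagonal automorphisms -/

namespace LieSuperalgebra

/-- Fˣ is divisible, hence an injective ℤ-module, so a nontrivial character of the cyclic group
generated by g extends to G. No finiteness of G is needed. -/
theorem exists_character_ne_zero (F : Type*) [Field F] [IsAlgClosed F] [CharZero F]
    {G : Type*} [AddCommGroup G] {g : G} (hg : g ≠ 0) : ∃ χ : G →+ Additive Fˣ, χ g ≠ 0 := by
  obtain ⟨ζ, hζ, hζ1⟩ : ∃ ζ : Fˣ, ζ ^ addOrderOf g = 1 ∧ ζ ≠ 1 := by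
    -- For g of infinite order any ζ ≠ 1 serves, here 2. For finite order ζ is a primitive root of
    -- unity of that order, and ζ = 1 would force g = 0.
    rcases eq_or_ne (addOrderOf g) 0 with h0 | h0
    · refine ⟨Units.mk0 2 two_ne_zero, by simp [h0], fun h => ?_⟩
      have := congrArg Units.val h
      norm_num at this
    · have : NeZero (addOrderOf g : F) := ⟨Nat.cast_ne_zero.2 h0⟩
      have : NeZero (addOrderOf g) := ⟨h0⟩
      obtain ⟨z, hz⟩ := HasEnoughRootsOfUnity.exists_primitiveRoot F (addOrderOf g)
      refine ⟨_, (hz.isUnit_unit h0).pow_eq_one, fun h => hg (AddMonoid.addOrderOf_eq_one_iff.1 ?_)⟩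
      have := (hz.isUnit_unit h0).eq_orderOf
      rwa [h, orderOf_one] at this
  have : DivisibleBy (Additive Fˣ) ℕ := by
    refine divisibleByOfSMulRightSurj _ _ fun {n} hn x => ?_
    obtain ⟨z, hz⟩ := IsAlgClosed.exists_pow_nat_eq (x.toMul : F) (Nat.pos_of_ne_zero hn)
    have hz0 : z ≠ 0 := by
      rintro rfl
      rw [zero_pow hn] at hz
      exact x.toMul.ne_zero hz.symm
    exact ⟨Additive.ofMul (Units.mk0 z hz0), Additive.toMul.injective (Units.ext (by simpa using hz))⟩
  have : DivisibleBy (Additive Fˣ) ℤ := AddGroup.divisibleByIntOfDivisibleByNat _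
  let f := LinearMap.toSpanSingleton ℤ G g
  let k := LinearMap.toSpanSingleton ℤ (Additive Fˣ) (Additive.ofMul ζ)
  -- This makes mg ↦ ζ^m well defined on the cyclic subgroup generated by g.
  have hle : LinearMap.ker f ≤ LinearMap.ker k := by
    intro m hm
    rw [LinearMap.mem_ker, LinearMap.toSpanSingleton_apply] at hm ⊢
    obtain ⟨d, rfl⟩ := addOrderOf_dvd_iff_zsmul_eq_zero.2 hm
    rw [← ofMul_zpow, zpow_mul, zpow_natCast, hζ, one_zpow, ofMul_one]
  obtain ⟨χ, hχ⟩ := (Module.Baer.of_divisible (Additive Fˣ)).extension_property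
    ((LinearMap.ker f).liftQ f le_rfl) (LinearMap.ker_eq_bot.1 (Submodule.ker_liftQ_eq_bot' _ _ rfl))
    ((LinearMap.ker f).liftQ k hle)
  refine ⟨χ.toAddMonoidHom, fun h => hζ1 ?_⟩
  have e := LinearMap.congr_fun hχ ((LinearMap.ker f).mkQ 1)
  simp only [LinearMap.comp_apply, Submodule.mkQ_apply, Submodule.liftQ_apply] at e
  simp only [f, k, LinearMap.toSpanSingleton_apply, one_smul] at e
  exact Additive.ofMul.injective (e.symm.trans h)

variable {F : Type*} {L : Type*} [Field F] [AddCommGroup L] [Module F L]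

theorem eqOn_of_iSup_eq_top {ι M : Type*} [AddCommGroup M] [Module F M] {Γ : ι → Submodule F L}
    (h : ⨆ i, Γ i = ⊤) {f g : L →ₗ[F] M} (hfg : ∀ i, ∀ x ∈ Γ i, f x = g x) : f = g := by
  have : ⊤ ≤ LinearMap.eqLocus f g := by
    rw [← h]
    exact iSup_le fun i x hx => hfg i x hx
  exact LinearMap.ext fun x => this (Submodule.mem_top (x := x))

theorem exists_diagonal_end {ι : Type*} {Γ : ι → Submodule F L} (hi : iSupIndep Γ)
    (h : ⨆ i, Γ i = ⊤) (c : ι → F) : ∃ θ : L →ₗ[F] L, ∀ i, ∀ x ∈ Γ i, θ x = c i • x := by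
  classical
  have hI := DirectSum.isInternal_submodule_of_iSupIndep_of_iSup_eq_top hi h
  let E := LinearEquiv.ofBijective (DirectSum.coeLinearMap Γ) hI
  refine ⟨(DirectSum.toModule F ι L fun i => c i • (Γ i).subtype) ∘ₗ E.symm.toLinearMap, ?_⟩
  intro i x hx
  have : E.symm x = DirectSum.lof F ι (fun i => Γ i) i ⟨x, hx⟩ := by
    rw [LinearEquiv.symm_apply_eq]
    exact (DirectSum.coeLinearMap_lof Γ i ⟨x, hx⟩).symm
  simp [this]

/-- The projection to a component. -/
theorem exists_component_projection {ι : Type*} {Γ : ι → Submodule F L} (hi : iSupIndep Γ)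
    (h : ⨆ i, Γ i = ⊤) : ∃ π : ι → L →ₗ[F] L,
      (∀ i, ∀ x ∈ Γ i, π i x = x) ∧ (∀ i j, i ≠ j → ∀ x ∈ Γ i, π j x = 0) ∧
      (∀ i x, π i x ∈ Γ i) ∧ (∀ x, (∀ i, π i x = 0) → x = 0) := by
  classical
  choose π hπ using fun j : ι => exists_diagonal_end hi h (fun i => if i = j then (1 : F) else 0)
  have h1 : ∀ i, ∀ x ∈ Γ i, π i x = x := fun i x hx => by simp [hπ i i x hx]
  have h2 : ∀ i j, i ≠ j → ∀ x ∈ Γ i, π j x = 0 := fun i j hij x hx => by simp [hπ j i x hx, hij]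
  refine ⟨π, h1, h2, ?_, ?_⟩
  · intro i x
    have : ⊤ ≤ (Γ i).comap (π i) := by
      rw [← h]
      refine iSup_le fun j y hy => ?_
      rw [Submodule.mem_comap]
      by_cases hij : j = i
      · subst hij
        rwa [h1 j y hy]
      · rw [h2 j i hij y hy]
        exact zero_mem _
    exact this Submodule.mem_top
  · intro x hx
    obtain ⟨f, hf⟩ := (Submodule.mem_iSup_iff_exists_dfinsupp Γ x).1 (h ▸ Submodule.mem_top)
    have key : ∀ i, π i x = f i := by
      intro i
      rw [← hf]
      simp only [DFinsupp.lsum_apply_apply, DFinsupp.sumAddHom_apply, LinearMap.toAddMonoidHom_coe,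
        Submodule.subtype_apply, DFinsupp.sum, map_sum]
      rw [Finset.sum_eq_single i]
      · exact h1 i _ (f i).2
      · intro j _ hj
        exact h2 j i hj _ (f j).2
      · intro hi
        simp [DFinsupp.notMem_support_iff.1 hi]
    have : f = 0 := by
      ext i
      rw [← key i, hx i]
      rfl
    rw [← hf, this]
    simp

variable {S : LieSuperalgebra F L}

theorem IsGrading.parity_eq_iSup {G : Type*} [AddCommGroup G] {Γ : G → Submodule F L}
    (h : S.IsGrading Γ) (i : ZMod 2) : S.parity i = ⨆ g, Γ g ⊓ S.parity i := by
  have key : ∀ j, ⨆ g, Γ g ⊓ S.parity j ≤ S.parity j := fun j => iSup_le fun g => inf_le_right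
  have top : (⨆ g, Γ g ⊓ S.parity 0) ⊔ (⨆ g, Γ g ⊓ S.parity 1) = ⊤ := by
    rw [← iSup_sup_eq, ← h.iSup_eq_top]
    exact iSup_congr fun g => (h.subsuperspace g).symm
  refine le_antisymm (fun x hx => ?_) (key i)
  obtain ⟨y, hy, z, hz, rfl⟩ := Submodule.mem_sup.1 (top ▸ Submodule.mem_top (x := x))
  have hd := Submodule.disjoint_def.1 S.isCompl.disjoint
  rcases Periplectic.zmod_two i with rfl | rfl
  · have : z = 0 := hd z (by simpa using sub_mem hx (key 0 hy)) (key 1 hz)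
    simpa [this] using hy
  · have : y = 0 := hd y (key 0 hy) (by simpa using sub_mem hx (key 1 hz))
    simpa [this] using hz

/-- Multiplicativity of c is required only where a bracket is nonzero, so that characters of the
universal group, which need not come from G, also give automorphisms. -/
theorem IsGrading.exists_isAut {G : Type*} [AddCommGroup G] {Γ : G → Submodule F L}
    (h : S.IsGrading Γ) (c : G → Fˣ)
    (hc : ∀ g k, ∀ x ∈ Γ g, ∀ y ∈ Γ k, S.bracket x y ≠ 0 → c (g + k) = c g * c k) :
    ∃ θ : L ≃ₗ[F] L, S.IsAut θ ∧ ∀ g, ∀ x ∈ Γ g, θ x = (c g : F) • x := by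
  obtain ⟨f, hf⟩ := exists_diagonal_end h.indep h.iSup_eq_top fun g => (c g : F)
  obtain ⟨f', hf'⟩ := exists_diagonal_end h.indep h.iSup_eq_top fun g => ((c g)⁻¹ : F)
  let θ : L ≃ₗ[F] L := LinearEquiv.ofLinearMap f f'
    (eqOn_of_iSup_eq_top h.iSup_eq_top fun g x hx => by simp [hf' g x hx, hf g x hx])
    (eqOn_of_iSup_eq_top h.iSup_eq_top fun g x hx => by simp [hf' g x hx, hf g x hx])
  have hθ : ∀ g, ∀ x ∈ Γ g, θ x = (c g : F) • x := hf
  refine ⟨θ, ⟨fun i => ?_, ?_⟩, hθ⟩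
  · rw [h.parity_eq_iSup i, Submodule.map_iSup]
    refine iSup_congr fun g => le_antisymm ?_ ?_
    · rintro _ ⟨x, hx, rfl⟩
      rw [LinearEquiv.coe_coe, hθ g x hx.1]
      exact Submodule.smul_mem _ _ hx
    · intro x hx
      refine ⟨(c g : F)⁻¹ • x, Submodule.smul_mem _ _ hx, ?_⟩
      rw [LinearEquiv.coe_coe, map_smul, hθ g x hx.1]
      simp
  · have : S.bracket.compr₂ (θ : L →ₗ[F] L) =
        S.bracket.compl₁₂ (θ : L →ₗ[F] L) (θ : L →ₗ[F] L) := by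
      refine eqOn_of_iSup_eq_top h.iSup_eq_top fun g x hx => ?_
      refine eqOn_of_iSup_eq_top h.iSup_eq_top fun k y hy => ?_
      simp only [LinearMap.compr₂_apply, LinearEquiv.coe_coe, LinearMap.compl₁₂_apply,
        hθ g x hx, hθ k y hy, map_smul, LinearMap.smul_apply]
      by_cases h0 : S.bracket x y = 0
      · simp [h0]
      · rw [hθ _ _ (h.bracket_mem g k x y hx hy), hc g k x hx y hy h0, smul_smul, mul_comm]
        simp
    exact fun x y => LinearMap.congr_fun (LinearMap.congr_fun this x) y

theorem IsGrading.exists_isAut_character {G : Type*} [AddCommGroup G] {Γ : G → Submodule F L}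
    (h : S.IsGrading Γ) (χ : G →+ Additive Fˣ) :
    ∃ θ : L ≃ₗ[F] L, S.IsAut θ ∧ ∀ g, ∀ x ∈ Γ g, θ x = ((χ g).toMul : F) • x :=
  h.exists_isAut (fun g => (χ g).toMul) fun g k _ _ _ _ _ => by simp

/-- If some x in W has a nonzero component in degree g, the scalar by which χ acts on W must be
χ(g). For k ≠ g a character with χ(k) ≠ χ(g) then excludes a component of degree k in every element
of W. -/
theorem le_component_of_scalar [IsAlgClosed F] [CharZero F] {G : Type*} [AddCommGroup G]
    {Γ : G → Submodule F L} (hi : iSupIndep Γ) (h : ⨆ i, Γ i = ⊤) (W : Submodule F L)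
    (hW : ∀ (χ : G →+ Additive Fˣ) (θ : L ≃ₗ[F] L),
      (∀ g, ∀ x ∈ Γ g, θ x = ((χ g).toMul : F) • x) →
      S.IsAut θ → ∃ c : F, ∀ x ∈ W, θ x = c • x) (hS : S.IsGrading Γ) : ∃ g, W ≤ Γ g := by
  obtain ⟨π, h1, h2, h3, h4⟩ := exists_component_projection hi h
  by_cases hW0 : W = ⊥
  · exact ⟨0, hW0 ▸ bot_le⟩
  obtain ⟨x, hx, hx0⟩ := (Submodule.ne_bot_iff W).1 hW0
  obtain ⟨g, hg⟩ : ∃ g, π g x ≠ 0 := by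
    by_contra! hcon
    exact hx0 (h4 x hcon)
  refine ⟨g, fun y hy => ?_⟩
  have hy0 : ∀ k, k ≠ g → π k y = 0 := by
    intro k hk
    obtain ⟨χ, hχ⟩ := exists_character_ne_zero F (sub_ne_zero.2 hk)
    obtain ⟨θ, hθ, hθΓ⟩ := hS.exists_isAut_character χ
    obtain ⟨c, hc⟩ := hW χ θ hθΓ hθ
    have comm : ∀ k z, π k (θ z) = ((χ k).toMul : F) • π k z := by
      intro k z
      have : π k ∘ₗ (θ : L →ₗ[F] L) = ((χ k).toMul : F) • π k := by
        refine eqOn_of_iSup_eq_top h fun l z hz => ?_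
        simp only [LinearMap.comp_apply, LinearEquiv.coe_coe, hθΓ l z hz, map_smul,
          LinearMap.smul_apply]
        by_cases hl : l = k
        · rw [hl]
        · simp [h2 l k hl z hz]
      exact LinearMap.congr_fun this z
    have e1 := comm g x
    rw [hc x hx, map_smul, ← sub_eq_zero, ← sub_smul, smul_eq_zero, or_iff_left hg,
      sub_eq_zero] at e1
    have e2 := comm k y
    rw [hc y hy, map_smul, ← sub_eq_zero, ← sub_smul, smul_eq_zero, sub_eq_zero, e1] at e2
    refine e2.resolve_left fun hh => hχ ?_
    rw [map_sub, sub_eq_zero]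
    exact (Additive.toMul.injective (Units.ext hh)).symm
  have : y = π g y := by
    rw [← sub_eq_zero]
    refine h4 _ fun k => ?_
    rw [map_sub, sub_eq_zero]
    by_cases hk : g = k
    · subst hk
      rw [h1 g _ (h3 g y)]
    · rw [hy0 k (Ne.symm hk), h2 g k hk _ (h3 g y)]
  rw [this]
  exact h3 g y

/-- Matching every component of Δ is enough: independence of Γ leaves no room for a further nonzero
component of Γ. -/
theorem equivalent_of_forall_map_eq {G H : Type*} {Γ : G → Submodule F L} {Δ : H → Submodule F L}
    (hΓ : iSupIndep Γ) (hΔ : iSupIndep Δ) (hΔt : ⨆ t, Δ t = ⊤)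
    (φ : L ≃ₗ[F] L) (hφ : S.IsAut φ)
    (h : ∀ t ∈ support Δ, ∃ s ∈ support Γ, (Γ s).map (φ : L →ₗ[F] L) = Δ t) :
    S.Equivalent Γ Δ := by
  choose f hf hfΓ using fun t : support Δ => h t.1 t.2
  have inj : Function.Injective (fun t : support Δ => (⟨f t, hf t⟩ : support Γ)) := by
    intro t t' htt
    have e : Δ t = Δ t' := by
      rw [← hfΓ t, ← hfΓ t', show f t = f t' from Subtype.ext_iff.1 htt]
    by_contra hne
    have := hΔ.pairwiseDisjoint (Subtype.coe_ne_coe.2 hne)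
    rw [Function.onFun, e, disjoint_self] at this
    exact t'.2 this
  have surj : Function.Surjective (fun t : support Δ => (⟨f t, hf t⟩ : support Γ)) := by
    intro s
    by_contra! hcon
    -- If s were missed, the other components of Γ would already fill the space, so Γ s would vanish
    -- by independence.
    have top : ⨆ s' ≠ s.1, Γ s' = ⊤ := by
      rw [eq_top_iff, ← Submodule.map_le_map_iff_of_injective
        (f := (φ : L →ₗ[F] L)) φ.injective]
      refine le_top.trans ?_
      rw [← hΔt]
      refine iSup_le fun t => ?_
      by_cases ht : Δ t = ⊥
      · rw [ht]
        exact bot_le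
      rw [← hfΓ ⟨t, ht⟩]
      refine Submodule.map_mono (le_iSup₂_of_le (f ⟨t, ht⟩) ?_ le_rfl)
      exact fun hh => hcon ⟨t, ht⟩ (Subtype.ext hh)
    have := hΓ s.1
    rw [top, disjoint_top] at this
    exact s.2 this
  let E := Equiv.ofBijective _ (And.intro inj surj : Function.Bijective _)
  refine ⟨φ, hφ, E.symm, fun s => ?_⟩
  obtain ⟨t, rfl⟩ := E.surjective s
  rw [Equiv.symm_apply_apply]
  exact hfΓ t

theorem IsAut.symm {φ : L ≃ₗ[F] L} (h : S.IsAut φ) : S.IsAut φ.symm := by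
  refine ⟨fun i => ?_, fun x y => ?_⟩
  · conv_lhs => rw [← h.1 i]
    ext x
    simp
  · rw [LinearEquiv.symm_apply_eq, h.2]
    simp

theorem IsAut.trans {φ ψ : L ≃ₗ[F] L} (h : S.IsAut φ) (k : S.IsAut ψ) : S.IsAut (φ.trans ψ) := by
  refine ⟨fun i => ?_, fun x y => ?_⟩
  · rw [LinearEquiv.coe_trans, Submodule.map_comp, h.1, k.1]
  · simp [h.2, k.2]

theorem Equivalent.symm {G H : Type*} {Γ : G → Submodule F L} {Δ : H → Submodule F L}
    (h : S.Equivalent Γ Δ) : S.Equivalent Δ Γ := by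
  obtain ⟨φ, hφ, α, hα⟩ := h
  refine ⟨φ.symm, hφ.symm, α.symm, fun t => ?_⟩
  obtain ⟨s, rfl⟩ := α.surjective t
  rw [← hα, Equiv.symm_apply_apply]
  ext x
  simp

theorem Equivalent.trans {G H K : Type*} {Γ : G → Submodule F L} {Δ : H → Submodule F L}
    {Θ : K → Submodule F L} (h : S.Equivalent Γ Δ) (k : S.Equivalent Δ Θ) : S.Equivalent Γ Θ := by
  obtain ⟨φ, hφ, α, hα⟩ := h
  obtain ⟨ψ, hψ, β, hβ⟩ := k
  refine ⟨φ.trans ψ, hφ.trans hψ, α.trans β, fun s => ?_⟩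
  rw [LinearEquiv.coe_trans, Submodule.map_comp, hα, hβ]
  rfl

/-- Transport of a grading along an automorphism. -/
theorem IsGrading.map {G : Type*} [AddCommGroup G] {Γ : G → Submodule F L} (h : S.IsGrading Γ)
    {φ : L ≃ₗ[F] L} (hφ : S.IsAut φ) :
    S.IsGrading fun g => (Γ g).map (φ : L →ₗ[F] L) where
  indep := h.indep.map_orderIso (Submodule.orderIsoMapComap φ)
  iSup_eq_top := by
    rw [← Submodule.map_iSup, h.iSup_eq_top, Submodule.map_top, LinearEquiv.range]
  subsuperspace g := by
    conv_lhs => rw [h.subsuperspace g]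
    rw [Submodule.map_sup, Submodule.map_inf _ φ.injective, Submodule.map_inf _ φ.injective,
      hφ.1, hφ.1]
  bracket_mem := by
    rintro g k _ _ ⟨x, hx, rfl⟩ ⟨y, hy, rfl⟩
    exact ⟨_, h.bracket_mem g k x y hx hy, hφ.2 x y⟩

/-- The grading obtained by relabelling the components along an isomorphism of groups. -/
theorem IsGrading.comp_addEquiv {G H : Type*} [AddCommGroup G] [AddCommGroup H]
    {Γ : G → Submodule F L} (h : S.IsGrading Γ) (f : H ≃+ G) : S.IsGrading (Γ ∘ f) where
  indep := h.indep.comp f.injective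
  iSup_eq_top := by
    rw [← h.iSup_eq_top]
    exact f.toEquiv.iSup_comp (g := Γ)
  subsuperspace g := h.subsuperspace (f g)
  bracket_mem g k x y hx hy := by
    rw [Function.comp_apply, map_add]
    exact h.bracket_mem _ _ x y hx hy

/-- A fine grading is equivalent to every grading that is mapped to a refinement of it by an
automorphism. -/
theorem IsFine.equivalent {G : Type*} [AddCommGroup G] {H : Type} [AddCommGroup H]
    {Γ : G → Submodule F L} {Δ : H → Submodule F L} (hΓ : IsFine.{w} S Γ) (hΔ : S.IsGrading Δ)
    {φ : L ≃ₗ[F] L} (hφ : S.IsAut φ)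
    (href : ∀ t, ∃ s, (Δ t).map (φ : L →ₗ[F] L) ≤ Γ s) : S.Equivalent Γ Δ := by
  refine Equivalent.symm ?_
  have hΔ' := hΔ.map hφ
  suffices S.Equivalent Γ fun g => (Δ g).map (φ : L →ₗ[F] L) by
    refine Equivalent.symm (this.trans (Equivalent.symm ⟨φ, hφ, ?_⟩))
    refine ⟨Equiv.subtypeEquivRight fun g => ?_, fun s => rfl⟩
    simp [support, Submodule.map_eq_bot_iff]
  have key : ∀ t ∈ support (fun g => (Δ g).map (φ : L →ₗ[F] L)), ∃ s ∈ support Γ,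
      (Δ t).map (φ : L →ₗ[F] L) ≤ Γ s := by
    intro t ht
    obtain ⟨s, hs⟩ := href t
    exact ⟨s, fun h0 => ht (le_bot_iff.1 (h0 ▸ hs)), hs⟩
  refine equivalent_of_forall_map_eq hΓ.1.indep hΔ'.indep hΔ'.iSup_eq_top (LinearEquiv.refl F L)
    ⟨fun i => by simp, fun x y => rfl⟩ fun t ht => ?_
  obtain ⟨s, hs, hle⟩ := key t ht
  refine ⟨s, hs, ?_⟩
  rw [LinearEquiv.refl_toLinearMap, Submodule.map_id]
  by_contra hne
  -- Fineness is tested against groups in universe w, so the group H has to be lifted there.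
  refine hΓ.2 (ULift.{w} H) _ (hΔ'.comp_addEquiv AddEquiv.ulift) ⟨fun t ht => key t.down ht, ?_⟩
  exact ⟨⟨t⟩, ht, s, hs, lt_of_le_of_ne hle (Ne.symm hne)⟩

end LieSuperalgebra

/-! ### Brackets in P(n) and the intrinsic description of the squares vvᵀ -/

namespace Periplectic

open Matrix

variable (F : Type*) [Field F] [CharZero F] (I : Type*) [Fintype I]

/-- The Lie superalgebra `P(n)` with `n + 1 = |I|`. -/
def periplectic : LieSuperalgebra F (space F I) :=
  (gl F I).restrict (space F I) (space_super F I) (space_bracket F I)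

variable {F I}

theorem periplectic_bracket (x y : space F I) :
    ((periplectic F I).bracket x y : Mat F I) = superBracket (x : Mat F I) (y : Mat F I) := rfl

theorem superBracket_fromBlocks (a b c d a' b' c' d' : Matrix I I F) :
    superBracket (fromBlocks a b c d) (fromBlocks a' b' c' d') =
      fromBlocks (a * a' - a' * a + b * c' + b' * c) (a * b' + b * d' - a' * b - b' * d)
        (c * a' + d * c' - c' * a - d' * c) (c * b' + d * d' - d' * d + c' * b) := by
  rw [superBracket_apply]
  simp only [ev, od, toBlocks_fromBlocks₁₁, toBlocks_fromBlocks₁₂, toBlocks_fromBlocks₂₁,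
    toBlocks_fromBlocks₂₂, fromBlocks_multiply, fromBlocks_add, fromBlocks_neg, sub_eq_add_neg]
  congr 1 <;> noncomm_ring

/-- The even element with diagonal blocks `a` and `-aᵀ`. -/
def evenElt (a : Matrix I I F) (ha : a.trace = 0) : space F I :=
  ⟨fromBlocks a 0 0 (-aᵀ), (mem_space F I).2 ⟨ha, by simp, by simp, rfl⟩⟩

/-- The odd element with upper right block `b` and lower left block `c`. -/
def oddElt (b c : Matrix I I F) (hb : bᵀ = b) (hc : cᵀ = -c) : space F I :=
  ⟨fromBlocks 0 b c 0, (mem_space F I).2 ⟨by simp, hb, hc, by simp⟩⟩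

theorem exists_eq_add (x : space F I) : ∃ a ha b c hb hc,
    x = evenElt a ha + oddElt b c hb hc := by
  obtain ⟨x, hx⟩ := x
  obtain ⟨a, b, c, d, rfl⟩ : ∃ a b c d, x = fromBlocks a b c d :=
    ⟨_, _, _, _, (fromBlocks_toBlocks x).symm⟩
  obtain ⟨h1, h2, h3, rfl⟩ := (mem_space F I).1 hx
  exact ⟨a, h1, b, c, h2, h3, Subtype.ext (by simp [evenElt, oddElt, fromBlocks_add])⟩

theorem mem_parity_zero {x : space F I} :
    x ∈ (periplectic F I).parity 0 ↔ ∃ a ha, x = evenElt a ha := by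
  constructor
  · intro hx
    obtain ⟨a, ha, b, c, hb, hc, rfl⟩ := exists_eq_add x
    have := mem_matParity_zero.1 (show (evenElt a ha + oddElt b c hb hc).1 ∈ matParity F I 0 from hx)
    simp [evenElt, oddElt, fromBlocks_add] at this
    exact ⟨a, ha, Subtype.ext (by simp [evenElt, oddElt, this])⟩
  · rintro ⟨a, ha, rfl⟩
    exact mem_matParity_zero.2 (by simp [evenElt])

theorem mem_parity_one {x : space F I} :
    x ∈ (periplectic F I).parity 1 ↔ ∃ b c hb hc, x = oddElt b c hb hc := by
  constructor
  · intro hx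
    obtain ⟨a, ha, b, c, hb, hc, rfl⟩ := exists_eq_add x
    have := mem_matParity_one.1 (show (evenElt a ha + oddElt b c hb hc).1 ∈ matParity F I 1 from hx)
    simp [evenElt, oddElt, fromBlocks_add] at this
    exact ⟨b, c, hb, hc, Subtype.ext (by simp [evenElt, oddElt, this])⟩
  · rintro ⟨b, c, hb, hc, rfl⟩
    exact mem_matParity_one.2 (by simp [oddElt])

theorem evenElt_inj {a a' : Matrix I I F} {ha ha'} :
    evenElt a ha = evenElt a' ha' ↔ a = a' := by
  refine ⟨fun h => ?_, fun h => by subst h; rfl⟩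
  simpa [evenElt] using congrArg (fun x => toBlocks₁₁ x.1) h

theorem oddElt_inj {b c b' c' : Matrix I I F} {hb hc hb' hc'} :
    oddElt b c hb hc = oddElt b' c' hb' hc' ↔ b = b' ∧ c = c' := by
  refine ⟨fun h => ⟨?_, ?_⟩, fun h => ?_⟩
  · simpa [oddElt] using congrArg (fun x => toBlocks₁₂ x.1) h
  · simpa [oddElt] using congrArg (fun x => toBlocks₂₁ x.1) h
  · obtain ⟨rfl, rfl⟩ := h
    rfl

theorem bracket_even_even (a a' : Matrix I I F) (ha ha') :
    (periplectic F I).bracket (evenElt a ha) (evenElt a' ha') =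
      evenElt (a * a' - a' * a) (by rw [trace_sub, trace_mul_comm, sub_self]) := by
  refine Subtype.ext ?_
  rw [periplectic_bracket]
  simp only [evenElt, superBracket_fromBlocks]
  congr 1 <;> simp

theorem bracket_even_odd (a b c : Matrix I I F) (ha hb hc) :
    (periplectic F I).bracket (evenElt a ha) (oddElt b c hb hc) =
      oddElt (a * b + b * aᵀ) (-(aᵀ * c + c * a)) (by simp [hb, add_comm])
        (by simp [hc, add_comm]) := by
  refine Subtype.ext ?_
  rw [periplectic_bracket]
  simp only [evenElt, oddElt, superBracket_fromBlocks]
  congr 1 <;> simp; abel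

theorem bracket_odd_odd (b c b' c' : Matrix I I F) (hb hc hb' hc') :
    (periplectic F I).bracket (oddElt b c hb hc) (oddElt b' c' hb' hc') =
      evenElt (b * c' + b' * c)
        (by rw [trace_add, trace_mul_eq_zero F I hb hc', trace_mul_eq_zero F I hb' hc, add_zero]) := by
  refine Subtype.ext ?_
  rw [periplectic_bracket]
  simp only [evenElt, oddElt, superBracket_fromBlocks]
  congr 1 <;> simp [hb, hc, hb', hc']

/-- An odd element squaring the brackets with which to zero in the sense below is
`(0, v vᵀ; 0, 0)` for some vector `v`. -/
theorem isRankOne_iff [DecidableEq I] [IsAlgClosed F] (hI : 3 ≤ Fintype.card I)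
    {b c : Matrix I I F} (hb : bᵀ = b) (hc : cᵀ = -c) :
    (∀ y ∈ (periplectic F I).parity 1, ∀ y' ∈ (periplectic F I).parity 1,
      (periplectic F I).bracket ((periplectic F I).bracket (oddElt b c hb hc) y)
        ((periplectic F I).bracket (oddElt b c hb hc) y') = 0) ↔
    c = 0 ∧ ∃ v : I → F, b = vecMulVec v v := by
  have key : (∀ y ∈ (periplectic F I).parity 1, ∀ y' ∈ (periplectic F I).parity 1,
      (periplectic F I).bracket ((periplectic F I).bracket (oddElt b c hb hc) y)
        ((periplectic F I).bracket (oddElt b c hb hc) y') = 0) ↔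
      ∀ b' c' : Matrix I I F, b'ᵀ = b' → c'ᵀ = -c' → ∀ b'' c'' : Matrix I I F,
        b''ᵀ = b'' → c''ᵀ = -c'' →
        (b * c' + b' * c) * (b * c'' + b'' * c) = (b * c'' + b'' * c) * (b * c' + b' * c) := by
    have e0 : (0 : space F I) = evenElt 0 (by simp) := Subtype.ext (by simp [evenElt])
    constructor
    · intro h b' c' hb' hc' b'' c'' hb'' hc''
      have := h _ (mem_parity_one.2 ⟨b', c', hb', hc', rfl⟩) _
        (mem_parity_one.2 ⟨b'', c'', hb'', hc'', rfl⟩)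
      rwa [bracket_odd_odd, bracket_odd_odd, bracket_even_even, e0, evenElt_inj, sub_eq_zero] at this
    · intro h y hy y' hy'
      obtain ⟨b', c', hb', hc', rfl⟩ := mem_parity_one.1 hy
      obtain ⟨b'', c'', hb'', hc'', rfl⟩ := mem_parity_one.1 hy'
      rw [bracket_odd_odd, bracket_odd_odd, bracket_even_even, e0, evenElt_inj, sub_eq_zero]
      exact h b' c' hb' hc' b'' c'' hb'' hc''
  rw [key]
  clear key
  constructor
  · intro h
    have hc0 : c = 0 := by
      ext i j
      by_cases hij : i = j
      · subst hij
        have := congrFun (congrFun hc i) i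
        exact self_eq_neg.1 this
      -- For b' = E_ii and b'' = E_jj the (i, i) entry of the identity reads c_ij c_ji = 0, that is,
      -- c_ij² = 0.
      have := congrFun (congrFun (h (single i i 1) 0 (by simp) (by simp) (single j j 1) 0 (by simp)
        (by simp)) i) i
      simp only [mul_zero, zero_add] at this
      rw [← mul_assoc, ← mul_assoc, single_mul_mul_single, single_mul_mul_single] at this
      have hji : c j i = - c i j := congrFun (congrFun hc i) j
      simpa [Matrix.single_mul_apply_same, Matrix.single_mul_apply_of_ne, hij, hji] using this
    subst hc0
    refine ⟨rfl, ?_⟩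
    have hs : ∀ i j, b i j = b j i := fun i j => congrFun (congrFun hb j) i
    have h2 : ∀ l i j, b l i * b i j = b i i * b l j := by
      intro l i j
      by_cases hij : i = j
      · subst hij
        ring
      -- A third index, available because n ≥ 2.
      obtain ⟨k, hki, hkj⟩ : ∃ k, k ≠ i ∧ k ≠ j := by
        by_contra! hcon
        have : (Finset.univ : Finset I) ⊆ {i, j} := fun k _ => by
          by_cases hk : k = i
          · simp [hk]
          · simp [hcon k hk]
        have := (Finset.card_le_card this).trans Finset.card_le_two
        rw [Finset.card_univ] at this
        omega
      -- For c' = E_ij - E_ji and c'' = E_ik - E_ki the (l, k) entry gives the vanishing of a 2 × 2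
      -- minor of b. The other side contributes nothing, as column k of c' is zero.
      have := congrFun (congrFun (h 0 (single i j 1 - single j i 1) (by simp) (by simp)
        0 (single i k 1 - single k i 1) (by simp) (by simp)) l) k
      simp only [mul_zero, add_zero, mul_sub, sub_mul] at this
      simp only [Matrix.mul_assoc] at this
      simp only [← Matrix.mul_assoc (single _ _ _)] at this
      simp only [single_mul_mul_single, Matrix.sub_apply] at this
      simp [Matrix.mul_single_apply_same, Matrix.mul_single_apply_of_ne, hki, hkj,
        Ne.symm hki, Ne.symm hkj] at this
      rw [hs j i] at this
      linear_combination this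
    by_cases hd : ∃ i, b i i ≠ 0
    · obtain ⟨i, hi⟩ := hd
      obtain ⟨r, hr⟩ := IsAlgClosed.exists_eq_mul_self (b i i)
      have hr0 : r ≠ 0 := by
        rintro rfl
        exact hi (by simpa using hr)
      -- With b_ii = r² the vector v is the i-th column of b divided by r.
      refine ⟨fun j => b j i / r, ?_⟩
      ext l j
      rw [vecMulVec_apply]
      have := h2 l i j
      rw [hs i j, hr] at this
      field_simp
      linear_combination -this
    · push Not at hd
      refine ⟨0, ?_⟩
      ext i j
      have := h2 j i j
      rw [hd, hs j i, zero_mul, mul_self_eq_zero] at this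
      simp [this]
  · rintro ⟨rfl, v, rfl⟩ b' c' - hc' b'' c'' - hc''
    -- The bracket with (0, vvᵀ; 0, 0) is the even element of vvᵀc', and (vvᵀc')(vvᵀc'') contains
    -- the factor vᵀc'v, which vanishes for skew-symmetric c'.
    have h0 : ∀ c : Matrix I I F, cᵀ = -c → v ᵥ* c ⬝ᵥ v = 0 := by
      intro c hc
      have : v ᵥ* c ⬝ᵥ v = -(v ᵥ* c ⬝ᵥ v) := by
        conv_lhs => rw [← transpose_transpose c, hc, transpose_neg, vecMul_neg, vecMul_transpose,
          neg_dotProduct, dotProduct_comm, dotProduct_mulVec]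
      exact self_eq_neg.1 this
    simp only [mul_zero, add_zero, vecMulVec_mul, vecMul_vecMulVec, h0 c' hc', h0 c'' hc'',
      zero_smul]

end Periplectic

/-! ### Linear maps of symmetric matrices preserving squares -/

namespace Periplectic

open Matrix

section SymmetricTensors

variable {F : Type*} [Field F] {I : Type*}

/-- The symmetrized tensor product of two vectors. -/
def symTensor (v w : I → F) : Matrix I I F := vecMulVec v w + vecMulVec w v

theorem symTensor_apply (v w : I → F) (i j : I) :
    symTensor v w i j = v i * w j + w i * v j := rfl

theorem symTensor_comm (v w : I → F) : symTensor v w = symTensor w v := add_comm _ _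

theorem transpose_symTensor (v w : I → F) : (symTensor v w)ᵀ = symTensor v w := by
  simp [symTensor, transpose_vecMulVec, add_comm]

theorem symTensor_left_injective [CharZero F] {x y v : I → F} (hv : v ≠ 0)
    (h : symTensor x v = symTensor y v) : x = y := by
  obtain ⟨i, hi⟩ := Function.ne_iff.1 hv
  have hi' : v i ≠ 0 := hi
  have key : ∀ k l, x k * v l + v k * x l = y k * v l + v k * y l := fun k l =>
    congrFun (congrFun h k) l
  have h1 : x i = y i := by
    have := key i i
    have h2 : 2 * v i * (x i - y i) = 0 := by linear_combination this
    have h3 : (2 : F) * v i ≠ 0 := mul_ne_zero two_ne_zero hi'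
    exact sub_eq_zero.1 ((mul_eq_zero.1 h2).resolve_left h3)
  ext j
  have := key j i
  rw [h1] at this
  exact mul_right_cancel₀ hi' (by linear_combination this)

theorem eq_or_eq_neg_of_vecMulVec_self {v w : I → F} (h : vecMulVec v v = vecMulVec w w) :
    v = w ∨ v = -w := by
  have key : ∀ i j, v i * v j = w i * w j := fun i j => congrFun (congrFun h i) j
  by_cases hv : v = 0
  · left
    subst hv
    ext i
    have := key i i
    simp only [Pi.zero_apply, mul_zero, zero_eq_mul, or_self] at this
    simp [this]
  obtain ⟨i, hi⟩ := Function.ne_iff.1 hv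
  have hi' : v i ≠ 0 := hi
  rcases mul_self_eq_mul_self_iff.1 (key i i) with h1 | h1
  · left
    ext j
    have := key i j
    rw [h1] at this hi'
    exact mul_left_cancel₀ hi' this
  · right
    ext j
    have := key i j
    rw [h1] at this hi'
    exact mul_left_cancel₀ hi' (by simpa using this)

variable [Fintype I]

theorem exists_dotProduct_ne_zero [DecidableEq I] {a q : I → F}
    (h : a ∉ Submodule.span F {q}) : ∃ φ : I → F, φ ⬝ᵥ q = 0 ∧ φ ⬝ᵥ a ≠ 0 := by
  obtain ⟨f, hf, hq⟩ := Submodule.exists_le_ker_of_notMem h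
  have key : ∀ v, (fun i => f (Pi.single i 1)) ⬝ᵥ v = f v := by
    intro v
    rw [LinearMap.pi_apply_eq_sum_univ f v]
    simp only [dotProduct, smul_eq_mul]
    refine Finset.sum_congr rfl fun i _ => ?_
    rw [mul_comm]
    congr 2
    ext j
    simp [Pi.single_apply, eq_comm]
  refine ⟨fun i => f (Pi.single i 1), ?_, ?_⟩
  · rw [key]
    exact hq (Submodule.mem_span_singleton_self q)
  · rwa [key]

theorem dotProduct_symTensor (φ v w : I → F) :
    φ ⬝ᵥ (symTensor v w *ᵥ φ) = 2 * ((φ ⬝ᵥ v) * (φ ⬝ᵥ w)) := by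
  simp only [symTensor, add_mulVec, vecMulVec_mulVec, dotProduct_add, op_smul_eq_smul,
    dotProduct_smul, smul_eq_mul]
  rw [dotProduct_comm v, dotProduct_comm w]
  ring

theorem dotProduct_vecMulVec (φ v w : I → F) :
    φ ⬝ᵥ (vecMulVec v w *ᵥ φ) = (φ ⬝ᵥ v) * (φ ⬝ᵥ w) := by
  simp only [vecMulVec_mulVec, op_smul_eq_smul, dotProduct_smul, smul_eq_mul]
  rw [dotProduct_comm w, mul_comm]

/-- Unique factorization of the quadratic form φ ↦ (φ·a)(φ·b): the functionals killing q all kill a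
or b. A vector space is not a union of two proper subspaces, so all of them kill the same one of the
two vectors. -/
theorem mem_span_or_of_symTensor_eq [DecidableEq I] [CharZero F] {a b x q : I → F}
    (ha : a ≠ 0) (hb : b ≠ 0) (h : symTensor a b = symTensor x q) :
    q ∈ Submodule.span F {a} ∨ q ∈ Submodule.span F {b} := by
  by_cases hq : q = 0
  · simp [hq]
  have swap : ∀ {c : I → F}, c ≠ 0 → c ∈ Submodule.span F {q} → q ∈ Submodule.span F {c} := by
    intro c hc h
    obtain ⟨t, rfl⟩ := Submodule.mem_span_singleton.1 h
    have ht : t ≠ 0 := by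
      rintro rfl
      simp at hc
    exact Submodule.mem_span_singleton.2 ⟨t⁻¹, by rw [smul_smul, inv_mul_cancel₀ ht, one_smul]⟩
  by_contra! hcon
  obtain ⟨f, hf, hfa⟩ := exists_dotProduct_ne_zero fun hh => hcon.1 (swap ha hh)
  obtain ⟨g, hg, hgb⟩ := exists_dotProduct_ne_zero fun hh => hcon.2 (swap hb hh)
  have key : ∀ φ : I → F, φ ⬝ᵥ q = 0 → (φ ⬝ᵥ a) * (φ ⬝ᵥ b) = 0 := by
    intro φ hφ
    have := congrArg (fun M => φ ⬝ᵥ (M *ᵥ φ)) h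
    simp only [dotProduct_symTensor, hφ, mul_zero] at this
    simpa using this
  have h1 := (mul_eq_zero.1 (key f hf)).resolve_left hfa
  have h2 := (mul_eq_zero.1 (key g hg)).resolve_right hgb
  have h3 := key (f + g) (by simp [add_dotProduct, hf, hg])
  simp [add_dotProduct, h1, h2, hfa, hgb] at h3

/-- A linear map on symmetric matrices preserving rank one matrices `v vᵀ` and the tangent spaces
at them is a congruence. -/
theorem exists_congruence [DecidableEq I] [Nonempty I] [CharZero F]
    (τ : Matrix I I F →ₗ[F] Matrix I I F)
    (h1 : ∀ v, ∃ v', τ (vecMulVec v v) = vecMulVec v' v')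
    (h2 : ∀ v v', v ≠ 0 → τ (vecMulVec v v) = vecMulVec v' v' →
      ∀ w, ∃ x, τ (symTensor w v) = symTensor x v')
    (h3 : ∀ b, bᵀ = b → τ b = 0 → b = 0) :
    ∃ u : Matrix I I F, ∀ v, τ (vecMulVec v v) = vecMulVec (u *ᵥ v) (u *ᵥ v) := by
  obtain ⟨i₀⟩ := ‹Nonempty I›
  let e : I → F := Pi.single i₀ 1
  have he : e ≠ 0 := by simp [e]
  obtain ⟨v₁, hv₁⟩ := h1 e
  have hv₁0 : v₁ ≠ 0 := by
    rintro rfl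
    have := h3 _ (transpose_vecMulVec e e) (by simpa using hv₁)
    simp [he] at this
  -- The tangent space at the fixed square eeᵀ defines the candidate U. Injectivity of x ↦
  -- `symTensor x v₁` makes it linear.
  choose U hU using h2 e v₁ he hv₁
  have hUadd : ∀ w w', U (w + w') = U w + U w' := by
    intro w w'
    refine symTensor_left_injective hv₁0 ?_
    rw [← hU]
    have e1 : ∀ x y z : I → F, symTensor (x + y) z = symTensor x z + symTensor y z := by
      intro x y z
      simp only [symTensor, add_vecMulVec, vecMulVec_add]
      abel
    rw [e1, map_add, hU, hU, e1]
  have hUsmul : ∀ (c : F) w, U (c • w) = c • U w := by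
    intro c w
    refine symTensor_left_injective hv₁0 ?_
    rw [← hU]
    have e1 : ∀ (c : F) (y z : I → F), symTensor (c • y) z = c • symTensor y z := by
      intro x y z
      simp only [symTensor, smul_vecMulVec, vecMulVec_smul, smul_add]
    rw [e1, map_smul, hU, e1]
  have hUe : U e = v₁ := by
    refine symTensor_left_injective hv₁0 ?_
    rw [← hU, symTensor, map_add, hv₁]
    rfl
  have hU0 : ∀ w, U w = 0 → w = 0 := by
    intro w hw
    have := hU w
    rw [hw] at this
    have := h3 _ (transpose_symTensor w e) (by rw [this]; simp [symTensor])
    exact symTensor_left_injective he (by rw [this]; simp [symTensor])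
  have sq_inj : ∀ v w, τ (vecMulVec v v) = τ (vecMulVec w w) → v = w ∨ v = -w := by
    intro v w h
    refine eq_or_eq_neg_of_vecMulVec_self (sub_eq_zero.1 (h3 _ ?_ ?_))
    · simp [transpose_vecMulVec]
    · rw [map_sub, h, sub_self]
  have sq_smul : ∀ (t : F) (v : I → F), vecMulVec (t • v) (t • v) = (t * t) • vecMulVec v v := by
    intro t v
    rw [smul_vecMulVec, vecMulVec_smul, smul_smul]
  -- If τ(wwᵀ) = qqᵀ, the image of the symmetric product of e and w is both that of U w with v₁ and
  -- that of some x with q. So q is a multiple of U w or of v₁, and the latter would put w on the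
  -- line of e.
  have scal : ∀ w, w ∉ Submodule.span F {e} → ∃ α : F,
      τ (vecMulVec w w) = (α * α) • vecMulVec (U w) (U w) := by
    intro w hw
    have hw0 : w ≠ 0 := fun h => hw (h ▸ zero_mem _)
    obtain ⟨q, hq⟩ := h1 w
    obtain ⟨x, hx⟩ := h2 w q hw0 hq e
    rw [symTensor_comm, hU] at hx
    rcases mem_span_or_of_symTensor_eq (fun h => hw0 (hU0 w h)) hv₁0 hx with h | h
    · obtain ⟨α, rfl⟩ := Submodule.mem_span_singleton.1 h
      exact ⟨α, by rw [hq, sq_smul]⟩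
    · obtain ⟨α, rfl⟩ := Submodule.mem_span_singleton.1 h
      rw [sq_smul, ← hv₁, ← map_smul, ← sq_smul] at hq
      refine absurd ?_ hw
      rcases sq_inj _ _ hq with rfl | rfl
      · exact Submodule.smul_mem _ _ (Submodule.mem_span_singleton_self e)
      · exact neg_mem (Submodule.smul_mem _ _ (Submodule.mem_span_singleton_self e))
  let UL : (I → F) →ₗ[F] (I → F) := ⟨⟨U, hUadd⟩, hUsmul⟩
  refine ⟨LinearMap.toMatrix' UL, fun w => ?_⟩
  rw [LinearMap.toMatrix'_mulVec]
  change _ = vecMulVec (U w) (U w)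
  by_cases hw : w ∈ Submodule.span F {e}
  · obtain ⟨t, rfl⟩ := Submodule.mem_span_singleton.1 hw
    rw [hUsmul, hUe, sq_smul, sq_smul, map_smul, hv₁]
  -- It remains to see α² = 1. Expanding the square of w + e and evaluating at a functional killing
  -- v₁ but not U w gives α² = γ²; one killing U w but not v₁ gives γ² = 1.
  obtain ⟨α, hα⟩ := scal w hw
  obtain ⟨γ, hγ⟩ := scal (w + e) fun h => hw (by
    simpa using sub_mem h (Submodule.mem_span_singleton_self e))
  have hexp : ∀ x y : I → F, vecMulVec (x + y) (x + y) =
      vecMulVec x x + symTensor x y + vecMulVec y y := by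
    intro x y
    simp only [symTensor, add_vecMulVec, vecMulVec_add]
    abel
  rw [hUadd, hexp, map_add, map_add, hα, hv₁, hU, hUe] at hγ
  have hi1 : U w ∉ Submodule.span F {v₁} := by
    intro h
    obtain ⟨t, ht⟩ := Submodule.mem_span_singleton.1 h
    refine hw (Submodule.mem_span_singleton.2 ⟨t, ?_⟩)
    have := hU0 (w - t • e) (by rw [sub_eq_add_neg, ← neg_smul, hUadd, hUsmul, hUe, ← ht]; simp)
    exact (sub_eq_zero.1 this).symm
  have hi2 : v₁ ∉ Submodule.span F {U w} := by
    intro h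
    obtain ⟨t, ht⟩ := Submodule.mem_span_singleton.1 h
    have ht0 : t ≠ 0 := by
      rintro rfl
      exact hv₁0 (by simpa using ht.symm)
    exact hi1 (Submodule.mem_span_singleton.2 ⟨t⁻¹, by rw [← ht, smul_smul, inv_mul_cancel₀ ht0,
      one_smul]⟩)
  obtain ⟨f, hf, hf'⟩ := exists_dotProduct_ne_zero hi1
  obtain ⟨g, hg, hg'⟩ := exists_dotProduct_ne_zero hi2
  have key : ∀ φ : I → F, (α * α) * ((φ ⬝ᵥ U w) * (φ ⬝ᵥ U w)) +
      2 * ((φ ⬝ᵥ U w) * (φ ⬝ᵥ v₁)) + (φ ⬝ᵥ v₁) * (φ ⬝ᵥ v₁) =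
      (γ * γ) * ((φ ⬝ᵥ (U w + v₁)) * (φ ⬝ᵥ (U w + v₁))) := by
    intro φ
    have := congrArg (fun M => φ ⬝ᵥ (M *ᵥ φ)) hγ
    simpa only [add_mulVec, smul_mulVec, dotProduct_add, dotProduct_smul, smul_eq_mul,
      dotProduct_vecMulVec, dotProduct_symTensor] using this
  have k1 := key f
  have k2 := key g
  simp only [dotProduct_add, hf, hg, mul_zero, add_zero, zero_add, zero_mul] at k1 k2
  have hγ1 : γ * γ = 1 := mul_right_cancel₀ (mul_ne_zero hg' hg') (by rw [← k2, one_mul])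
  have hα1 : α * α = γ * γ := mul_right_cancel₀ (mul_ne_zero hf' hf') k1
  rw [hα, hα1, hγ1, one_smul]

/-- By polarization the squares vvᵀ span the symmetric matrices, so the congruence found on squares
holds everywhere. A kernel vector v of u would give τ(vvᵀ) = 0. -/
theorem exists_congruence_of_isSymm [DecidableEq I] [Nonempty I] [CharZero F]
    (τ : Matrix I I F →ₗ[F] Matrix I I F)
    (h1 : ∀ v, ∃ v', τ (vecMulVec v v) = vecMulVec v' v')
    (h2 : ∀ v v', v ≠ 0 → τ (vecMulVec v v) = vecMulVec v' v' →
      ∀ w, ∃ x, τ (symTensor w v) = symTensor x v')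
    (h3 : ∀ b, bᵀ = b → τ b = 0 → b = 0) :
    ∃ u : Matrix I I F, IsUnit u ∧ ∀ b, bᵀ = b → τ b = u * b * uᵀ := by
  obtain ⟨u, hu⟩ := exists_congruence τ h1 h2 h3
  refine ⟨u, ?_, ?_⟩
  · rw [← Matrix.mulVec_injective_iff_isUnit]
    refine (injective_iff_map_eq_zero (Matrix.mulVecLin u)).2 fun v hv => ?_
    have := h3 _ (transpose_vecMulVec v v) (by rw [hu, show u *ᵥ v = 0 from hv]; simp)
    simpa using this
  · have hs : ∀ v w, τ (symTensor v w) = u * symTensor v w * uᵀ := by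
      intro v w
      have e1 : symTensor v w = vecMulVec (v + w) (v + w) - vecMulVec v v - vecMulVec w w := by
        simp only [symTensor, add_vecMulVec, vecMulVec_add]
        abel
      have e2 : ∀ v, τ (vecMulVec v v) = u * vecMulVec v v * uᵀ := by
        intro v
        rw [hu, mul_vecMulVec, vecMulVec_mul, vecMul_transpose]
      rw [e1, map_sub, map_sub, e2, e2, e2]
      noncomm_ring
    intro b hb
    have e1 : (2 : F) • b = ∑ i, ∑ j, b i j • symTensor (Pi.single i 1) (Pi.single j 1) := by
      have e2 : ∀ i j : I, symTensor (Pi.single i (1 : F)) (Pi.single j 1) =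
          single i j 1 + (single i j 1)ᵀ := by
        intro i j
        rw [symTensor, ← transpose_vecMulVec (Pi.single i (1 : F)), ← single_eq_single_vecMulVec_single]
      simp only [e2, smul_add, Finset.sum_add_distrib, ← transpose_smul, ← transpose_sum]
      simp only [smul_single, smul_eq_mul, mul_one, ← matrix_eq_sum_single b, hb, two_smul]
    have e3 : (2 : F) • τ b = (2 : F) • (u * b * uᵀ) := by
      rw [← map_smul, e1]
      simp only [map_sum, map_smul, hs]
      rw [← smul_mul_assoc, ← mul_smul_comm, e1, Finset.mul_sum, Finset.sum_mul]
      refine Finset.sum_congr rfl fun i _ => ?_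
      rw [Finset.mul_sum, Finset.sum_mul]
      refine Finset.sum_congr rfl fun j _ => ?_
      rw [mul_smul_comm, smul_mul_assoc]
    exact smul_right_injective _ two_ne_zero e3

end SymmetricTensors

end Periplectic

/-! ### Conjugation automorphisms -/

namespace Periplectic

open Matrix

variable {F : Type*} [Field F] [CharZero F] {I : Type*} [Fintype I] [DecidableEq I]

/-- The block diagonal matrix with blocks `u` and `z (u⁻¹)ᵀ`. -/
def conjugator (u : (Matrix I I F)ˣ) (z : Fˣ) : (Mat F I)ˣ where
  val := fromBlocks u 0 0 ((z : F) • u⁻¹.valᵀ)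
  inv := fromBlocks ↑u⁻¹ 0 0 ((↑z⁻¹ : F) • u.valᵀ)
  val_inv := by simp [-coe_units_inv, fromBlocks_multiply, smul_smul, ← transpose_mul, ← fromBlocks_one]
  inv_val := by simp [-coe_units_inv, fromBlocks_multiply, smul_smul, ← transpose_mul, ← fromBlocks_one]

theorem conj_fromBlocks (u : (Matrix I I F)ˣ) (z : Fˣ) (a b c d : Matrix I I F) :
    (conjugator u z).val * fromBlocks a b c d * (conjugator u z)⁻¹.val =
      fromBlocks (u.val * a * u⁻¹.val)
        ((↑z⁻¹ : F) • (u.val * b * u.valᵀ))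
        ((z : F) • (u⁻¹.valᵀ * c * u⁻¹.val))
        (u⁻¹.valᵀ * d * u.valᵀ) := by
  simp [-coe_units_inv, conjugator, fromBlocks_multiply, smul_smul]

theorem conj_mem (u : (Matrix I I F)ˣ) (z : Fˣ) {x : Mat F I} (hx : x ∈ space F I) :
    (conjugator u z).val * x * (conjugator u z)⁻¹.val ∈ space F I := by
  obtain ⟨a, b, c, d, rfl⟩ : ∃ a b c d, x = fromBlocks a b c d :=
    ⟨_, _, _, _, (fromBlocks_toBlocks x).symm⟩
  obtain ⟨h1, h2, h3, rfl⟩ := (mem_space F I).1 hx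
  rw [conj_fromBlocks, mem_space]
  refine ⟨?_, ?_, ?_, ?_⟩
  · rw [trace_mul_comm, ← mul_assoc, Units.inv_mul, one_mul, h1]
  · simp [-coe_units_inv, h2, mul_assoc]
  · simp [-coe_units_inv, h3, mul_assoc]
  · simp [-coe_units_inv, mul_assoc]

/-- Conjugation by `conjugator u z`. -/
def ad (u : (Matrix I I F)ˣ) (z : Fˣ) : space F I ≃ₗ[F] space F I where
  toFun x := ⟨_, conj_mem u z x.2⟩
  invFun x := ⟨_, conj_mem u⁻¹ z⁻¹ x.2⟩
  map_add' x y := Subtype.ext (by simp [-coe_units_inv, mul_add, add_mul])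
  map_smul' r x := Subtype.ext (by simp)
  left_inv x := by
    have e : conjugator u⁻¹ z⁻¹ = (conjugator u z)⁻¹ := Units.ext rfl
    refine Subtype.ext ?_
    simp only [e, inv_inv, ← mul_assoc, Units.inv_mul, one_mul]
    simp only [mul_assoc, Units.inv_mul, mul_one]
  right_inv x := by
    have e : conjugator u⁻¹ z⁻¹ = (conjugator u z)⁻¹ := Units.ext rfl
    refine Subtype.ext ?_
    simp only [e, inv_inv, ← mul_assoc, Units.mul_inv, one_mul]
    simp only [mul_assoc, Units.mul_inv, mul_one]

theorem coe_ad (u : (Matrix I I F)ˣ) (z : Fˣ) (x : space F I) : (ad u z x : Mat F I) =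
    (conjugator u z).val * x * (conjugator u z)⁻¹.val := rfl

theorem ad_evenElt (u : (Matrix I I F)ˣ) (z : Fˣ) (a : Matrix I I F) (ha) :
    ad u z (evenElt a ha) = evenElt (u.val * a * u⁻¹.val)
      (by rw [trace_mul_comm, ← mul_assoc, Units.inv_mul, one_mul, ha]) := by
  refine Subtype.ext ?_
  rw [coe_ad, evenElt, conj_fromBlocks]
  simp [-coe_units_inv, evenElt, mul_assoc]

theorem ad_oddElt (u : (Matrix I I F)ˣ) (z : Fˣ) (b c : Matrix I I F) (hb hc) :
    ad u z (oddElt b c hb hc) = oddElt ((↑z⁻¹ : F) • (u.val * b * u.valᵀ))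
      ((z : F) • (u⁻¹.valᵀ * c * u⁻¹.val))
      (by simp [-coe_units_inv, hb, mul_assoc]) (by simp [-coe_units_inv, hc, mul_assoc]) := by
  refine Subtype.ext ?_
  rw [coe_ad, oddElt, conj_fromBlocks]
  simp [-coe_units_inv, oddElt]

theorem isAut_ad (u : (Matrix I I F)ˣ) (z : Fˣ) : (periplectic F I).IsAut (ad u z) := by
  have hle : ∀ (u : (Matrix I I F)ˣ) (z : Fˣ) (i : ZMod 2), ∀ x ∈ (periplectic F I).parity i,
      ad u z x ∈ (periplectic F I).parity i := by
    intro u z i x hx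
    rcases zmod_two i with rfl | rfl
    · obtain ⟨a, ha, rfl⟩ := mem_parity_zero.1 hx
      exact mem_parity_zero.2 ⟨_, _, ad_evenElt u z a ha⟩
    · obtain ⟨b, c, hb, hc, rfl⟩ := mem_parity_one.1 hx
      exact mem_parity_one.2 ⟨_, _, _, _, ad_oddElt u z b c hb hc⟩
  refine ⟨fun i => le_antisymm ?_ fun x hx => ?_, fun x y => Subtype.ext ?_⟩
  · rintro _ ⟨x, hx, rfl⟩
    exact hle u z i x hx
  · exact ⟨ad u⁻¹ z⁻¹ x, hle _ _ i x hx, (ad u z).apply_symm_apply x⟩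
  · rw [periplectic_bracket, coe_ad, coe_ad, coe_ad, periplectic_bracket]
    have hev : ∀ x : Mat F I, ev ((conjugator u z).val * x * (conjugator u z)⁻¹.val) =
        (conjugator u z).val * ev x * (conjugator u z)⁻¹.val := by
      intro x
      rw [← fromBlocks_toBlocks x, conj_fromBlocks]
      simp [-coe_units_inv, conj_fromBlocks, ev]
    have hod : ∀ x : Mat F I, od ((conjugator u z).val * x * (conjugator u z)⁻¹.val) =
        (conjugator u z).val * od x * (conjugator u z)⁻¹.val := by
      intro x
      rw [← fromBlocks_toBlocks x, conj_fromBlocks]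
      simp [-coe_units_inv, conj_fromBlocks, od]
    have hmul : ∀ x y : Mat F I,
        (conjugator u z).val * x * (conjugator u z)⁻¹.val *
          ((conjugator u z).val * y * (conjugator u z)⁻¹.val) =
        (conjugator u z).val * (x * y) * (conjugator u z)⁻¹.val := by
      intro x y
      simp [-coe_units_inv, mul_assoc]
    simp only [superBracket_apply, hev, hod, hmul, mul_sub, sub_mul, mul_add, add_mul]

theorem ad_mul (u v : (Matrix I I F)ˣ) (z w : Fˣ) (x : space F I) :
    ad (u * v) (z * w) x = ad u z (ad v w x) := by
  have e : conjugator (u * v) (z * w) = conjugator u z * conjugator v w := by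
    refine Units.ext ?_
    simp [-coe_units_inv, conjugator, fromBlocks_multiply, smul_smul, mul_comm]
  refine Subtype.ext ?_
  rw [coe_ad, coe_ad, coe_ad, e, _root_.mul_inv_rev]
  simp [-coe_units_inv, mul_assoc]

/-- The matrix p = v⁻¹u fixes every symmetric b under b ↦ p b pᵀ. The choice b = E_ii makes p
diagonal with entries ±1, and b = E_ij + E_ji makes these entries equal. This ambiguity is why
commuting automorphisms give matrices commuting only up to sign. -/
theorem eq_or_eq_neg_of_ad_eq [Nonempty I] {u v : (Matrix I I F)ˣ} (h : ad u 1 = ad v 1) :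
    u = v ∨ u = -v := by
  have h1 : ∀ b : Matrix I I F, bᵀ = b → u.val * b * u.valᵀ =
      v.val * b * v.valᵀ := by
    intro b hb
    have hc : (0 : Matrix I I F)ᵀ = -0 := by simp
    have := LinearEquiv.congr_fun h (oddElt b 0 hb hc)
    rw [ad_oddElt, ad_oddElt, oddElt_inj] at this
    simpa using this.1
  set p : Matrix I I F := v⁻¹.val * u.val with hp
  have h2 : ∀ b : Matrix I I F, bᵀ = b → p * b * pᵀ = b := by
    intro b hb
    have := h1 b hb
    calc p * b * pᵀ = v⁻¹.val * (u.val * b * u.valᵀ) *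
          v⁻¹.valᵀ := by simp [-coe_units_inv, hp, mul_assoc]
      _ = b * (v⁻¹.val * v.val)ᵀ := by rw [this, transpose_mul]; simp [-coe_units_inv, ← mul_assoc]
      _ = b := by simp
  have h3 : ∀ i r s, p r i * p s i = single i i (1 : F) r s := by
    intro i r s
    have := congrFun (congrFun (h2 (single i i 1) (by simp)) r) s
    rwa [single_eq_single_vecMulVec_single, mul_vecMulVec, vecMulVec_mul, vecMulVec_apply,
      vecMul_transpose, mulVec_single_one, ← single_eq_single_vecMulVec_single] at this
  have hoff : ∀ r i, r ≠ i → p r i = 0 := by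
    intro r i hri
    have := h3 i r r
    rwa [single_apply_of_row_ne hri.symm, mul_self_eq_zero] at this
  have hdiag : ∀ i, p i i * p i i = 1 := by
    intro i
    rw [h3, single_apply_same]
  have hij : ∀ i j, p i i * p j j = 1 := by
    intro i j
    by_cases hij : i = j
    · rw [← hij, hdiag]
    have := congrFun (congrFun (h2 (symTensor (Pi.single i 1) (Pi.single j 1))
      (transpose_symTensor _ _)) i) j
    rw [symTensor, mul_add, add_mul, mul_vecMulVec, vecMulVec_mul, mul_vecMulVec, vecMulVec_mul,
      vecMul_transpose, vecMul_transpose, mulVec_single_one, mulVec_single_one] at this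
    simpa [vecMulVec_apply, hoff i j hij, hoff j i (Ne.symm hij), hij] using this
  obtain ⟨i₀⟩ := ‹Nonempty I›
  have hpe : p = p i₀ i₀ • (1 : Matrix I I F) := by
    ext i j
    by_cases h : i = j
    · subst h
      have h1 := hij i i₀
      have h2 := hdiag i₀
      simp only [Matrix.smul_apply, one_apply_eq, smul_eq_mul, mul_one]
      linear_combination p i₀ i₀ * h1 - p i i * h2
    · simp [-coe_units_inv, hoff i j h, h]
  have hu : u.val = p i₀ i₀ • v.val := by
    have : u.val = v.val * p := by simp [-coe_units_inv, hp, ← mul_assoc]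
    rw [this, hpe]
    simp
  rcases mul_self_eq_one_iff.1 (hdiag i₀) with h | h
  · left
    exact Units.ext (by rw [hu, h, one_smul])
  · right
    exact Units.ext (by rw [hu, h]; simp)

end Periplectic

/-! ### Every automorphism of P(n) is a conjugation -/

namespace Periplectic

open Matrix

variable {F : Type*} [Field F] [CharZero F] {I : Type*} [Fintype I] [DecidableEq I]

theorem zero_symm : (0 : Matrix I I F)ᵀ = 0 := transpose_zero

theorem zero_skew : (0 : Matrix I I F)ᵀ = -0 := by simp

/-- Used to obtain every tangent vector at the square vvᵀ as a bracket of vvᵀ with an even element.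
-/
theorem exists_trace_zero_mulVec_eq (hI : 2 ≤ Fintype.card I) {v : I → F} (hv : v ≠ 0)
    (w : I → F) : ∃ a : Matrix I I F, a.trace = 0 ∧ a *ᵥ v = w := by
  obtain ⟨i, hi⟩ := Function.ne_iff.1 hv
  have hi' : v i ≠ 0 := hi
  have : Nontrivial I := Fintype.one_lt_card_iff_nontrivial.1 hI
  obtain ⟨j, hj⟩ := exists_ne i
  -- The first term sends v to w and has trace w_i / v_i; the second has the same trace and kills v.
  refine ⟨vecMulVec w (Pi.single i (v i)⁻¹) -
    (w i / v i) • vecMulVec (Pi.single j 1) (Pi.single j 1 - (v j / v i) • Pi.single i 1), ?_, ?_⟩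
  · rw [trace_sub, trace_smul, trace_vecMulVec, trace_vecMulVec]
    simp [hj.symm, div_eq_mul_inv]
  · rw [sub_mulVec, smul_mulVec, vecMulVec_mulVec, vecMulVec_mulVec, sub_dotProduct,
      smul_dotProduct, single_dotProduct, single_dotProduct, single_dotProduct]
    simp [hi']

/-- The odd element attached to the symmetrization of a matrix. -/
def symElt : Matrix I I F →ₗ[F] space F I where
  toFun m := oddElt ((2 : F)⁻¹ • (m + mᵀ)) 0 (by simp [add_comm]) (by simp)
  map_add' x y := Subtype.ext (by
    simp only [oddElt, Submodule.coe_add, fromBlocks_add, transpose_add, ← smul_add, add_zero]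
    congr 2
    abel)
  map_smul' r x := Subtype.ext (by
    simp [oddElt, fromBlocks_smul, smul_comm r])

theorem symElt_of_symm {b : Matrix I I F} (hb : bᵀ = b) :
    symElt b = oddElt b 0 hb zero_skew := by
  refine Subtype.ext ?_
  change fromBlocks 0 ((2 : F)⁻¹ • (b + bᵀ)) 0 0 = fromBlocks 0 b 0 0
  rw [hb, ← two_smul F b, smul_smul, inv_mul_cancel₀ two_ne_zero, one_smul]

theorem symElt_transpose (b : Matrix I I F) : symElt bᵀ = symElt b := by
  refine Subtype.ext ?_
  change fromBlocks 0 ((2 : F)⁻¹ • (bᵀ + bᵀᵀ)) 0 0 = fromBlocks 0 ((2 : F)⁻¹ • (b + bᵀ)) 0 0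
  rw [transpose_transpose, add_comm]

/-- The odd element attached to the skew-symmetrization of a matrix. -/
def skewElt : Matrix I I F →ₗ[F] space F I where
  toFun m := oddElt 0 ((2 : F)⁻¹ • (m - mᵀ)) (by simp) (by simp [← smul_neg])
  map_add' x y := Subtype.ext (by
    simp only [oddElt, Submodule.coe_add, fromBlocks_add, transpose_add, ← smul_add, add_zero]
    congr 2
    abel)
  map_smul' r x := Subtype.ext (by
    simp [oddElt, fromBlocks_smul, smul_comm r, ← smul_sub])

theorem skewElt_of_skew {c : Matrix I I F} (hc : cᵀ = -c) :
    skewElt c = oddElt 0 c zero_symm hc := by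
  refine Subtype.ext ?_
  change fromBlocks 0 0 ((2 : F)⁻¹ • (c - cᵀ)) 0 = fromBlocks 0 0 c 0
  rw [hc, sub_neg_eq_add, ← two_smul F c, smul_smul, inv_mul_cancel₀ two_ne_zero, one_smul]

/-- The upper right block, as a linear map. -/
def upperRight : space F I →ₗ[F] Matrix I I F where
  toFun x := x.1.toBlocks₁₂
  map_add' _ _ := rfl
  map_smul' _ _ := rfl

/-- The lower left block, as a linear map. -/
def lowerLeft : space F I →ₗ[F] Matrix I I F where
  toFun x := x.1.toBlocks₂₁
  map_add' _ _ := rfl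
  map_smul' _ _ := rfl

theorem upperRight_oddElt (b c : Matrix I I F) (hb hc) : upperRight (oddElt b c hb hc) = b :=
  toBlocks_fromBlocks₁₂ _ _ _ _

theorem lowerLeft_oddElt (b c : Matrix I I F) (hb hc) : lowerLeft (oddElt b c hb hc) = c :=
  toBlocks_fromBlocks₂₁ _ _ _ _

theorem IsAut.exists_evenElt {θ : space F I ≃ₗ[F] space F I} (hθ : (periplectic F I).IsAut θ)
    (a : Matrix I I F) (ha) : ∃ a' ha', θ (evenElt a ha) = evenElt a' ha' :=
  mem_parity_zero.1 (hθ.1 0 ▸ Submodule.mem_map_of_mem (mem_parity_zero.2 ⟨a, ha, rfl⟩))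

theorem IsAut.exists_oddElt {θ : space F I ≃ₗ[F] space F I} (hθ : (periplectic F I).IsAut θ)
    (b c : Matrix I I F) (hb hc) : ∃ b' c' hb' hc', θ (oddElt b c hb hc) = oddElt b' c' hb' hc' :=
  mem_parity_one.1 (hθ.1 1 ▸ Submodule.mem_map_of_mem (mem_parity_one.2 ⟨b, c, hb, hc, rfl⟩))

/-- An automorphism that fixes the odd elements with vanishing lower left block is trivial. -/
theorem eq_refl_of_fixes_upperRight (hI : 3 ≤ Fintype.card I) {θ : space F I ≃ₗ[F] space F I}
    (hθ : (periplectic F I).IsAut θ)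
    (h : ∀ b hb hc, θ (oddElt b 0 hb hc) = oddElt b 0 hb hc) : θ = LinearEquiv.refl F _ := by
  have h0 : (0 : Matrix I I F)ᵀ = -0 := zero_skew
  -- The even part acts faithfully on symmetric matrices: d b + b dᵀ = 0 for all b = E_ii forces d =
  -- 0.
  have heven : ∀ a ha, θ (evenElt a ha) = evenElt a ha := by
    intro a ha
    obtain ⟨a', ha', e⟩ := IsAut.exists_evenElt hθ a ha
    rw [e, evenElt_inj, ← sub_eq_zero]
    have key : ∀ b : Matrix I I F, bᵀ = b → (a' - a) * b + b * (a' - a)ᵀ = 0 := by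
      intro b hb
      have := hθ.2 (evenElt a ha) (oddElt b 0 hb h0)
      rw [e, h, bracket_even_odd, bracket_even_odd] at this
      have := congrArg upperRight this
      have e0 : (-(aᵀ * 0 + 0 * a) : Matrix I I F) = 0 := by simp
      simp only [e0] at this
      rw [h, upperRight_oddElt, upperRight_oddElt] at this
      rw [transpose_sub, sub_mul, mul_sub]
      rw [sub_add_sub_comm, this, sub_self]
    ext r i
    have h1 := congrFun (congrFun (key (single i i 1) (by simp)) r) i
    by_cases hri : r = i
    · subst hri
      simpa using h1
    · simpa [Matrix.single_mul_apply_of_ne, hri] using h1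
  have hskew : ∀ c hb hc, ∃ f : Matrix I I F, ∃ hf : fᵀ = f,
      θ (oddElt 0 c hb hc) = oddElt f c hf hc := by
    intro c hb hc
    obtain ⟨f, c', hf, hc', e⟩ := IsAut.exists_oddElt hθ 0 c hb hc
    -- The bracket of the fixed element with b = 1 and the one with lower left block c is the even
    -- element c, which θ fixes. So θ preserves the lower left block.
    have := hθ.2 (oddElt 1 0 (by simp) h0) (oddElt 0 c hb hc)
    rw [e, h, bracket_odd_odd, bracket_odd_odd, heven, evenElt_inj] at this
    simp only [one_mul, mul_zero, add_zero] at this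
    subst this
    exact ⟨f, hf, e⟩
  have hrel : ∀ (a : Matrix I I F) (_ : a.trace = 0) (c : Matrix I I F) (_ : cᵀ = -c),
      upperRight (θ (skewElt (-(aᵀ * c + c * a)))) =
        a * upperRight (θ (skewElt c)) + upperRight (θ (skewElt c)) * aᵀ := by
    intro a ha c hc
    have h00 : (0 : Matrix I I F)ᵀ = 0 := zero_symm
    obtain ⟨f, hf, e⟩ := hskew c h00 hc
    have := hθ.2 (evenElt a ha) (oddElt 0 c h00 hc)
    rw [heven, e, bracket_even_odd, bracket_even_odd] at this
    have := congrArg upperRight this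
    rw [upperRight_oddElt] at this
    rw [skewElt_of_skew hc, e, upperRight_oddElt, ← this, skewElt_of_skew (by simp [hc, add_comm])]
    congr 2
    exact oddElt_inj.2 ⟨by simp, rfl⟩
  -- The symmetric part that θ adds depends on c equivariantly for the traceless matrices by `hrel`.
  -- Such a map from skew-symmetric to symmetric matrices is zero, as seen on c = E_ij - E_ji with
  -- the help of a third index k.
  have hzero : upperRight ∘ₗ (θ : space F I →ₗ[F] space F I) ∘ₗ skewElt = 0 := by
    refine Matrix.ext_linearMap _ fun i j => LinearMap.ext_ring ?_
    simp only [LinearMap.comp_apply, LinearEquiv.coe_coe, LinearMap.zero_apply]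
    by_cases hij : i = j
    · subst hij
      have : skewElt (single i i (1 : F)) = 0 := Subtype.ext (by simp [skewElt, oddElt])
      simp [singleLinearMap, this]
    have e0 : skewElt (single i j (1 : F)) = (2 : F)⁻¹ • skewElt (single i j 1 - single j i 1) := by
      rw [skewElt_of_skew (c := single i j 1 - single j i 1) (by simp)]
      refine Subtype.ext ?_
      change fromBlocks 0 0 ((2 : F)⁻¹ • (single i j (1 : F) - (single i j 1)ᵀ)) 0 =
        (2 : F)⁻¹ • fromBlocks 0 0 (single i j 1 - single j i 1) 0
      simp [fromBlocks_smul]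
    change upperRight (θ (skewElt (single i j (1 : F)))) = 0
    rw [e0, map_smul, map_smul]
    set c : Matrix I I F := single i j 1 - single j i 1 with hcdef
    have hc : cᵀ = -c := by simp [hcdef]
    set f := upperRight (θ (skewElt c)) with hf
    obtain ⟨k, hki, hkj⟩ : ∃ k, k ≠ i ∧ k ≠ j := by
      by_contra! hcon
      have : (Finset.univ : Finset I) ⊆ {i, j} := fun k _ => by
        by_cases hk : k = i
        · simp [hk]
        · simp [hcon k hk]
      have := (Finset.card_le_card this).trans Finset.card_le_two
      rw [Finset.card_univ] at this
      omega
    -- E_kl annihilates c, whose row and column k vanish, hence it annihilates f. This leaves only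
    -- the entry f_kk.
    have r1 : ∀ l, l ≠ k → single k l (1 : F) * f + f * single l k 1 = 0 := by
      intro l hl
      have := hrel (single k l 1) (by simp [trace_single_eq_of_ne, hl.symm]) c hc
      rw [← hf, transpose_single] at this
      rw [← this]
      have e1 : -(single l k (1 : F) * c + c * single k l 1) = 0 := by
        simp [hcdef, mul_sub, sub_mul, single_mul_single_of_ne, hki, hkj, Ne.symm hki, Ne.symm hkj]
      rw [e1]
      simp
    have hsym : fᵀ = f := by
      obtain ⟨f', hf', e⟩ := hskew c zero_symm hc
      rw [hf, skewElt_of_skew hc, e, upperRight_oddElt, hf']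
    have r2 : ∀ l s, l ≠ k → f l s = 0 := by
      intro l s hl
      by_cases hs : s = k
      · subst hs
        have h1 := congrFun (congrFun (r1 l hl) s) s
        have h2 : f s l = f l s := congrFun (congrFun hsym l) s
        simp [h2] at h1
        exact h1
      · have := congrFun (congrFun (r1 l hl) k) s
        simpa [hs] using this
    -- A weight argument: E_kk - E_ii multiplies c by 1, but the (k, k) entry of its action on f is
    -- 2 f_kk.
    have r3 : f k k = 0 := by
      have := hrel (single k k 1 - single i i 1) (by simp) c hc
      have e1 : -((single k k (1 : F) - single i i 1)ᵀ * c + c * (single k k 1 - single i i 1)) = c := by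
        simp [hcdef, mul_sub, sub_mul, single_mul_single_of_ne, hki, hkj, Ne.symm hki, Ne.symm hkj,
          hij, Ne.symm hij, ← sub_eq_neg_add]
      rw [e1, ← hf] at this
      have := congrFun (congrFun this k) k
      simp [sub_mul, mul_sub, hki] at this
      exact this
    have : f = 0 := by
      ext l s
      by_cases hl : l = k
      · by_cases hs : s = k
        · rw [hl, hs, r3]
          rfl
        · rw [← hsym]
          exact r2 s l hs
      · exact r2 l s hl
    rw [this, smul_zero]
  ext1 x
  obtain ⟨a, ha, b, c, hb, hc, rfl⟩ := exists_eq_add x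
  have e1 : oddElt b c hb hc = oddElt b 0 hb h0 + oddElt 0 c zero_symm hc :=
    Subtype.ext (by simp [oddElt, fromBlocks_add])
  have e2 : θ (oddElt 0 c zero_symm hc) = oddElt 0 c zero_symm hc := by
    obtain ⟨f, hf, e⟩ := hskew c zero_symm hc
    have := LinearMap.congr_fun hzero c
    rw [LinearMap.comp_apply, LinearMap.comp_apply, skewElt_of_skew hc, LinearEquiv.coe_coe, e,
      upperRight_oddElt] at this
    rw [e, oddElt_inj]
    exact ⟨this, rfl⟩
  rw [map_add, heven, e1, map_add, h, e2]
  rfl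

/-- The squares vvᵀ are characterized by brackets, so θ permutes them and acts on upper right blocks
by a congruence with some u. Composing θ with the inverse of `ad u 1` fixes these blocks, and only
the identity does so. -/
theorem exists_eq_ad [IsAlgClosed F] (hI : 3 ≤ Fintype.card I) {θ : space F I ≃ₗ[F] space F I}
    (hθ : (periplectic F I).IsAut θ) : ∃ u : (Matrix I I F)ˣ, θ = ad u 1 := by
  have : Nonempty I := Fintype.card_pos_iff.1 (by omega)
  have h0 : (0 : Matrix I I F)ᵀ = -0 := zero_skew
  have hvv : ∀ v : I → F, ∃ v' : I → F, θ (oddElt (vecMulVec v v) 0 (transpose_vecMulVec v v) h0) =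
      oddElt (vecMulVec v' v') 0 (transpose_vecMulVec v' v') h0 := by
    intro v
    obtain ⟨b', c', hb', hc', e⟩ := IsAut.exists_oddElt hθ _ _ (transpose_vecMulVec v v) h0
    have h1 := (isRankOne_iff hI (transpose_vecMulVec v v) h0).2 ⟨rfl, v, rfl⟩
    have h2 := (isRankOne_iff hI hb' hc').1 (by
      intro y hy y' hy'
      rw [← hθ.1 1] at hy hy'
      obtain ⟨z, hz, rfl⟩ := hy
      obtain ⟨z', hz', rfl⟩ := hy'
      rw [← e, LinearEquiv.coe_coe, ← hθ.2, ← hθ.2, ← hθ.2, h1 z hz z' hz', map_zero])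
    obtain ⟨rfl, v', rfl⟩ := h2
    exact ⟨v', e⟩
  -- This holds on squares by `hvv`, and the squares span the symmetric matrices by polarization.
  have hlow : lowerLeft ∘ₗ (θ : space F I →ₗ[F] space F I) ∘ₗ symElt = 0 := by
    have hsq : ∀ v : I → F, lowerLeft (θ (symElt (vecMulVec v v))) = 0 := by
      intro v
      obtain ⟨v', e⟩ := hvv v
      rw [symElt_of_symm (transpose_vecMulVec v v), e, lowerLeft_oddElt]
    refine Matrix.ext_linearMap _ fun i j => LinearMap.ext_ring ?_
    change lowerLeft (θ (symElt (single i j (1 : F)))) = 0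
    rw [single_eq_single_vecMulVec_single]
    set x : I → F := Pi.single i 1
    set y : I → F := Pi.single j 1
    have e1 : vecMulVec x y + (vecMulVec x y)ᵀ =
        vecMulVec (x + y) (x + y) - vecMulVec x x - vecMulVec y y := by
      simp only [transpose_vecMulVec, add_vecMulVec, vecMulVec_add]
      abel
    have e2 : (2 : F) • lowerLeft (θ (symElt (vecMulVec x y))) = 0 := by
      rw [two_smul]
      conv_lhs => rw [← symElt_transpose (vecMulVec x y)]
      conv_lhs => enter [2]; rw [symElt_transpose (vecMulVec x y)]
      rw [← map_add, ← map_add, ← map_add, add_comm, e1]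
      simp only [map_sub, hsq, sub_zero]
    exact (smul_eq_zero.1 e2).resolve_left two_ne_zero
  let τ : Matrix I I F →ₗ[F] Matrix I I F :=
    upperRight ∘ₗ (θ : space F I →ₗ[F] space F I) ∘ₗ symElt
  have hτ : ∀ b hb, θ (oddElt b 0 hb h0) = oddElt (τ b) 0 (by
      obtain ⟨b', c', hb', hc', e⟩ := IsAut.exists_oddElt hθ b 0 hb h0
      simp only [τ, LinearMap.comp_apply, symElt_of_symm hb, LinearEquiv.coe_coe, e]
      rw [upperRight_oddElt, hb']) h0 := by
    intro b hb
    obtain ⟨b', c', hb', hc', e⟩ := IsAut.exists_oddElt hθ b 0 hb h0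
    have h1 := LinearMap.congr_fun hlow b
    rw [LinearMap.comp_apply, LinearMap.comp_apply, symElt_of_symm hb, LinearEquiv.coe_coe, e,
      lowerLeft_oddElt] at h1
    have h2 : τ b = b' := by
      simp only [τ, LinearMap.comp_apply, symElt_of_symm hb, LinearEquiv.coe_coe, e]
      rw [upperRight_oddElt]
    exact e.trans (oddElt_inj.2 ⟨h2.symm, h1⟩)
  obtain ⟨u, hu, hu'⟩ := exists_congruence_of_isSymm τ
    (fun v => by
      obtain ⟨v', e⟩ := hvv v
      rw [hτ, oddElt_inj] at e
      exact ⟨v', e.1⟩)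
    (fun v v' hv hvv' w => by
      -- With w = a v, the tangent vector `symTensor w v` is the bracket of the even element a with
      -- vvᵀ. Its image is the bracket of an even element a' with v'v'ᵀ, a tangent vector at that
      -- square.
      obtain ⟨a, ha, rfl⟩ := exists_trace_zero_mulVec_eq (by omega) hv w
      obtain ⟨a', ha', e⟩ := IsAut.exists_evenElt hθ a ha
      refine ⟨a' *ᵥ v', ?_⟩
      have e3 : ∀ (a : Matrix I I F) (v : I → F),
          a * vecMulVec v v + vecMulVec v v * aᵀ = symTensor (a *ᵥ v) v := by
        intro a v
        rw [mul_vecMulVec, vecMulVec_mul, vecMul_transpose]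
        rfl
      have := hθ.2 (evenElt a ha) (oddElt (vecMulVec v v) 0 (transpose_vecMulVec v v) h0)
      rw [e, hτ, bracket_even_odd, bracket_even_odd] at this
      have e0 : (-(aᵀ * 0 + 0 * a) : Matrix I I F) = 0 := by simp
      simp only [e0, e3, hvv'] at this
      rw [hτ, oddElt_inj] at this
      exact this.1)
    (fun b hb hb0 => by
      have := hτ b hb
      have e0 : oddElt (τ b) 0 (by rw [hb0]; simp) h0 = (0 : space F I) :=
        Subtype.ext (by simp [oddElt, hb0])
      rw [e0, LinearEquiv.map_eq_zero_iff] at this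
      have := congrArg upperRight this
      rwa [upperRight_oddElt, map_zero] at this)
  refine ⟨hu.unit, ?_⟩
  have key := eq_refl_of_fixes_upperRight hI (hθ.trans (isAut_ad hu.unit 1).symm) (by
    intro b hb hc
    rw [LinearEquiv.trans_apply, LinearEquiv.symm_apply_eq, hτ, ad_oddElt, oddElt_inj]
    simp [hu' b hb])
  ext1 x
  have := LinearEquiv.congr_fun key x
  rwa [LinearEquiv.trans_apply, LinearEquiv.symm_apply_eq] at this

end Periplectic

/-! ### Gradings by joint eigenspaces of automorphisms -/

namespace LieSuperalgebra

variable {F : Type*} {L : Type*} [Field F] [AddCommGroup L] [Module F L]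

theorem iSupIndep_of_eigen {G J : Type*} {Γ : G → Submodule F L} (f : J → L ≃ₗ[F] L)
    (c : J → G → F) (heig : ∀ j g, ∀ x ∈ Γ g, f j x = c j g • x)
    (hsep : ∀ g h, g ≠ h → ∃ j, c j g ≠ c j h) : iSupIndep Γ := by
  classical
  rw [iSupIndep_iff_finsetSum_eq_zero_imp_eq_zero]
  intro s
  induction s using Finset.induction_on with
  | empty => simp
  | insert a s ha ih =>
    intro v hv h0
    have key : ∀ g ∈ s, v g = 0 := by
      intro g hg
      obtain ⟨j, hj⟩ := hsep g a (fun h => ha (h ▸ hg))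
      -- Applying f j and subtracting c j a times the relation removes the term at a and keeps a
      -- nonzero multiple of the term at g.
      have h1 : ∑ h ∈ s, (c j h - c j a) • v h = 0 := by
        have e1 : f j (∑ h ∈ insert a s, v h) - c j a • ∑ h ∈ insert a s, v h = 0 := by
          rw [h0, map_zero, smul_zero, sub_zero]
        rw [map_sum, Finset.smul_sum, ← Finset.sum_sub_distrib, Finset.sum_insert ha,
          heig j a _ (hv a (Finset.mem_insert_self a s)), sub_self, zero_add] at e1
        rw [← e1]
        refine Finset.sum_congr rfl fun h hh => ?_
        rw [heig j h _ (hv h (Finset.mem_insert_of_mem hh)), sub_smul]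
      have h2 := ih (fun h => (c j h - c j a) • v h)
        (fun h hh => Submodule.smul_mem _ _ (hv h (Finset.mem_insert_of_mem hh))) h1 g hg
      exact (smul_eq_zero.1 h2).resolve_left (sub_ne_zero.2 hj)
    intro g hg
    rcases Finset.mem_insert.1 hg with rfl | hg
    · rwa [Finset.sum_insert ha, Finset.sum_eq_zero key, add_zero] at h0
    · exact key g hg

theorem mem_component_of_eigen {G J : Type*} {Γ : G → Submodule F L} (f : J → L ≃ₗ[F] L)
    (c : J → G → F) (heig : ∀ j g, ∀ x ∈ Γ g, f j x = c j g • x)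
    (hsep : ∀ g h, g ≠ h → ∃ j, c j g ≠ c j h) (htop : ⨆ g, Γ g = ⊤) {x : L} {g : G}
    (hx : ∀ j, f j x = c j g • x) : x ∈ Γ g := by
  obtain ⟨π, h1, h2, h3, h4⟩ := exists_component_projection
    (iSupIndep_of_eigen f c heig hsep) htop
  have comm : ∀ j h z, π h (f j z) = c j h • π h z := by
    intro j h z
    have : π h ∘ₗ (f j : L →ₗ[F] L) = c j h • π h := by
      refine eqOn_of_iSup_eq_top htop fun l z hz => ?_
      simp only [LinearMap.comp_apply, LinearEquiv.coe_coe, heig j l z hz, map_smul,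
        LinearMap.smul_apply]
      by_cases hl : l = h
      · rw [hl]
      · simp [h2 l h hl z hz]
    exact LinearMap.congr_fun this z
  have : x = π g x := by
    rw [← sub_eq_zero]
    refine h4 _ fun h => ?_
    rw [map_sub, sub_eq_zero]
    by_cases hh : g = h
    · subst hh
      rw [h1 g _ (h3 g x)]
    · rw [h2 g h hh _ (h3 g x)]
      obtain ⟨j, hj⟩ := hsep g h hh
      have := comm j h x
      rw [hx, map_smul, ← sub_eq_zero, ← sub_smul] at this
      exact (smul_eq_zero.1 this).resolve_left (sub_ne_zero.2 hj)
  rw [this]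
  exact h3 g x

/-- When the subspaces span and the eigenvalue systems separate the labels, each Γ g is the full
joint eigenspace. Independence and compatibility with parity and bracket then follow without
computing a bracket. -/
theorem isGrading_of_eigen {S : LieSuperalgebra F L} {G J : Type*} [AddCommGroup G]
    {Γ : G → Submodule F L} (f : J → L ≃ₗ[F] L) (hf : ∀ j, S.IsAut (f j))
    (c : J → G → F) (hmul : ∀ j g h, c j (g + h) = c j g * c j h)
    (heig : ∀ j g, ∀ x ∈ Γ g, f j x = c j g • x)
    (hsep : ∀ g h, g ≠ h → ∃ j, c j g ≠ c j h) (htop : ⨆ g, Γ g = ⊤) : S.IsGrading Γ where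
  indep := iSupIndep_of_eigen f c heig hsep
  iSup_eq_top := htop
  subsuperspace g := by
    refine le_antisymm (fun x hx => ?_) (sup_le inf_le_left inf_le_left)
    obtain ⟨y, hy, z, hz, rfl⟩ := Submodule.mem_sup.1
      (S.isCompl.sup_eq_top ▸ Submodule.mem_top (x := x))
    have hpar : ∀ j i, ∀ y ∈ S.parity i, f j y ∈ S.parity i := fun j i y hy => by
      rw [← (hf j).1 i]
      exact Submodule.mem_map_of_mem hy
    have hd := Submodule.disjoint_def.1 S.isCompl.disjoint
    -- The difference f j y - c j g • y is even, and equals the odd element c j g • z - f j z, so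
    -- both vanish.
    have key : ∀ j, f j y = c j g • y ∧ f j z = c j g • z := by
      intro j
      have h1 := heig j g _ hx
      rw [map_add, smul_add] at h1
      have h2 : f j y - c j g • y = c j g • z - f j z := by
        rw [sub_eq_sub_iff_add_eq_add, h1, add_comm]
      have h3 := hd (f j y - c j g • y)
        (sub_mem (hpar j 0 y hy) (Submodule.smul_mem _ _ hy))
        (h2 ▸ sub_mem (Submodule.smul_mem _ _ hz) (hpar j 1 z hz))
      exact ⟨sub_eq_zero.1 h3, (sub_eq_zero.1 (h2 ▸ h3)).symm⟩
    exact Submodule.mem_sup.2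
      ⟨y, ⟨mem_component_of_eigen f c heig hsep htop fun j => (key j).1, hy⟩,
        z, ⟨mem_component_of_eigen f c heig hsep htop fun j => (key j).2, hz⟩, rfl⟩
  bracket_mem g h x y hx hy := by
    refine mem_component_of_eigen f c heig hsep htop fun j => ?_
    rw [(hf j).2, heig j g x hx, heig j h y hy, map_smul, map_smul, LinearMap.smul_apply, smul_smul,
      hmul, mul_comm]

end LieSuperalgebra

/-! ### The matrices X_t: products, commutation signs and spanning -/

namespace Periplectic

open Matrix

section Signs

variable (F : Type*) [Field F]

/-- The nontrivial character of `ZMod 2` with values `1` and `-1`. -/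
def sgn (z : ZMod 2) : Fˣ := (-1) ^ z.val

theorem sgn_zero : sgn F 0 = 1 := pow_zero _

theorem sgn_one : sgn F 1 = -1 := pow_one _

theorem sgn_add (x y : ZMod 2) : sgn F (x + y) = sgn F x * sgn F y := by
  have e : (1 : ZMod 2) + 1 = 0 := rfl
  rcases zmod_two x with rfl | rfl <;> rcases zmod_two y with rfl | rfl <;>
    simp [e, sgn_zero, sgn_one]

theorem sgn_mul_self (x : ZMod 2) : sgn F x * sgn F x = 1 := by
  rcases zmod_two x with rfl | rfl <;> simp [sgn_zero, sgn_one]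

theorem sgn_ne [CharZero F] {x y : ZMod 2} (h : x ≠ y) : sgn F x ≠ sgn F y := by
  have e : (1 : Fˣ) ≠ -1 := fun h => by
    have := congrArg Units.val h
    simp only [Units.val_one, Units.val_neg] at this
    exact one_ne_zero (self_eq_neg.1 this)
  rcases zmod_two x with rfl | rfl <;> rcases zmod_two y with rfl | rfl
  · exact absurd rfl h
  · rwa [sgn_zero, sgn_one]
  · rw [sgn_zero, sgn_one]
    exact e.symm
  · exact absurd rfl h

variable {F} in
theorem sum_sgn [CharZero F] {ℓ : ℕ} {x : B ℓ} (hx : x ≠ 0) :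
    ∑ r : B ℓ, (sgn F (x ⬝ᵥ r) : F) = 0 := by
  obtain ⟨i, hi⟩ := Function.ne_iff.1 hx
  have hi1 : x i = 1 := (zmod_two (x i)).resolve_left hi
  have : ∑ r : B ℓ, (sgn F (x ⬝ᵥ r) : F) = -∑ r : B ℓ, (sgn F (x ⬝ᵥ r) : F) := by
    rw [← Finset.sum_neg_distrib]
    -- Translating r by the i-th unit vector, where x_i = 1, flips every sign.
    refine Fintype.sum_equiv (Equiv.addRight (Pi.single i 1)) _ _ fun r => ?_
    rw [Equiv.coe_addRight, dotProduct_add, sgn_add, dotProduct_single, hi1, mul_one, sgn_one]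
    simp
  exact self_eq_neg.1 this

end Signs

section Realization

variable {ℓ : ℕ}

theorem neg_B (b : B ℓ) : -b = b := by
  ext i
  exact ZMod.neg_eq_self_mod_two (b i)

theorem eq_add_comm_B {r b c : B ℓ} : r = b + c ↔ c = b + r := by
  constructor <;> (rintro rfl; rw [← add_assoc]; nth_rw 2 [← neg_B b]; simp)

/-- The projection of `T_(ℓ)` to `A`, identified with the dual of `B`. -/
def coordA (t : T ℓ) : B ℓ := fun j => t ⟨ℓ - 1 - j, by have := j.isLt; omega⟩

/-- The element of `T_(ℓ)` with given coordinates. -/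
def ofCoord (α b : B ℓ) : T ℓ := fun i =>
  if h : i.val < ℓ then α ⟨ℓ - 1 - i, by omega⟩ else b ⟨i - ℓ, by have := i.isLt; omega⟩

theorem coordA_ofCoord (α b : B ℓ) : coordA (ofCoord α b) = α := by
  ext j
  have := j.isLt
  rw [coordA, ofCoord, dif_pos (show ℓ - 1 - (j : ℕ) < ℓ by omega)]
  congr 1
  ext
  simp only
  omega

theorem projB_ofCoord (α b : B ℓ) : projB (ofCoord α b) = b := by
  ext j
  rw [projB, ofCoord, dif_neg (show ¬ (ℓ + (j : ℕ) < ℓ) by omega)]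
  congr 1
  ext
  simp

theorem coord_ext {s t : T ℓ} (h1 : coordA s = coordA t) (h2 : projB s = projB t) : s = t := by
  ext i
  have hi := i.isLt
  by_cases h : i.val < ℓ
  · have := congrFun h1 ⟨ℓ - 1 - i, by omega⟩
    simp only [coordA] at this
    have e : (⟨ℓ - 1 - (ℓ - 1 - i), by omega⟩ : Fin (2 * ℓ)) = i := Fin.ext (by simp only; omega)
    rwa [e] at this
  · have := congrFun h2 ⟨i - ℓ, by omega⟩
    simp only [projB] at this
    have e : (⟨ℓ + (i - ℓ), by omega⟩ : Fin (2 * ℓ)) = i := Fin.ext (by simp only; omega)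
    rwa [e] at this

theorem coordA_add (s t : T ℓ) : coordA (s + t) = coordA s + coordA t := rfl

theorem projB_add (s t : T ℓ) : projB (s + t) = projB s + projB t := rfl

theorem coordA_zero : coordA (0 : T ℓ) = 0 := rfl

theorem projB_zero : projB (0 : T ℓ) = 0 := rfl

variable (F : Type*) [Field F]

/-- β pairs the i-th coordinate with the i-th from the end, so on A × B it is a dot product after
reversing the first ℓ coordinates. This is the reason for the reversal in `coordA`. -/
theorem X_apply (t : T ℓ) (r c : B ℓ) :
    X F ℓ t r c = if r = projB t + c then (sgn F (coordA t ⬝ᵥ r) : F) else 0 := by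
  have key : ∑ i, projA t i * inclB r i.rev = coordA t ⬝ᵥ r := by
    rw [← Fintype.sum_equiv (Fin.revPerm.trans (finCongr rfl)) (fun i => projA t i.rev * inclB r i) _
      (fun i => by simp)]
    rw [Fintype.sum_equiv (finCongr (two_mul ℓ)) _
      (fun i : Fin (ℓ + ℓ) => projA t (Fin.cast (two_mul ℓ).symm i).rev *
        inclB r (Fin.cast (two_mul ℓ).symm i)) (fun i => by simp), Fin.sum_univ_add]
    have h1 : ∀ j : Fin ℓ, inclB r (Fin.cast (two_mul ℓ).symm (Fin.castAdd ℓ j)) = 0 := by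
      intro j
      have := j.isLt
      simp [inclB]
    have h2 : ∀ j : Fin ℓ, inclB r (Fin.cast (two_mul ℓ).symm (Fin.natAdd ℓ j)) = r j := by
      intro j
      simp [inclB]
    have h3 : ∀ j : Fin ℓ, projA t (Fin.cast (two_mul ℓ).symm (Fin.natAdd ℓ j)).rev =
        coordA t j := by
      intro j
      have := j.isLt
      rw [projA, if_pos (by simp [Fin.val_rev]; omega)]
      simp only [coordA]
      congr 1
      ext
      simp [Fin.val_rev]
      omega
    simp only [h1, h2, h3, mul_zero, Finset.sum_const_zero, zero_add, dotProduct]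
  rw [X, of_apply, beta, key]
  simp [sgn]

theorem X_mul (s t : T ℓ) : X F ℓ s * X F ℓ t =
    (sgn F (coordA t ⬝ᵥ projB s) : F) • X F ℓ (s + t) := by
  ext r c
  rw [mul_apply, Matrix.smul_apply, X_apply]
  simp only [X_apply]
  rw [Finset.sum_eq_single (projB s + r)]
  · rw [if_pos (eq_add_comm_B.1 rfl), projB_add, coordA_add]
    have : projB s + r = projB t + c ↔ r = projB s + projB t + c := by
      rw [add_assoc]
      exact ⟨fun h => eq_add_comm_B.1 h.symm, fun h => (eq_add_comm_B.1 h).symm⟩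
    simp only [this]
    split_ifs
    · rw [add_dotProduct, dotProduct_add, sgn_add, sgn_add]
      push_cast
      rw [smul_eq_mul]
      ring
    · simp
  · intro m _ hm
    rw [if_neg fun h => hm (eq_add_comm_B.1 h), zero_mul]
  · simp

theorem X_transpose (t : T ℓ) : (X F ℓ t)ᵀ = (sgn F (coordA t ⬝ᵥ projB t) : F) • X F ℓ t := by
  ext r c
  rw [transpose_apply, Matrix.smul_apply, X_apply, X_apply]
  by_cases h : c = projB t + r
  · rw [if_pos h, if_pos (eq_add_comm_B.1 h), h, dotProduct_add, sgn_add]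
    simp
  · rw [if_neg h, if_neg fun hh => h (eq_add_comm_B.1 hh), smul_zero]

theorem X_zero : X F ℓ 0 = 1 := by
  ext r c
  rw [X_apply, coordA_zero, projB_zero, zero_add, zero_dotProduct, sgn_zero, one_apply]
  rfl

theorem add_self_T (s : T ℓ) : s + s = 0 := by
  ext i
  exact CharTwo.add_self_eq_zero (s i)

theorem X_mul_transpose (s : T ℓ) : X F ℓ s * (X F ℓ s)ᵀ = 1 := by
  rw [X_transpose, mul_smul_comm, X_mul, add_self_T, X_zero, smul_smul, ← Units.val_mul,
    sgn_mul_self]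
  simp

theorem X_transpose_mul (s : T ℓ) : (X F ℓ s)ᵀ * X F ℓ s = 1 := by
  rw [X_transpose, smul_mul_assoc, X_mul, add_self_T, X_zero, smul_smul, ← Units.val_mul,
    sgn_mul_self]
  simp

/-- The commutation factor of `X s` and `X t`. -/
def comm (s t : T ℓ) : ZMod 2 := coordA t ⬝ᵥ projB s + coordA s ⬝ᵥ projB t

theorem comm_add (s t t' : T ℓ) : comm s (t + t') = comm s t + comm s t' := by
  simp only [comm, coordA_add, projB_add, add_dotProduct, dotProduct_add]
  ring

/-- Nondegeneracy: pairing with the unit vectors of A and of B recovers all coordinates. -/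
theorem exists_comm_ne {t t' : T ℓ} (h : t ≠ t') : ∃ s, comm s t ≠ comm s t' := by
  by_contra! hcon
  refine h (coord_ext ?_ ?_)
  · ext i
    have := hcon (ofCoord 0 (Pi.single i 1))
    simpa [comm, projB_ofCoord, coordA_ofCoord] using this
  · ext i
    have := hcon (ofCoord (Pi.single i 1) 0)
    simpa [comm, projB_ofCoord, coordA_ofCoord] using this

theorem X_mul_comm (s t : T ℓ) : X F ℓ s * X F ℓ t = (sgn F (comm s t) : F) • (X F ℓ t * X F ℓ s) := by
  rw [X_mul, X_mul, add_comm t s, smul_smul, comm, sgn_add]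
  congr 1
  have := congrArg Units.val (sgn_mul_self F (coordA s ⬝ᵥ projB t))
  push_cast at this ⊢
  linear_combination -(sgn F (coordA t ⬝ᵥ projB s) : F) * this

theorem X_conj (s t : T ℓ) : X F ℓ s * X F ℓ t * (X F ℓ s)ᵀ = (sgn F (comm s t) : F) • X F ℓ t := by
  rw [X_mul_comm, smul_mul_assoc, mul_assoc, X_mul_transpose, mul_one]

theorem trace_X [CharZero F] {t : T ℓ} (ht : t ≠ 0) : (X F ℓ t).trace = 0 := by
  simp only [trace, diag_apply, X_apply]
  by_cases hb : projB t = 0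
  · have ha : coordA t ≠ 0 := fun ha => ht (coord_ext ha hb)
    simp only [hb, zero_add, if_true]
    exact sum_sgn ha
  · have : ∀ r : B ℓ, r ≠ projB t + r := fun r h => hb (by simpa using h)
    simp [this]

/-- Fourier inversion over A: for fixed r and c, the sum of sgn(α·r) X_t over all t with coordinates
α and r + c equals 2^ℓ E_rc. -/
theorem span_X [CharZero F] : Submodule.span F (Set.range (X F ℓ)) = ⊤ := by
  rw [eq_top_iff]
  intro M _
  rw [matrix_eq_sum_single M]
  refine sum_mem fun r _ => sum_mem fun c _ => ?_
  have key : (Fintype.card (B ℓ) : F) • single r c (M r c) =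
      (M r c) • ∑ α : B ℓ, (sgn F (α ⬝ᵥ r) : F) • X F ℓ (ofCoord α (r + c)) := by
    ext r' c'
    have e0 : ∀ b : B ℓ, b + b = 0 := fun b => by
      nth_rw 2 [← neg_B b]
      exact add_neg_cancel b
    simp only [Matrix.smul_apply, Matrix.sum_apply, X_apply, coordA_ofCoord, projB_ofCoord,
      smul_eq_mul, mul_ite, mul_zero, ← Units.val_mul, ← sgn_add, ← dotProduct_add]
    by_cases h : r' = r + c + c'
    · simp only [if_pos h]
      by_cases hr : r = r'
      · have hc : c = c' := by
          rw [← hr, add_assoc, left_eq_add] at h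
          rw [← add_zero c, ← e0 c', ← add_assoc, h, zero_add]
        subst hr hc
        simp [e0, sgn_zero, mul_comm]
      · have hr' : r + r' ≠ 0 := fun h0 => hr (by
          rw [← add_zero r, ← e0 r', ← add_assoc, h0, zero_add])
        simp only [dotProduct_comm _ (r + r')]
        rw [sum_sgn hr', single_apply_of_row_ne hr]
        simp
    · simp only [if_neg h]
      rw [single_apply, if_neg]
      · simp
      · rintro ⟨rfl, rfl⟩
        exact h (by rw [add_assoc, e0, add_zero])
  have hcard : (Fintype.card (B ℓ) : F) ≠ 0 := Nat.cast_ne_zero.2 Fintype.card_ne_zero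
  rw [← inv_smul_smul₀ hcard (single r c (M r c)), key]
  exact Submodule.smul_mem _ _ (Submodule.smul_mem _ _ (sum_mem fun α _ =>
    Submodule.smul_mem _ _ (Submodule.subset_span ⟨_, rfl⟩)))

end Realization

end Periplectic

/-! ### The grading Γ_P(ℓ) as a joint eigenspace decomposition -/

namespace Periplectic

open Matrix

open scoped Kronecker

section Blocks

variable {F : Type*} [Field F] {I : Type*} {ℓ k : ℕ}

/-- The matrix with rows and columns indexed by `I` attached to a Kronecker product. -/
def blockMat (lab : Fin k × B ℓ ≃ I) (A : Matrix (Fin k) (Fin k) F) (Y : Matrix (B ℓ) (B ℓ) F) :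
    Matrix I I F := reindex lab lab (A ⊗ₖ Y)

variable (lab : Fin k × B ℓ ≃ I)

theorem blockMat_apply (A : Matrix (Fin k) (Fin k) F) (Y : Matrix (B ℓ) (B ℓ) F)
    (p q : Fin k × B ℓ) : blockMat lab A Y (lab p) (lab q) = A p.1 q.1 * Y p.2 q.2 := by
  simp [blockMat]

theorem blockMat_transpose (A : Matrix (Fin k) (Fin k) F) (Y : Matrix (B ℓ) (B ℓ) F) :
    (blockMat lab A Y)ᵀ = blockMat lab Aᵀ Yᵀ := rfl

theorem blockMat_smul_right (c : F) (A : Matrix (Fin k) (Fin k) F) (Y : Matrix (B ℓ) (B ℓ) F) :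
    blockMat lab A (c • Y) = c • blockMat lab A Y := by
  rw [blockMat, kronecker_smul]
  rfl

theorem blockMat_smul_left (c : F) (A : Matrix (Fin k) (Fin k) F) (Y : Matrix (B ℓ) (B ℓ) F) :
    blockMat lab (c • A) Y = c • blockMat lab A Y := by
  rw [blockMat, smul_kronecker]
  rfl

theorem blockMat_one [DecidableEq I] :
    blockMat lab (1 : Matrix (Fin k) (Fin k) F) (1 : Matrix (B ℓ) (B ℓ) F) = 1 := by
  rw [blockMat, one_kronecker_one]
  simp

variable [Fintype I]

theorem blockMat_mul (A A' : Matrix (Fin k) (Fin k) F) (Y Y' : Matrix (B ℓ) (B ℓ) F) :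
    blockMat lab A Y * blockMat lab A' Y' = blockMat lab (A * A') (Y * Y') := by
  simp only [blockMat, reindex_apply, submatrix_mul_equiv, mul_kronecker_mul]

theorem trace_blockMat (A : Matrix (Fin k) (Fin k) F) (Y : Matrix (B ℓ) (B ℓ) F) :
    (blockMat lab A Y).trace = A.trace * Y.trace := by
  rw [← trace_kronecker]
  simp only [trace, diag_apply, blockMat, reindex_apply, submatrix_apply]
  exact Fintype.sum_equiv lab.symm _ _ fun i => rfl

/-- The basis matrices `E_ij ⊗ X_t`. -/
def basisMat (i j : Fin k) (t : T ℓ) : Matrix I I F := blockMat lab (single i j 1) (X F ℓ t)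

theorem basisMat_transpose (i j : Fin k) (t : T ℓ) : (basisMat lab i j t : Matrix I I F)ᵀ =
    (sgn F (coordA t ⬝ᵥ projB t) : F) • basisMat lab j i t := by
  rw [basisMat, blockMat_transpose, X_transpose, transpose_single, blockMat_smul_right]
  rfl

/-- The two diagonals are independent so that all four blocks are covered: each of them will be the
given diagonal or its inverse, depending on the block. -/
theorem basisMat_conj (p r : Fin k → F) (s : T ℓ) (i j : Fin k) (t : T ℓ) :
    blockMat lab (diagonal p) (X F ℓ s) * basisMat lab i j t *
      blockMat lab (diagonal r) (X F ℓ s)ᵀ =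
    (p i * r j * sgn F (comm s t) : F) • basisMat lab i j t := by
  have h : diagonal p * single i j (1 : F) * diagonal r = (p i * r j) • single i j (1 : F) := by
    ext a b
    rw [mul_diagonal, diagonal_mul]
    by_cases h : i = a ∧ j = b
    · obtain ⟨rfl, rfl⟩ := h
      simp
    · simp [h]
  rw [basisMat, blockMat_mul, blockMat_mul, X_conj, blockMat_smul_right, h, blockMat_smul_left,
    smul_smul, mul_comm]

theorem span_basisMat [CharZero F] (M : Matrix I I F) : M ∈ Submodule.span F
    {x | ∃ i j t, x = basisMat lab i j t} := by
  have h : ∀ (i j : Fin k) (Y : Matrix (B ℓ) (B ℓ) F), blockMat lab (single i j 1) Y ∈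
      Submodule.span F {x : Matrix I I F | ∃ i j t, x = basisMat lab i j t} := by
    intro i j Y
    have hY : Y ∈ Submodule.span F (Set.range (X F ℓ)) := span_X F ▸ Submodule.mem_top
    induction hY using Submodule.span_induction with
    | mem x hx =>
      obtain ⟨t, rfl⟩ := hx
      exact Submodule.subset_span ⟨i, j, t, rfl⟩
    | zero => simp [blockMat]
    | add x y _ _ hx hy =>
      have : blockMat lab (single i j 1) (x + y) =
          blockMat lab (single i j 1) x + blockMat lab (single i j 1) y := by
        rw [blockMat, kronecker_add]
        rfl
      rw [this]
      exact add_mem hx hy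
    | smul c x _ hx =>
      rw [blockMat_smul_right]
      exact Submodule.smul_mem _ _ hx
  have e : M = ∑ i, ∑ j, blockMat lab (single i j 1) (Matrix.of fun a b => M (lab (i, a)) (lab (j, b))) := by
    ext x y
    obtain ⟨p, rfl⟩ := lab.surjective x
    obtain ⟨q, rfl⟩ := lab.surjective y
    simp only [Matrix.sum_apply, blockMat_apply, of_apply, single_apply]
    rw [Finset.sum_eq_single p.1, Finset.sum_eq_single q.1]
    · simp
    · intro b _ hb
      simp [hb]
    · simp
    · intro b _ hb
      simp [hb]
    · simp
  rw [e]
  exact sum_mem fun i _ => sum_mem fun j _ => h i j _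

variable [DecidableEq I]

/-- The invertible matrices `diag(p) ⊗ X_s`. -/
def monomialUnit (p : Fin k → Fˣ) (s : T ℓ) : (Matrix I I F)ˣ where
  val := blockMat lab (diagonal fun i => (p i : F)) (X F ℓ s)
  inv := blockMat lab (diagonal fun i => ((p i)⁻¹ : Fˣ).val) (X F ℓ s)ᵀ
  val_inv := by
    rw [blockMat_mul, X_mul_transpose, diagonal_mul_diagonal]
    simp [blockMat_one]
  inv_val := by
    rw [blockMat_mul, X_transpose_mul, diagonal_mul_diagonal]
    simp [blockMat_one]

theorem monomialUnit_val (p : Fin k → Fˣ) (s : T ℓ) : (monomialUnit lab p s).val =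
    blockMat lab (diagonal fun i => (p i : F)) (X F ℓ s) := rfl

theorem monomialUnit_inv_val (p : Fin k → Fˣ) (s : T ℓ) : (monomialUnit lab p s)⁻¹.val =
    blockMat lab (diagonal fun i => ((p i)⁻¹ : Fˣ).val) (X F ℓ s)ᵀ := rfl

end Blocks

section Characters

variable {F : Type*} [Field F] {ℓ k : ℕ}

/-- The character of `T_(ℓ) × ℤ^k × ⟨e₀⟩` attached to `s`, `p` and `z`. -/
def chi (p : Fin k → Fˣ) (z : Fˣ) (s : T ℓ) (g : BigGroup ℓ k) : Fˣ :=
  sgn F (comm s g.1) * (∏ i, p i ^ g.2.1 i) * z ^ g.2.2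

theorem chi_add (p : Fin k → Fˣ) (z : Fˣ) (s : T ℓ) (g h : BigGroup ℓ k) :
    chi p z s (g + h) = chi p z s g * chi p z s h := by
  simp only [chi, Prod.fst_add, Prod.snd_add, Pi.add_apply, comm_add, sgn_add, _root_.zpow_add,
    Finset.prod_mul_distrib]
  ac_rfl

theorem chi_zero (p : Fin k → Fˣ) (z : Fˣ) (s : T ℓ) : chi p z s 0 = 1 := by
  have := chi_add p z s 0 0
  rwa [add_zero, eq_comm, mul_eq_left] at this

theorem chi_neg (p : Fin k → Fˣ) (z : Fˣ) (s : T ℓ) (g : BigGroup ℓ k) :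
    chi p z s (-g) = (chi p z s g)⁻¹ := by
  rw [eq_inv_iff_mul_eq_one, ← chi_add, neg_add_cancel, chi_zero]

theorem chi_sub (p : Fin k → Fˣ) (z : Fˣ) (s : T ℓ) (g h : BigGroup ℓ k) :
    chi p z s (g - h) = chi p z s g * (chi p z s h)⁻¹ := by
  rw [sub_eq_add_neg, chi_add, chi_neg]

theorem chi_e (p : Fin k → Fˣ) (z : Fˣ) (s : T ℓ) (i : Fin k) : chi p z s (e i) = p i := by
  rw [chi, e, Finset.prod_eq_single i]
  · simp [comm, coordA_zero, projB_zero, sgn_zero]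
  · intro j _ hj
    simp [hj]
  · simp

theorem chi_e₀ (p : Fin k → Fˣ) (z : Fˣ) (s : T ℓ) : chi p z s e₀ = z := by
  simp [chi, e₀, comm, coordA_zero, projB_zero, sgn_zero]

theorem chi_T (p : Fin k → Fˣ) (z : Fˣ) (s t : T ℓ) :
    chi p z s ((t, 0, 0) : BigGroup ℓ k) = sgn F (comm s t) := by
  simp [chi]

/-- 2 has infinite order in Fˣ, as it does in ℚ ⊆ F. -/
theorem zpow_two_injective [CharZero F] {a b : ℤ}
    (h : (Units.mk0 (2 : F) two_ne_zero) ^ a = (Units.mk0 (2 : F) two_ne_zero) ^ b) : a = b := by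
  have h1 := congrArg Units.val h
  simp only [Units.val_zpow_eq_zpow_val, Units.val_mk0] at h1
  have h2 : ((2 : ℚ) ^ a : ℚ) = (2 : ℚ) ^ b := by
    have : (((2 : ℚ) ^ a : ℚ) : F) = (((2 : ℚ) ^ b : ℚ) : F) := by
      push_cast
      exact h1
    exact_mod_cast this
  exact zpow_right_injective₀ (by norm_num) (by norm_num) h2

/-- The commutation signs detect the T-part and powers of 2 detect each integer coordinate. The
parameter z is what detects the coordinate of e₀. -/
theorem exists_chi_ne [CharZero F] {g h : BigGroup ℓ k} (hgh : g ≠ h) :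
    ∃ (p : Fin k → Fˣ) (z : Fˣ) (s : T ℓ), chi p z s g ≠ chi p z s h := by
  by_contra! hcon
  have h0 : ∀ t : T ℓ, comm 0 t = 0 := fun t => by simp [comm, coordA_zero, projB_zero]
  have h1 : g.1 = h.1 := by
    by_contra hne
    obtain ⟨s, hs⟩ := exists_comm_ne hne
    have := hcon 1 1 s
    simp only [chi, Pi.one_apply, _root_.one_zpow, Finset.prod_const_one, mul_one] at this
    exact sgn_ne F hs this
  have h2 : g.2.2 = h.2.2 := by
    have := hcon 1 (Units.mk0 2 two_ne_zero) 0
    simp only [chi, Pi.one_apply, _root_.one_zpow, Finset.prod_const_one, h0, sgn_zero, one_mul] at this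
    exact zpow_two_injective this
  have h3 : g.2.1 = h.2.1 := by
    ext i
    have := hcon (Pi.mulSingle i (Units.mk0 2 two_ne_zero)) 1 0
    simp only [chi, h0, sgn_zero, one_mul, _root_.one_zpow, mul_one] at this
    rw [Finset.prod_eq_single i, Finset.prod_eq_single i] at this
    · simp only [Pi.mulSingle_eq_same] at this
      exact zpow_two_injective this
    all_goals simp +contextual [Pi.mulSingle_eq_of_ne]
  exact hgh (Prod.ext h1 (Prod.ext h3 h2))

end Characters

section FineGrading

variable {F : Type*} [Field F] [CharZero F] {n ℓ k : ℕ}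

theorem conj_matComponent (lab : Fin k × B ℓ ≃ Fin (n + 1)) (p : Fin k → Fˣ) (z : Fˣ) (s : T ℓ)
    (g : BigGroup ℓ k) {x : Mat F (Fin (n + 1))}
    (hx : x ∈ matComponent (X F ℓ) (fun t => (t, 0, 0)) e e₀ lab g) :
    (conjugator (monomialUnit lab p s) z).val * x * (conjugator (monomialUnit lab p s) z)⁻¹.val =
      (chi p z s g : F) • x := by
  have ht : ∀ (a : Fin k → F) (s : T ℓ), (blockMat lab (diagonal a) (X F ℓ s))ᵀ =
      blockMat lab (diagonal a) (X F ℓ s)ᵀ := fun a s => by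
    rw [blockMat_transpose, diagonal_transpose]
  have ht' : ∀ (a : Fin k → F) (s : T ℓ), (blockMat lab (diagonal a) (X F ℓ s)ᵀ)ᵀ =
      blockMat lab (diagonal a) (X F ℓ s) := fun a s => by
    rw [blockMat_transpose, diagonal_transpose, transpose_transpose]
  unfold matComponent at hx
  induction hx using Submodule.span_induction with
  | mem x hx =>
    rcases hx with ((⟨i, j, t, rfl, rfl⟩ | ⟨i, j, t, rfl, rfl⟩) | ⟨i, j, t, rfl, rfl⟩) |
      ⟨i, j, t, rfl, rfl⟩
    all_goals
      rw [conj_fromBlocks]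
      change fromBlocks (_ * _ * _) (_ • (_ * _ * _)) (_ • (_ * _ * _)) (_ * _ * _) = _
      simp only [mul_zero, zero_mul, smul_zero, monomialUnit_inv_val, monomialUnit_val, ht, ht']
      simp only [chi_add, chi_sub, chi_neg, chi_e, chi_e₀, chi_T]
      rw [fromBlocks_smul, smul_zero]
    · have := basisMat_conj lab (fun i => (p i : F)) (fun i => ((p i)⁻¹ : Fˣ).val) s i j t
      unfold basisMat blockMat at this
      unfold blockMat
      rw [this]
      congr 2
      push_cast
      ring
    · have := basisMat_conj lab (fun i => (p i : F)) (fun i => (p i : F)) s i j t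
      unfold basisMat blockMat at this
      unfold blockMat
      rw [this, smul_smul]
      congr 2
      push_cast
      ring
    · have := basisMat_conj lab (fun i => ((p i)⁻¹ : Fˣ).val) (fun i => ((p i)⁻¹ : Fˣ).val) s i j t
      unfold basisMat blockMat at this
      unfold blockMat
      rw [this, smul_smul]
      congr 2
      push_cast
      ring
    · have := basisMat_conj lab (fun i => ((p i)⁻¹ : Fˣ).val) (fun i => (p i : F)) s i j t
      unfold basisMat blockMat at this
      unfold blockMat
      rw [this]
      congr 2
      push_cast
      ring
  | zero => simp
  | add x y _ _ hx hy => rw [mul_add, add_mul, hx, hy, smul_add]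
  | smul c x _ hx => rw [mul_smul_comm, smul_mul_assoc, hx, smul_comm]

theorem ad_fineGammaP (h : k * 2 ^ ℓ = n + 1) (p : Fin k → Fˣ) (z : Fˣ) (s : T ℓ)
    (g : BigGroup ℓ k) {x : space F (Fin (n + 1))} (hx : x ∈ fineGammaP F h g) :
    ad (monomialUnit (labelling h) p s) z x = (chi p z s g : F) • x :=
  Subtype.ext (conj_matComponent _ p z s g hx)

theorem upperLeft_mem (lab : Fin k × B ℓ ≃ Fin (n + 1)) (i j : Fin k) (t : T ℓ) :
    fromBlocks (basisMat lab i j t) 0 0 0 ∈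
      matComponent (X F ℓ) (fun t => (t, 0, 0)) e e₀ lab (e i + (t, 0, 0) - e j) :=
  Submodule.subset_span (Or.inl (Or.inl (Or.inl ⟨i, j, t, rfl, rfl⟩)))

theorem upperRight_mem (lab : Fin k × B ℓ ≃ Fin (n + 1)) (i j : Fin k) (t : T ℓ) :
    fromBlocks 0 (basisMat lab i j t) 0 0 ∈
      matComponent (X F ℓ) (fun t => (t, 0, 0)) e e₀ lab (e i + (t, 0, 0) + e j - e₀) :=
  Submodule.subset_span (Or.inl (Or.inl (Or.inr ⟨i, j, t, rfl, rfl⟩)))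

theorem lowerLeft_mem (lab : Fin k × B ℓ ≃ Fin (n + 1)) (i j : Fin k) (t : T ℓ) :
    fromBlocks 0 0 (basisMat lab i j t) 0 ∈
      matComponent (X F ℓ) (fun t => (t, 0, 0)) e e₀ lab (-e i + (t, 0, 0) - e j + e₀) :=
  Submodule.subset_span (Or.inl (Or.inr ⟨i, j, t, rfl, rfl⟩))

theorem lowerRight_mem (lab : Fin k × B ℓ ≃ Fin (n + 1)) (i j : Fin k) (t : T ℓ) :
    fromBlocks 0 0 0 (basisMat lab i j t) ∈
      matComponent (X F ℓ) (fun t => (t, 0, 0)) e e₀ lab (-e i + (t, 0, 0) + e j) :=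
  Submodule.subset_span (Or.inr ⟨i, j, t, rfl, rfl⟩)

/-- Transposition exchanges i and j and changes X_t only by a sign, so the lower right block has the
same degree as the upper left one. -/
theorem diag_mem (lab : Fin k × B ℓ ≃ Fin (n + 1)) (i j : Fin k) (t : T ℓ) :
    fromBlocks (basisMat lab i j t) 0 0 (-(basisMat lab i j t)ᵀ) ∈
      matComponent (X F ℓ) (fun t => (t, 0, 0)) e e₀ lab (e i + (t, 0, 0) - e j) := by
  have e1 : fromBlocks (basisMat lab i j t) 0 0 (-(basisMat lab i j t : Matrix _ _ F)ᵀ) =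
      fromBlocks (basisMat lab i j t) 0 0 0 +
        (-(sgn F (coordA t ⬝ᵥ projB t) : F)) • fromBlocks 0 0 0 (basisMat lab j i t) := by
    rw [basisMat_transpose, fromBlocks_smul, fromBlocks_add]
    simp
  rw [e1]
  refine add_mem (upperLeft_mem lab i j t) (Submodule.smul_mem _ _ ?_)
  convert lowerRight_mem (F := F) lab j i t using 2
  abel

theorem symElt_basisMat_mem (h : k * 2 ^ ℓ = n + 1) (i j : Fin k) (t : T ℓ) :
    symElt (basisMat (labelling h) i j t) ∈ fineGammaP F h (e i + (t, 0, 0) + e j - e₀) := by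
  change fromBlocks 0 ((2 : F)⁻¹ • (basisMat (labelling h) i j t +
    (basisMat (labelling h) i j t)ᵀ)) 0 0 ∈ matComponent _ _ _ _ _ _
  have e1 : (fromBlocks 0 ((2 : F)⁻¹ • (basisMat (labelling h) i j t +
      (basisMat (labelling h) i j t : Matrix _ _ F)ᵀ)) 0 0 : Mat F (Fin (n + 1))) =
      (2 : F)⁻¹ • (fromBlocks 0 (basisMat (labelling h) i j t) 0 0 +
        (sgn F (coordA t ⬝ᵥ projB t) : F) • fromBlocks 0 (basisMat (labelling h) j i t) 0 0) := by
    rw [basisMat_transpose, fromBlocks_smul, fromBlocks_add, fromBlocks_smul]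
    simp
  rw [e1]
  refine Submodule.smul_mem _ _ (add_mem (upperRight_mem _ i j t) (Submodule.smul_mem _ _ ?_))
  convert upperRight_mem (F := F) (labelling h) j i t using 2
  abel

theorem skewElt_basisMat_mem (h : k * 2 ^ ℓ = n + 1) (i j : Fin k) (t : T ℓ) :
    skewElt (basisMat (labelling h) i j t) ∈ fineGammaP F h (-e i + (t, 0, 0) - e j + e₀) := by
  change fromBlocks 0 0 ((2 : F)⁻¹ • (basisMat (labelling h) i j t -
    (basisMat (labelling h) i j t)ᵀ)) 0 ∈ matComponent _ _ _ _ _ _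
  have e1 : (fromBlocks 0 0 ((2 : F)⁻¹ • (basisMat (labelling h) i j t -
      (basisMat (labelling h) i j t : Matrix _ _ F)ᵀ)) 0 : Mat F (Fin (n + 1))) =
      (2 : F)⁻¹ • (fromBlocks 0 0 (basisMat (labelling h) i j t) 0 +
        (-(sgn F (coordA t ⬝ᵥ projB t) : F)) • fromBlocks 0 0 (basisMat (labelling h) j i t) 0) := by
    rw [basisMat_transpose, fromBlocks_smul, fromBlocks_add, fromBlocks_smul]
    simp [sub_eq_add_neg]
  rw [e1]
  refine Submodule.smul_mem _ _ (add_mem (lowerLeft_mem _ i j t) (Submodule.smul_mem _ _ ?_))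
  convert lowerLeft_mem (F := F) (labelling h) j i t using 2
  abel

/-- The even element attached to the traceless part of a matrix. -/
def tracelessElt {I : Type*} [Fintype I] [DecidableEq I] [Nonempty I] :
    Matrix I I F →ₗ[F] space F I where
  toFun m := evenElt (m - ((Fintype.card I : F)⁻¹ * m.trace) • 1) (by
    have : (Fintype.card I : F) ≠ 0 := Nat.cast_ne_zero.2 Fintype.card_ne_zero
    rw [trace_sub, trace_smul, trace_one, smul_eq_mul]
    field_simp
    ring)
  map_add' x y := Subtype.ext (by
    simp only [evenElt, Submodule.coe_add, fromBlocks_add, trace_add, mul_add, add_smul, add_zero,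
      transpose_sub, transpose_add]
    congr 1 <;> abel)
  map_smul' r x := Subtype.ext (by
    simp [evenElt, fromBlocks_smul, smul_sub, smul_smul, mul_left_comm])

theorem tracelessElt_of_trace_eq_zero {I : Type*} [Fintype I] [DecidableEq I] [Nonempty I]
    {a : Matrix I I F} (ha : a.trace = 0) : tracelessElt a = evenElt a ha := by
  refine Subtype.ext ?_
  change fromBlocks (a - _) 0 0 (-(a - _)ᵀ) = fromBlocks a 0 0 (-aᵀ)
  simp [ha]

theorem tracelessElt_basisMat_mem (h : k * 2 ^ ℓ = n + 1) (i j : Fin k) (t : T ℓ) :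
    tracelessElt (basisMat (labelling h) i j t) ∈ fineGammaP F h (e i + (t, 0, 0) - e j) := by
  change fromBlocks (_ - _) 0 0 (-(_ - _)ᵀ) ∈ matComponent _ _ _ _ _ _
  set m : Matrix (Fin (n + 1)) (Fin (n + 1)) F := basisMat (labelling h) i j t with hm
  have e1 : ∀ c : F, fromBlocks (m - c • 1) 0 0 (-(m - c • 1)ᵀ) =
      fromBlocks m 0 0 (-mᵀ) - c • fromBlocks 1 0 0 (-1ᵀ) := by
    intro c
    rw [fromBlocks_smul, sub_eq_add_neg (fromBlocks _ _ _ _), fromBlocks_neg, fromBlocks_add]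
    simp [sub_eq_add_neg, add_comm]
  rw [e1]
  refine sub_mem (diag_mem _ i j t) ?_
  -- The trace is nonzero only here. The degree is then 0, which is also the degree of the element
  -- with diagonal blocks 1 and -1, the sum of the contributions of all E_ii ⊗ X_0.
  by_cases h0 : i = j ∧ t = 0
  · obtain ⟨rfl, rfl⟩ := h0
    have e2 : (1 : Matrix (Fin (n + 1)) (Fin (n + 1)) F) = ∑ i, basisMat (labelling h) i i 0 := by
      rw [← blockMat_one (labelling h)]
      ext x y
      obtain ⟨q, rfl⟩ := (labelling h).surjective x
      obtain ⟨r, rfl⟩ := (labelling h).surjective y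
      simp only [Matrix.sum_apply, basisMat, blockMat_apply, X_zero, ← Finset.sum_mul]
      congr 1
      rw [Finset.sum_eq_single q.1]
      · simp [one_apply, single_apply]
      · intro i _ hi
        simp [hi]
      · simp
    let D : Matrix (Fin (n + 1)) (Fin (n + 1)) F →+ Mat F (Fin (n + 1)) :=
      { toFun := fun m => fromBlocks m 0 0 (-mᵀ)
        map_zero' := by simp
        map_add' := fun x y => by simp [fromBlocks_add, add_comm] }
    have e3 : D 1 = ∑ i, D (basisMat (labelling h) i i 0) := by rw [← map_sum, ← e2]
    refine Submodule.smul_mem _ _ ?_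
    change D 1 ∈ _
    rw [e3]
    refine sum_mem fun i' _ => ?_
    change fromBlocks _ 0 0 (-_ᵀ) ∈ _
    convert diag_mem (F := F) (labelling h) i' i' 0 using 1
    rw [add_sub_right_comm, add_sub_right_comm, sub_self, sub_self]
  · have : m.trace = 0 := by
      rw [hm, basisMat, trace_blockMat]
      by_cases hij : i = j
      · rw [trace_X F fun ht => h0 ⟨hij, ht⟩, mul_zero]
      · rw [trace_single_eq_of_ne _ _ _ hij, zero_mul]
    rw [this, mul_zero, zero_smul]
    exact zero_mem _

theorem iSup_fineGammaP (h : k * 2 ^ ℓ = n + 1) : ⨆ g, fineGammaP F h g = ⊤ := by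
  have key : ∀ (f : Matrix (Fin (n + 1)) (Fin (n + 1)) F →ₗ[F] space F (Fin (n + 1))),
      (∀ i j t, ∃ g, f (basisMat (labelling h) i j t) ∈ fineGammaP F h g) →
      ∀ m, f m ∈ ⨆ g, fineGammaP F h g := by
    intro f hf m
    have : Submodule.span F {x | ∃ i j t, x = basisMat (labelling h) i j t} ≤
        (⨆ g, fineGammaP F h g).comap f := by
      rw [Submodule.span_le]
      rintro _ ⟨i, j, t, rfl⟩
      obtain ⟨g, hg⟩ := hf i j t
      exact Submodule.mem_iSup_of_mem g hg
    exact this (span_basisMat _ m)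
  rw [eq_top_iff]
  intro x _
  obtain ⟨a, ha, b, c, hb, hc, rfl⟩ := exists_eq_add x
  have e1 : oddElt b c hb hc = symElt b + skewElt c := by
    rw [symElt_of_symm hb, skewElt_of_skew hc]
    exact Subtype.ext (by simp [oddElt, fromBlocks_add])
  rw [e1, ← tracelessElt_of_trace_eq_zero ha]
  exact add_mem (key _ (fun i j t => ⟨_, tracelessElt_basisMat_mem h i j t⟩) a)
    (add_mem (key _ (fun i j t => ⟨_, symElt_basisMat_mem h i j t⟩) b)
      (key _ (fun i j t => ⟨_, skewElt_basisMat_mem h i j t⟩) c))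

theorem isGrading_fineGammaP (h : k * 2 ^ ℓ = n + 1) :
    (periplectic F (Fin (n + 1))).IsGrading (fineGammaP F h) :=
  LieSuperalgebra.isGrading_of_eigen
    (fun j : (Fin k → Fˣ) × Fˣ × T ℓ => ad (monomialUnit (labelling h) j.1 j.2.2) j.2.1)
    (fun j => isAut_ad _ _) (fun j g => (chi j.1 j.2.1 j.2.2 g : F))
    (fun j g g' => by rw [chi_add, Units.val_mul])
    (fun j g x hx => ad_fineGammaP h j.1 j.2.1 j.2.2 g hx)
    (fun g g' hg => by
      obtain ⟨p, z, s, hne⟩ := exists_chi_ne (F := F) hg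
      exact ⟨(p, z, s), fun hh => hne (Units.ext hh)⟩)
    (iSup_fineGammaP h)

end FineGrading

end Periplectic

/-! ### Centralizers of the matrices diag(p) ⊗ X_s, and fineness of Γ_P(ℓ) -/

namespace Periplectic

open Matrix

section Centralizer

variable {F : Type*} [Field F] {I : Type*} [Fintype I] {ℓ k : ℕ} (lab : Fin k × B ℓ ≃ I)

theorem mul_blockMat_diagonal_apply (u : Matrix I I F) (p : Fin k → F) (Y : Matrix (B ℓ) (B ℓ) F)
    (x : I) (j : Fin k) (b : B ℓ) : (u * blockMat lab (diagonal p) Y) x (lab (j, b)) =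
      p j * ∑ c, u x (lab (j, c)) * Y c b := by
  rw [mul_apply, ← lab.sum_comp, Fintype.sum_prod_type, Finset.sum_eq_single j]
  · simp only [blockMat_apply, diagonal_apply_eq, Finset.mul_sum]
    exact Finset.sum_congr rfl fun c _ => by ring
  · intro i _ hi
    simp [blockMat_apply, hi]
  · simp

theorem blockMat_diagonal_mul_apply (u : Matrix I I F) (p : Fin k → F) (Y : Matrix (B ℓ) (B ℓ) F)
    (i : Fin k) (a : B ℓ) (y : I) : (blockMat lab (diagonal p) Y * u) (lab (i, a)) y =
      p i * ∑ c, Y a c * u (lab (i, c)) y := by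
  rw [mul_apply, ← lab.sum_comp, Fintype.sum_prod_type, Finset.sum_eq_single i]
  · simp only [blockMat_apply, diagonal_apply_eq, Finset.mul_sum]
    exact Finset.sum_congr rfl fun c _ => by ring
  · intro j _ hj
    simp [blockMat_apply, hj.symm]
  · simp

variable [CharZero F]

theorem linearIndependent_X : LinearIndependent F (X F ℓ) := by
  refine linearIndependent_of_top_le_span_of_card_eq_finrank (span_X F).ge ?_
  rw [Module.finrank_matrix]
  simp [pow_mul', sq, Module.finrank_self]

variable [DecidableEq I]

/-- An invertible matrix commuting up to sign with all `diag(p) ⊗ X_s` is of this form. -/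
theorem exists_eq_monomialUnit (hk : 0 < k) (u : (Matrix I I F)ˣ)
    (hu : ∀ p s, u * monomialUnit lab p s = monomialUnit lab p s * u ∨
      u * monomialUnit lab p s = -(monomialUnit lab p s * u)) :
    ∃ p s, u = monomialUnit lab p s := by
  have hval : ∀ {m : (Matrix I I F)ˣ}, u * m = m * u → ∀ x y,
      (u.val * m.val) x y = (m.val * u.val) x y := fun h x y => by
    rw [← Units.val_mul, h, Units.val_mul]
  have hval' : ∀ {m : (Matrix I I F)ˣ}, u * m = -(m * u) → ∀ x y,
      (u.val * m.val) x y = -(m.val * u.val) x y := fun h x y => by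
    rw [← Units.val_mul, h, Units.val_neg, Matrix.neg_apply, Units.val_mul]
  have hoff : ∀ i j a b, i ≠ j → u.val (lab (i, a)) (lab (j, b)) = 0 := by
    intro i j a b hij
    -- Distinct positive integers: neither a difference nor a sum of two entries vanishes, so either
    -- sign forces the off-diagonal blocks to be zero.
    let p : Fin k → Fˣ := fun i => Units.mk0 ((i.val + 1 : ℕ) : F) (Nat.cast_ne_zero.2 (by omega))
    have e1 : (u.val * (monomialUnit lab p 0).val) (lab (i, a)) (lab (j, b)) =
        ((j.val + 1 : ℕ) : F) * u.val (lab (i, a)) (lab (j, b)) := by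
      rw [monomialUnit_val, X_zero, mul_blockMat_diagonal_apply]
      simp [p, one_apply]
    have e2 : ((monomialUnit lab p 0).val * u.val) (lab (i, a)) (lab (j, b)) =
        ((i.val + 1 : ℕ) : F) * u.val (lab (i, a)) (lab (j, b)) := by
      rw [monomialUnit_val, X_zero, blockMat_diagonal_mul_apply]
      simp [p, one_apply]
    have hij' : i.val ≠ j.val := fun h => hij (Fin.ext h)
    rcases hu p 0 with h | h
    · have h1 := hval h (lab (i, a)) (lab (j, b))
      rw [e1, e2, ← sub_eq_zero, ← sub_mul] at h1
      refine (mul_eq_zero.1 h1).resolve_left (sub_ne_zero.2 fun h2 => hij' ?_)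
      have := Nat.cast_injective (R := F) h2
      omega
    · have h1 := hval' h (lab (i, a)) (lab (j, b))
      rw [e1, e2, ← sub_eq_zero,
        sub_neg_eq_add, ← add_mul, ← Nat.cast_add] at h1
      exact (mul_eq_zero.1 h1).resolve_left (Nat.cast_ne_zero.2 (by omega))
  let U : Fin k → Matrix (B ℓ) (B ℓ) F := fun i => of fun a b => u.val (lab (i, a)) (lab (i, b))
  -- The sign ε is common to all diagonal blocks, which is what later forces the same t in each of
  -- them.
  have hcomm : ∀ s, ∃ ε : F, ∀ i, U i = ε • (X F ℓ s * U i * (X F ℓ s)ᵀ) := by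
    intro s
    have key : ∃ ε : F, ∀ i, U i * X F ℓ s = ε • (X F ℓ s * U i) := by
      have e1 : ∀ i a b, (u.val * (monomialUnit lab (1 : Fin k → Fˣ) s).val) (lab (i, a)) (lab (i, b)) =
          (U i * X F ℓ s) a b := by
        intro i a b
        rw [monomialUnit_val, mul_blockMat_diagonal_apply]
        simp [U, mul_apply]
      have e2 : ∀ i a b, ((monomialUnit lab (1 : Fin k → Fˣ) s).val * u.val) (lab (i, a)) (lab (i, b)) =
          (X F ℓ s * U i) a b := by
        intro i a b
        rw [monomialUnit_val, blockMat_diagonal_mul_apply]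
        simp [U, mul_apply]
      rcases hu 1 s with h | h
      · refine ⟨1, fun i => ?_⟩
        ext a b
        rw [one_smul, ← e1, ← e2]
        exact hval h _ _
      · refine ⟨-1, fun i => ?_⟩
        ext a b
        rw [neg_one_smul, Matrix.neg_apply, ← e1, ← e2]
        exact hval' h _ _
    obtain ⟨ε, hε⟩ := key
    refine ⟨ε, fun i => ?_⟩
    rw [← smul_mul_assoc, ← hε, mul_assoc, X_mul_transpose, mul_one]
  have hspan : ∀ i, ∃ c : T ℓ → F, ∑ t, c t • X F ℓ t = U i := fun i =>
    (Submodule.mem_span_range_iff_exists_fun F).1 (span_X F ▸ Submodule.mem_top)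
  choose c hc using hspan
  -- Conjugation by X_s multiplies the coefficient of X_t by a sign, so every t that occurs
  -- satisfies ε · sgn(comm s t) = 1 for each s. Nondegeneracy leaves one t.
  have hsame : ∀ i j t t', c i t ≠ 0 → c j t' ≠ 0 → t = t' := by
    intro i j t t' ht ht'
    by_contra hne
    obtain ⟨s, hs⟩ := exists_comm_ne hne
    obtain ⟨ε, hε⟩ := hcomm s
    have key : ∀ i t, c i t = ε * (c i t * sgn F (comm s t)) := by
      intro i t
      have h1 := hε i
      rw [← hc i, Finset.mul_sum, Finset.sum_mul, Finset.smul_sum] at h1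
      simp only [mul_smul_comm, smul_mul_assoc, X_conj, smul_smul] at h1
      rw [← sub_eq_zero, ← Finset.sum_sub_distrib] at h1
      simp only [← sub_smul] at h1
      have := Fintype.linearIndependent_iff.1 (linearIndependent_X (F := F)) _ h1 t
      rwa [sub_eq_zero] at this
    have k1 : ε * sgn F (comm s t) = 1 := mul_left_cancel₀ ht (by
      linear_combination -key i t)
    have k2 : ε * sgn F (comm s t') = 1 := mul_left_cancel₀ ht' (by
      linear_combination -key j t')
    have hε0 : ε ≠ 0 := fun h => by simp [h] at k1
    exact sgn_ne F hs (Units.ext (mul_left_cancel₀ hε0 (k1.trans k2.symm)))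
  have hne : ∀ i, ∃ t, c i t ≠ 0 := by
    intro i
    by_contra! hcon
    have hU : U i = 0 := by rw [← hc i]; simp [hcon]
    have : ∀ y, u.val (lab (i, 0)) y = 0 := by
      intro y
      obtain ⟨⟨j, b⟩, rfl⟩ := lab.surjective y
      by_cases hij : i = j
      · subst hij
        exact congrFun (congrFun hU 0) b
      · exact hoff i j 0 b hij
    have h1 := congrFun (congrFun u.mul_inv (lab (i, 0))) (lab (i, 0))
    rw [mul_apply] at h1
    simp [this] at h1
  obtain ⟨t, ht⟩ := hne ⟨0, hk⟩
  have hct : ∀ i, c i t ≠ 0 := by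
    intro i
    obtain ⟨t', ht'⟩ := hne i
    rwa [hsame _ _ _ _ ht ht']
  refine ⟨fun i => Units.mk0 (c i t) (hct i), t, Units.ext ?_⟩
  have hUi : ∀ i, U i = c i t • X F ℓ t := by
    intro i
    rw [← hc i, Finset.sum_eq_single t]
    · intro t' _ ht'
      by_contra h
      exact ht' (hsame i i t' t (fun h0 => h (by rw [h0, zero_smul])) (hct i))
    · simp
  ext x y
  obtain ⟨⟨i, a⟩, rfl⟩ := lab.surjective x
  obtain ⟨⟨j, b⟩, rfl⟩ := lab.surjective y
  rw [monomialUnit_val, blockMat_apply]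
  by_cases hij : i = j
  · subst hij
    have := congrFun (congrFun (hUi i) a) b
    simpa [U] using this
  · rw [hoff i j a b hij]
    simp [hij]

end Centralizer

section Diagonal

variable {F : Type*} [Field F] [IsAlgClosed F] [CharZero F] {n ℓ k : ℕ}

/-- An automorphism commuting with the automorphisms attached to `Γ_P(ℓ)` is one of them. -/
theorem exists_eq_ad_monomialUnit (hn : 2 ≤ n) (h : k * 2 ^ ℓ = n + 1)
    {θ : space F (Fin (n + 1)) ≃ₗ[F] space F (Fin (n + 1))}
    (hθ : (periplectic F (Fin (n + 1))).IsAut θ)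
    (hcomm : ∀ (p : Fin k → Fˣ) (s : T ℓ) x, θ (ad (monomialUnit (labelling h) p s) 1 x) =
      ad (monomialUnit (labelling h) p s) 1 (θ x)) :
    ∃ (p : Fin k → Fˣ) (s : T ℓ), θ = ad (monomialUnit (labelling h) p s) 1 := by
  obtain ⟨u, rfl⟩ := exists_eq_ad (by rw [Fintype.card_fin]; omega) hθ
  obtain ⟨p, s, rfl⟩ := exists_eq_monomialUnit (labelling h) (pos_of_mul_eq h) u fun p s => by
    refine eq_or_eq_neg_of_ad_eq (LinearEquiv.ext fun x => ?_)
    have h1 := ad_mul u (monomialUnit (labelling h) p s) 1 1 x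
    have h2 := ad_mul (monomialUnit (labelling h) p s) u 1 1 x
    rw [mul_one] at h1 h2
    rw [h1, h2, hcomm]
  exact ⟨p, s, rfl⟩

/-- If an automorphism acts by scalars on subspaces of the components of `Γ_P(ℓ)` spanning the
whole algebra, then it acts by a character on the components of `Γ_P(ℓ)`. -/
theorem exists_character_of_scalar (hn : 2 ≤ n) (h : k * 2 ^ ℓ = n + 1)
    {θ : space F (Fin (n + 1)) ≃ₗ[F] space F (Fin (n + 1))}
    (hθ : (periplectic F (Fin (n + 1))).IsAut θ) {ι : Type*}
    (Δ : ι → Submodule F (space F (Fin (n + 1)))) (hΔ : ⨆ i, Δ i = ⊤)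
    (hle : ∀ i, ∃ g, Δ i ≤ fineGammaP F h g) (c : ι → F) (hc : ∀ i, ∀ x ∈ Δ i, θ x = c i • x) :
    ∃ (p : Fin k → Fˣ) (s : T ℓ), ∀ g, ∀ x ∈ fineGammaP F h g, θ x = (chi p 1 s g : F) • x := by
  obtain ⟨p, s, rfl⟩ := exists_eq_ad_monomialUnit hn h hθ fun p s x => by
    -- Both maps are scalar on each Δ i, and these subspaces span.
    have : (θ : _ →ₗ[F] _) ∘ₗ (ad (monomialUnit (labelling h) p s) 1).toLinearMap =
        (ad (monomialUnit (labelling h) p s) 1).toLinearMap ∘ₗ (θ : _ →ₗ[F] _) := by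
      refine LieSuperalgebra.eqOn_of_iSup_eq_top hΔ fun i x hx => ?_
      obtain ⟨g, hg⟩ := hle i
      simp only [LinearMap.comp_apply, LinearEquiv.coe_coe]
      rw [ad_fineGammaP h p 1 s g (hg hx), map_smul, hc i x hx, map_smul,
        ad_fineGammaP h p 1 s g (hg hx), smul_comm]
    exact LinearMap.congr_fun this x
  exact ⟨p, s, fun g x hx => ad_fineGammaP h p 1 s g hx⟩

/-- The gradings `Γ_P(ℓ)` are fine. -/
theorem isFine_fineGammaP (hn : 2 ≤ n) (h : k * 2 ^ ℓ = n + 1) :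
    LieSuperalgebra.IsFine.{w} (periplectic F (Fin (n + 1))) (fineGammaP F h) := by
  refine ⟨isGrading_fineGammaP h, fun H _ Δ hΔ ⟨href, t, ht, g, hg, hlt⟩ => ?_⟩
  have hle : ∀ i, ∃ g, Δ i ≤ fineGammaP F h g := fun i => by
    by_cases hi : i ∈ LieSuperalgebra.support Δ
    · obtain ⟨s, -, hs⟩ := href i hi
      exact ⟨s, hs⟩
    · exact ⟨0, by rw [not_not.1 hi]; exact bot_le⟩
  -- Every character of H acts on the component of degree g of Γ_P(ℓ) by a scalar, so that component
  -- lies in one Δ t'. This contradicts the strict inclusion of Δ t in it.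
  obtain ⟨t', ht'⟩ := LieSuperalgebra.le_component_of_scalar (S := periplectic F (Fin (n + 1)))
    hΔ.indep hΔ.iSup_eq_top (fineGammaP F h g) (fun χ θ hθΔ hθ => by
      obtain ⟨p, s, hps⟩ := exists_character_of_scalar hn h hθ Δ hΔ.iSup_eq_top hle _ hθΔ
      exact ⟨_, hps g⟩) hΔ
  by_cases htt : t = t'
  · subst htt
    exact absurd ht' hlt.not_ge
  · have := hΔ.indep.pairwiseDisjoint htt
    exact ht (disjoint_self.1 (this.mono_right (hlt.le.trans ht')))

end Diagonal

end Periplectic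

/-! ### Diagonalizable operators and rescaling to involutions -/

namespace Periplectic

open Module

section Operators

variable {F : Type*} [Field F] {V : Type*} [AddCommGroup V] [Module F V]

/-- Generalized eigenvectors (of rank two, hence all of them) are eigenvectors. -/
def IsReduced (f : End F V) : Prop :=
  ∀ (c : F) (x : V), f (f x) - (2 * c) • f x + (c * c) • x = 0 → f x = c • x

theorem IsReduced.neg {f : End F V} (hf : IsReduced f) : IsReduced (-f) := by
  intro c x hx
  have := hf (-c) x (by rw [← hx]; simp [smul_neg, neg_smul])
  rw [LinearMap.neg_apply, this, neg_smul, neg_neg]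

theorem IsReduced.maxGenEigenspace_eq {f : End F V} (hf : IsReduced f) (c : F) :
    f.maxGenEigenspace c = f.eigenspace c := by
  refine le_antisymm (fun x hx => ?_) (f.genEigenspace_le_maximal c 1)
  obtain ⟨m, hm⟩ := (End.mem_maxGenEigenspace f c x).1 hx
  rw [End.mem_eigenspace_iff]
  have key : ∀ y, (f - c • (1 : End F V)) ((f - c • (1 : End F V)) y) = 0 → (f - c • (1 : End F V)) y = 0 := by
    intro y hy
    have := hf c y (by
      rw [← hy]
      simp only [LinearMap.sub_apply, LinearMap.smul_apply, End.one_apply, map_sub, map_smul]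
      module)
    simp [this]
  have h : ∀ m y, ((f - c • (1 : End F V)) ^ (m + 1)) y = 0 → (f - c • (1 : End F V)) y = 0 := by
    intro m
    induction m with
    | zero => exact fun y hy => by rwa [zero_add, pow_one] at hy
    | succ m ih => exact fun y hy => key y (ih _ (by rwa [pow_succ, End.mul_apply] at hy))
  have := h m x (by rw [pow_succ', End.mul_apply, hm, map_zero])
  simpa [sub_eq_zero] using this

theorem IsReduced.iSup_eigenspace [IsAlgClosed F] [FiniteDimensional F V] {f : End F V}
    (hf : IsReduced f) : ⨆ c, f.eigenspace c = ⊤ := by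
  simp only [← hf.maxGenEigenspace_eq]
  exact End.iSup_maxGenEigenspace_eq_top f

/-- If (f - c)²x = 0 then (f² - c²)²x = 0, so f²x = c²x. Subtracting the two expressions for f²x
gives 2c(f x - c x) = 0; for c = 0 injectivity is used instead. -/
theorem IsReduced.of_mul_self [CharZero F] {f : End F V} (hf : IsReduced (f * f))
    (hi : ∀ x, f x = 0 → x = 0) : IsReduced f := by
  intro c x hx
  have h2 : f (f x) = (2 * c) • f x - (c * c) • x := by
    rw [← sub_eq_zero, ← hx]
    abel
  have h1 := hf (c * c) x (by
    simp only [End.mul_apply, h2, map_sub, map_smul]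
    module)
  rw [End.mul_apply, h2] at h1
  by_cases hc : c = 0
  · subst hc
    rw [zero_smul]
    refine hi _ ?_
    rw [h2]
    simp
  · have : (2 * c) • (f x - c • x) = 0 := by
      rw [smul_sub, smul_smul, sub_eq_zero]
      rw [sub_eq_iff_eq_add] at h1
      rw [h1]
      module
    exact sub_eq_zero.1 ((smul_eq_zero.1 this).resolve_left (mul_ne_zero two_ne_zero hc))

/-- Two operators that commute up to sign. -/
def SignComm (f g : End F V) : Prop := f * g = g * f ∨ f * g = -(g * f)

theorem SignComm.symm {f g : End F V} (h : SignComm f g) : SignComm g f := by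
  rcases h with h | h
  · exact Or.inl h.symm
  · exact Or.inr (by rw [h, neg_neg])

theorem SignComm.mul {f g h : End F V} (hf : SignComm f h) (hg : SignComm g h) :
    SignComm (f * g) h := by
  unfold SignComm at *
  rcases hg with hg | hg <;> rcases hf with hf | hf
  · left; rw [mul_assoc, hg, ← mul_assoc, hf, mul_assoc]
  · right; rw [mul_assoc, hg, ← mul_assoc, hf, neg_mul, mul_assoc]
  · right; rw [mul_assoc, hg, mul_neg, ← mul_assoc, hf, mul_assoc]
  · left; rw [mul_assoc, hg, mul_neg, ← mul_assoc, hf, neg_mul, neg_neg, mul_assoc]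

theorem signComm_closure {S : Set (End F V)} (hS : ∀ f ∈ S, ∀ g ∈ S, SignComm f g)
    {f g : End F V} (hf : f ∈ Submonoid.closure S) (hg : g ∈ Submonoid.closure S) :
    SignComm f g := by
  have h1 : ∀ f ∈ S, ∀ g ∈ Submonoid.closure S, SignComm g f := by
    intro f hf g hg
    induction hg using Submonoid.closure_induction with
    | mem x hx => exact hS x hx f hf
    | one => exact Or.inl (by simp)
    | mul x y _ _ hx hy => exact hx.mul hy
  induction hf using Submonoid.closure_induction with
  | mem x hx => exact (h1 x hx g hg).symm
  | one => exact Or.inl (by simp)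
  | mul x y _ _ hx hy => exact hx.mul hy

/-- An invertible operator with diagonalizable square can be rescaled to an involution without
changing the operators commuting up to sign with it. -/
theorem exists_involution [IsAlgClosed F] [FiniteDimensional F V] {f : End F V}
    (hf : IsReduced (f * f)) (hi : ∀ x, f x = 0 → x = 0) :
    ∃ g : End F V, g * g = 1 ∧ (∀ q, q * f = f * q → q * g = g * q) ∧
      ∀ q, q * f = -(f * q) → q * g = -(g * q) := by
  choose r hr using fun c : F => IsAlgClosed.exists_eq_mul_self c
  -- σ is an inverse square root of f², so σf is the involution. Any q commuting or anticommuting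
  -- with f commutes with f², hence with σ.
  obtain ⟨σ, hσ⟩ := LieSuperalgebra.exists_diagonal_end
    (End.eigenspaces_iSupIndep (f * f)) hf.iSup_eigenspace fun c => (r c)⁻¹
  have hq : ∀ q : End F V, q * (f * f) = f * f * q → q * σ = σ * q := by
    intro q hq
    refine LieSuperalgebra.eqOn_of_iSup_eq_top hf.iSup_eigenspace fun c x hx => ?_
    have : q x ∈ (f * f).eigenspace c := by
      rw [End.mem_eigenspace_iff] at hx ⊢
      rw [← End.mul_apply, ← hq, End.mul_apply, hx, map_smul]
    rw [End.mul_apply, End.mul_apply, hσ c x hx, hσ c _ this, map_smul]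
  have hfσ : f * σ = σ * f := hq f (by rw [mul_assoc])
  refine ⟨σ * f, ?_, ?_, ?_⟩
  · refine LieSuperalgebra.eqOn_of_iSup_eq_top hf.iSup_eigenspace fun c x hx => ?_
    have e : σ * f * (σ * f) = σ * σ * (f * f) := by
      rw [mul_assoc, ← mul_assoc f, hfσ, mul_assoc, mul_assoc]
    have hx' := End.mem_eigenspace_iff.1 hx
    rw [e, End.mul_apply, hx', map_smul, End.mul_apply, hσ c x hx, map_smul, hσ c x hx, smul_smul,
      smul_smul, End.one_apply]
    -- Here the chosen inverse root is the default value 0, which is harmless since f² has no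
    -- kernel.
    by_cases hc : c = 0
    · have : x = 0 := hi _ (hi _ (by rw [← End.mul_apply, hx', hc, zero_smul]))
      simp [this]
    · rw [mul_assoc, ← mul_inv, ← hr c, mul_inv_cancel₀ hc, one_smul]
  · intro q h
    have : q * σ = σ * q := hq q (by rw [← mul_assoc, h, mul_assoc, h, mul_assoc])
    rw [← mul_assoc, this, mul_assoc, h, mul_assoc]
  · intro q h
    have : q * σ = σ * q := hq q (by
      rw [← mul_assoc, h, neg_mul, mul_assoc, h, mul_neg, neg_neg, mul_assoc])
    rw [← mul_assoc, this, mul_assoc, h, mul_neg, mul_assoc]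

/-- Commuting diagonalizable operators have a common eigenbasis. -/
theorem exists_eigenbasis [IsAlgClosed F] [FiniteDimensional F V] {𝒬 : Set (End F V)}
    (hr : ∀ q ∈ 𝒬, IsReduced q) (hc : ∀ q ∈ 𝒬, ∀ r ∈ 𝒬, q * r = r * q) :
    ∃ (k : ℕ) (b : Basis (Fin k) F V), ∀ q ∈ 𝒬, ∃ p : Fin k → F, ∀ i, q (b i) = p i • b i := by
  have h := End.iSup_iInf_maxGenEigenspace_eq_top_of_iSup_maxGenEigenspace_eq_top_of_commute
    (fun q : 𝒬 => q.1) (fun q r _ => hc q q.2 r r.2) fun q => End.iSup_maxGenEigenspace_eq_top _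
  let S : Set V := {x | ∀ q ∈ 𝒬, ∃ c : F, q x = c • x}
  have hS : ⊤ ≤ Submodule.span F S := by
    rw [← h]
    refine iSup_le fun χ x hx => Submodule.subset_span fun q hq => ⟨χ ⟨q, hq⟩, ?_⟩
    have := (Submodule.mem_iInf _).1 hx ⟨q, hq⟩
    rw [(hr q hq).maxGenEigenspace_eq] at this
    exact End.mem_eigenspace_iff.1 this
  let b := Basis.ofSpan hS
  have hb : ∀ i, b i ∈ S := fun i => Basis.ofSpan_subset hS ⟨i, rfl⟩
  have := FiniteDimensional.fintypeBasisIndex b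
  let b' := b.reindex (Fintype.equivFin _)
  refine ⟨_, b', fun q hq => ?_⟩
  have : ∀ i, ∃ c : F, q (b' i) = c • b' i := fun i => by
    rw [Basis.reindex_apply]
    exact hb _ q hq
  choose p hp using this
  exact ⟨p, hp⟩

end Operators

end Periplectic

/-! ### Simultaneous monomial form of operators commuting up to sign -/

namespace Periplectic

open Module Matrix

section Classification

variable {F : Type*} [Field F]

/-- Vectors over `ZMod 2` of length `ℓ + 1`, split by the first entry. -/
def splitEquiv (k ℓ : ℕ) : (Fin k × B ℓ) ⊕ (Fin k × B ℓ) ≃ Fin k × B (ℓ + 1) where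
  toFun := Sum.elim (fun x => (x.1, vecCons 0 x.2)) (fun x => (x.1, vecCons 1 x.2))
  invFun x := if x.2 0 = 0 then Sum.inl (x.1, vecTail x.2) else Sum.inr (x.1, vecTail x.2)
  left_inv := by rintro (x | x) <;> simp
  right_inv x := by
    obtain ⟨i, c⟩ := x
    have hc : vecCons (c 0) (vecTail c) = c := cons_head_tail c
    rcases zmod_two (c 0) with h | h
    · rw [h] at hc
      simp [h, hc]
    · rw [h] at hc
      simp [h, hc]

variable {V : Type*} [AddCommGroup V] [Module F V] [CharZero F]

/-- A basis adapted to a pair of anticommuting involutions. -/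
theorem exists_basis_of_involutions {f g : End F V} (hf : f * f = 1) (hg : g * g = 1)
    (hfg : f * g = -(g * f)) {k ℓ : ℕ} (b : Basis (Fin k × B ℓ) F (f.eigenspace 1)) :
    ∃ b' : Basis (Fin k × B (ℓ + 1)) F V, ∀ i c,
      b' (i, vecCons 0 c) = b (i, c) ∧ b' (i, vecCons 1 c) = g (b (i, c)) := by
  have hf' : ∀ x, f (f x) = x := fun x => by rw [← End.mul_apply, hf, End.one_apply]
  have hg' : ∀ x, g (g x) = x := fun x => by rw [← End.mul_apply, hg, End.one_apply]
  have hfg' : ∀ x, f (g x) = -g (f x) := fun x => by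
    rw [← End.mul_apply, hfg, LinearMap.neg_apply, End.mul_apply]
  have hx : ∀ x : f.eigenspace 1, f x = x := fun x => by
    rw [End.mem_eigenspace_iff.1 x.2, one_smul]
  have h2 : (2 : F)⁻¹ + 2⁻¹ = 1 := by norm_num
  -- As g anticommutes with f it exchanges the eigenspaces of 1 and -1, so V is the sum of the first
  -- one and its image under g.
  let E : (f.eigenspace 1 × f.eigenspace 1) ≃ₗ[F] V :=
    { toFun := fun x => (x.1 : V) + g x.2
      map_add' := fun x y => by
        simp only [Prod.fst_add, Prod.snd_add, Submodule.coe_add, map_add]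
        abel
      map_smul' := fun c x => by simp
      invFun := fun v =>
        (⟨(2 : F)⁻¹ • (v + f v), by
          rw [End.mem_eigenspace_iff, one_smul, map_smul, map_add, hf', add_comm]⟩,
        ⟨(2 : F)⁻¹ • g (v - f v), by
          rw [End.mem_eigenspace_iff, one_smul, map_smul, hfg', map_sub, hf', ← map_neg,
            neg_sub]⟩)
      left_inv := fun x => by
        refine Prod.ext (Subtype.ext ?_) (Subtype.ext ?_)
        · change (2 : F)⁻¹ • (((x.1 : V) + g x.2) + f ((x.1 : V) + g x.2)) = x.1
          rw [map_add, hfg', hx, hx, show ((x.1 : V) + g x.2) + (x.1 + -g x.2) = (x.1 : V) + x.1 by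
            abel, smul_add, ← add_smul, h2, one_smul]
        · change (2 : F)⁻¹ • g (((x.1 : V) + g x.2) - f ((x.1 : V) + g x.2)) = x.2
          rw [map_add f, hfg', hx, hx,
            show ((x.1 : V) + g x.2) - (x.1 + -g x.2) = g x.2 + g x.2 by abel, map_add, hg',
            smul_add, ← add_smul, h2, one_smul]
      right_inv := fun v => by
        change (2 : F)⁻¹ • (v + f v) + g ((2 : F)⁻¹ • g (v - f v)) = v
        rw [map_smul, hg', ← smul_add, show v + f v + (v - f v) = v + v by abel, smul_add,
          ← add_smul, h2, one_smul] }
  refine ⟨((b.prod b).map E).reindex (splitEquiv k ℓ), fun i c => ⟨?_, ?_⟩⟩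
  · have : (splitEquiv k ℓ).symm (i, vecCons 0 c) = Sum.inl (i, c) := by
      rw [Equiv.symm_apply_eq]
      rfl
    rw [Basis.reindex_apply, this, Basis.map_apply, Basis.prod_apply]
    change (b (i, c) : V) + g ((0 : f.eigenspace 1) : V) = _
    simp
  · have : (splitEquiv k ℓ).symm (i, vecCons 1 c) = Sum.inr (i, c) := by
      rw [Equiv.symm_apply_eq]
      rfl
    rw [Basis.reindex_apply, this, Basis.map_apply, Basis.prod_apply]
    change ((0 : f.eigenspace 1) : V) + g (b (i, c)) = _
    simp

/-- An operator commuting up to sign with a pair of anticommuting involutions `f` and `g` is the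
product of an operator commuting with `f` and `g` and of `f^a g^b`. -/
theorem exists_factorization {f g q : End F V} (hf : f * f = 1) (hg : g * g = 1)
    (hfg : f * g = -(g * f)) (hqf : SignComm q f) (hqg : SignComm q g) :
    ∃ r : End F V, r * f = f * r ∧ r * g = g * r ∧ (r * r = q * q ∨ r * r = -(q * q)) ∧
      r ∈ Submonoid.closure {q, f, g} ∧
      (q = r ∨ q = r * f ∨ q = r * g ∨ q = r * f * g) := by
  have hq : q ∈ Submonoid.closure {q, f, g} := Submonoid.subset_closure (by simp)
  have hfm : f ∈ Submonoid.closure {q, f, g} := Submonoid.subset_closure (by simp)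
  have hgm : g ∈ Submonoid.closure {q, f, g} := Submonoid.subset_closure (by simp)
  have f1 : ∀ x, x * f * f = x := fun x => by rw [mul_assoc, hf, mul_one]
  have g1 : ∀ x, x * g * g = x := fun x => by rw [mul_assoc, hg, mul_one]
  have fg1 : ∀ x, x * f * g = -(x * g * f) := fun x => by rw [mul_assoc, hfg, mul_neg, mul_assoc]
  -- Multiplying q by f changes its sign with g only, multiplying by g its sign with f only. The two
  -- signs thus dictate the factor that makes both positive.
  rcases hqf with h1 | h1 <;> rcases hqg with h2 | h2
  · exact ⟨q, h1, h2, Or.inl rfl, hq, Or.inl rfl⟩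
  · have r1 : ∀ x, x * f * q = x * q * f := fun x => by rw [mul_assoc, ← h1, mul_assoc]
    have r2 : ∀ x, x * g * q = -(x * q * g) := fun x => by
      rw [mul_assoc, mul_assoc, h2, mul_neg, neg_neg]
    refine ⟨q * f, ?_, ?_, Or.inl ?_, mul_mem hq hfm, Or.inr (Or.inl (f1 q).symm)⟩
    · rw [h1, mul_assoc, h1, ← mul_assoc]
    · rw [fg1, h2, neg_mul, neg_neg, mul_assoc]
    · rw [← mul_assoc, r1, f1]
  · have r2 : ∀ x, x * g * q = x * q * g := fun x => by rw [mul_assoc, ← h2, mul_assoc]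
    refine ⟨q * g, ?_, ?_, Or.inl ?_, mul_mem hq hgm, Or.inr (Or.inr (Or.inl (g1 q).symm))⟩
    · rw [← neg_eq_iff_eq_neg.2 (fg1 q), h1, neg_mul, neg_neg, mul_assoc]
    · rw [h2, mul_assoc, h2, ← mul_assoc]
    · rw [← mul_assoc, r2, g1]
  · have r1 : ∀ x, x * f * q = -(x * q * f) := fun x => by
      rw [mul_assoc, mul_assoc, h1, mul_neg, neg_neg]
    have r2 : ∀ x, x * g * q = -(x * q * g) := fun x => by
      rw [mul_assoc, mul_assoc, h2, mul_neg, neg_neg]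
    have h1' : f * q = -(q * f) := by rw [h1, neg_neg]
    have h2' : g * q = -(q * g) := by rw [h2, neg_neg]
    refine ⟨q * g * f, ?_, ?_, Or.inr ?_, mul_mem (mul_mem hq hgm) hfm,
      Or.inr (Or.inr (Or.inr ?_))⟩
    · rw [f1, mul_assoc q, ← mul_assoc f, h1', neg_mul, ← mul_assoc, fg1, neg_mul, neg_neg, f1]
    · rw [fg1, g1, mul_assoc q, ← mul_assoc g, h2', neg_mul, ← mul_assoc, g1]
    · rw [← mul_assoc, ← mul_assoc, r1, r2]
      simp only [neg_mul, neg_neg]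
      rw [fg1, g1, neg_mul, f1]
    · rw [f1, g1]

/-- Invertible operators commuting up to sign whose squares are diagonalizable are, in a suitable
basis, tensor products of diagonal matrices and the matrices `X_t`. -/
theorem exists_monomial_basis [IsAlgClosed F] [FiniteDimensional F V] (𝒬 : Set (End F V))
    (hinj : ∀ q ∈ 𝒬, ∀ x, q x = 0 → x = 0) (hred : ∀ q ∈ 𝒬, IsReduced (q * q))
    (hcomm : ∀ q ∈ 𝒬, ∀ r ∈ 𝒬, SignComm q r) :
    ∃ (ℓ k : ℕ) (b : Basis (Fin k × B ℓ) F V), ∀ q ∈ 𝒬, ∃ (p : Fin k → F) (α β : B ℓ),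
      ∀ i c, q (b (i, c)) = (p i * sgn F (α ⬝ᵥ c)) • b (i, β + c) := by
  induction hd : finrank F V using Nat.strong_induction_on generalizing V with
  | _ d ih =>
  -- A commuting family has a common eigenbasis, which is the case ℓ = 0.
  by_cases hab : ∀ q ∈ 𝒬, ∀ r ∈ 𝒬, q * r = r * q
  · obtain ⟨k, b, hb⟩ := exists_eigenbasis
      (fun q hq => (hred q hq).of_mul_self (hinj q hq)) hab
    refine ⟨0, k, b.reindex (Equiv.prodUnique (Fin k) (B 0)).symm, fun q hq => ?_⟩
    obtain ⟨p, hp⟩ := hb q hq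
    refine ⟨p, 0, 0, fun i c => ?_⟩
    rw [zero_dotProduct, sgn_zero, Units.val_one, mul_one, zero_add, Basis.reindex_apply]
    exact hp i
  push Not at hab
  obtain ⟨f₀, hf₀, g₀, hg₀, hne⟩ := hab
  have hanti : f₀ * g₀ = -(g₀ * f₀) := (hcomm f₀ hf₀ g₀ hg₀).resolve_left hne
  obtain ⟨f, hf, hfc, hfa⟩ := exists_involution (hred f₀ hf₀) (hinj f₀ hf₀)
  obtain ⟨g, hg, hgc, hga⟩ := exists_involution (hred g₀ hg₀) (hinj g₀ hg₀)
  have hqf : ∀ q ∈ 𝒬, SignComm q f := fun q hq => (hcomm q hq f₀ hf₀).imp (hfc q) (hfa q)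
  have hqg : ∀ q ∈ 𝒬, SignComm q g := fun q hq => (hcomm q hq g₀ hg₀).imp (hgc q) (hga q)
  have hfg : f * g = -(g * f) := by
    refine hga f ?_
    rw [hfa g₀ (by rw [hanti, neg_neg]), neg_neg]
  have hf' : ∀ x, f (f x) = x := fun x => by rw [← End.mul_apply, hf, End.one_apply]
  have hg' : ∀ x, g (g x) = x := fun x => by rw [← End.mul_apply, hg, End.one_apply]
  have hfg' : ∀ x, f (g x) = -g (f x) := fun x => by
    rw [← End.mul_apply, hfg, LinearMap.neg_apply, End.mul_apply]
  -- If f were the identity, fg = -gf would force V = 0, where f₀ and g₀ commute.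
  have hlt : finrank F (f.eigenspace 1) < d := by
    rw [← hd]
    refine Submodule.finrank_lt fun htop => hne ?_
    have h1 : ∀ x, f x = x := fun x => by
      have : x ∈ f.eigenspace 1 := htop ▸ Submodule.mem_top
      rw [End.mem_eigenspace_iff.1 this, one_smul]
    have h0 : ∀ x : V, x = 0 := fun x => by
      have := hfg' (g x)
      rw [h1, h1, hg'] at this
      have h2 : (2 : F) • x = 0 := by rw [two_smul, ← sub_neg_eq_add, ← this, sub_self]
      exact (smul_eq_zero.1 h2).resolve_left two_ne_zero
    exact LinearMap.ext fun x => (h0 _).trans (h0 _).symm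
  let S : Set (End F V) := 𝒬 ∪ {f, g}
  have hS : ∀ q ∈ S, ∀ r ∈ S, SignComm q r := by
    rintro q (hq | rfl | rfl) r (hr | rfl | rfl)
    · exact hcomm q hq r hr
    · exact hqf q hq
    · exact hqg q hq
    · exact (hqf r hr).symm
    · exact Or.inl rfl
    · exact Or.inr hfg
    · exact (hqg r hr).symm
    · exact SignComm.symm (Or.inr hfg)
    · exact Or.inl rfl
  -- The induction is applied to the restrictions of all suitable products of elements of 𝒬, f and
  -- g, because the factors r below are such products and need not belong to 𝒬.
  obtain ⟨ℓ, k, b, hb⟩ := ih _ hlt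
    {p : End F (f.eigenspace 1) | ∃ r ∈ Submonoid.closure S, (∀ x, r x = 0 → x = 0) ∧
      IsReduced (r * r) ∧ ∀ x, (p x : V) = r x}
    (fun p ⟨r, _, hr, _, hp⟩ x hx => Subtype.ext (hr _ (by rw [← hp, hx]; rfl)))
    (fun p ⟨r, _, _, hr, hp⟩ c x hx => Subtype.ext (by
      have e : ∀ x, ((p * p) x : V) = (r * r) x := fun x => by
        rw [End.mul_apply, hp, hp, End.mul_apply]
      rw [e, hr c x]
      · rfl
      · rw [← e, ← e]
        exact congrArg Subtype.val hx))
    (fun p ⟨r, hr, _, _, hp⟩ p' ⟨r', hr', _, _, hp'⟩ => by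
      refine (signComm_closure hS hr hr').imp (fun h => ?_) fun h => ?_
      · refine LinearMap.ext fun x => Subtype.ext ?_
        rw [End.mul_apply, End.mul_apply, hp, hp', hp', hp]
        exact LinearMap.congr_fun h x
      · refine LinearMap.ext fun x => Subtype.ext ?_
        rw [LinearMap.neg_apply, Submodule.coe_neg, End.mul_apply, End.mul_apply, hp, hp', hp', hp]
        exact LinearMap.congr_fun h x)
    rfl
  obtain ⟨b', hb'⟩ := exists_basis_of_involutions hf hg hfg b
  refine ⟨ℓ + 1, k, b', fun q hq => ?_⟩
  obtain ⟨r, hrf, hrg, hrr, hrS, hqr⟩ := exists_factorization hf hg hfg (hqf q hq) (hqg q hq)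
  have hrS' : r ∈ Submonoid.closure S := Submonoid.closure_mono (by
    rintro x (rfl | rfl | rfl)
    · exact Or.inl hq
    · exact Or.inr (Or.inl rfl)
    · exact Or.inr (Or.inr rfl)) hrS
  have hrinj : ∀ x, r x = 0 → x = 0 := fun x hx => by
    refine hinj q hq _ (hinj q hq _ ?_)
    rw [← End.mul_apply]
    rcases hrr with h | h
    · rw [← h, End.mul_apply, hx, map_zero]
    · rw [← neg_eq_iff_eq_neg.2 h, LinearMap.neg_apply, End.mul_apply, hx, map_zero, neg_zero]
  have hrred : IsReduced (r * r) := by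
    rcases hrr with h | h
    · exact h ▸ hred q hq
    · exact h ▸ (hred q hq).neg
  have hmaps : ∀ x ∈ f.eigenspace 1, r x ∈ f.eigenspace 1 := fun x hx => by
    rw [End.mem_eigenspace_iff] at hx ⊢
    rw [← End.mul_apply, ← hrf, End.mul_apply, hx, map_smul]
  obtain ⟨p, α, β, hp⟩ := hb (r.restrict hmaps) ⟨r, hrS', hrinj, hrred, fun x => rfl⟩
  have hrb : ∀ i c, r (b (i, c)) = (p i * sgn F (α ⬝ᵥ c)) • (b (i, β + c) : V) := fun i c =>
    congrArg Subtype.val (hp i c)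
  have hr0 : ∀ i c, r (b' (i, vecCons 0 c)) =
      (p i * sgn F (α ⬝ᵥ c)) • b' (i, vecCons 0 (β + c)) := fun i c => by
    rw [(hb' i _).1, (hb' i _).1, hrb]
  have hr1 : ∀ i c, r (b' (i, vecCons 1 c)) =
      (p i * sgn F (α ⬝ᵥ c)) • b' (i, vecCons 1 (β + c)) := fun i c => by
    rw [(hb' i _).2, (hb' i _).2, ← End.mul_apply, hrg, End.mul_apply, hrb, map_smul]
  have hbf : ∀ x : f.eigenspace 1, f x = x := fun x => by
    rw [End.mem_eigenspace_iff.1 x.2, one_smul]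
  have hf0 : ∀ i c, f (b' (i, vecCons 0 c)) = b' (i, vecCons 0 c) := fun i c => by
    rw [(hb' i _).1, hbf]
  have hf1 : ∀ i c, f (b' (i, vecCons 1 c)) = -b' (i, vecCons 1 c) := fun i c => by
    rw [(hb' i _).2, hfg', hbf]
  have hg0 : ∀ i c, g (b' (i, vecCons 0 c)) = b' (i, vecCons 1 c) := fun i c => by
    rw [(hb' i _).1, (hb' i _).2]
  have hg1 : ∀ i c, g (b' (i, vecCons 1 c)) = b' (i, vecCons 0 c) := fun i c => by
    rw [(hb' i _).1, (hb' i _).2, hg']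
  have hcons : ∀ c : B (ℓ + 1), ∃ d, c = vecCons 0 d ∨ c = vecCons 1 d := fun c => by
    refine ⟨vecTail c, ?_⟩
    rw [← cons_head_tail c]
    rcases zmod_two (vecHead c) with h | h <;> simp [h]
  have e11 : (1 : ZMod 2) + 1 = 0 := rfl
  -- A factor f adds the sign of the new first coordinate (first entry of α), a factor g its shift
  -- (first entry of β).
  rcases hqr with rfl | rfl | rfl | rfl
  · refine ⟨p, vecCons 0 α, vecCons 0 β, fun i c => ?_⟩
    obtain ⟨d, rfl | rfl⟩ := hcons c
    · rw [hr0]; simp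
    · rw [hr1]; simp
  · refine ⟨p, vecCons 1 α, vecCons 0 β, fun i c => ?_⟩
    obtain ⟨d, rfl | rfl⟩ := hcons c
    · rw [End.mul_apply, hf0, hr0]; simp
    · rw [End.mul_apply, hf1, map_neg, hr1]; simp [sgn_add, sgn_one]
  · refine ⟨p, vecCons 0 α, vecCons 1 β, fun i c => ?_⟩
    obtain ⟨d, rfl | rfl⟩ := hcons c
    · rw [End.mul_apply, hg0, hr1]; simp
    · rw [End.mul_apply, hg1, hr0]; simp [e11]
  -- In r f g the sign is taken after the shift by g, which costs a factor -1.
  · refine ⟨fun i => -p i, vecCons 1 α, vecCons 1 β, fun i c => ?_⟩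
    obtain ⟨d, rfl | rfl⟩ := hcons c
    · rw [End.mul_apply, End.mul_apply, hg0, hf1, map_neg, hr1]; simp
    · rw [End.mul_apply, End.mul_apply, hg1, hf0, hr0]; simp [sgn_add, sgn_one, e11]

end Classification

end Periplectic

/-! ### Every grading is refined by a conjugate of some Γ_P(ℓ) -/

namespace Periplectic

open Module Matrix

section Reduced

variable {F : Type*} [Field F]

/-- On the component i the hypothesis on x becomes (c i - d)² π_i x = 0. -/
theorem isReduced_of_scalar {L : Type*} [AddCommGroup L] [Module F L] {ι : Type*}
    {Γ : ι → Submodule F L} (hi : iSupIndep Γ) (h : ⨆ i, Γ i = ⊤) {θ : End F L} {c : ι → F}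
    (hθ : ∀ i, ∀ x ∈ Γ i, θ x = c i • x) : IsReduced θ := by
  obtain ⟨π, h1, h2, -, h4⟩ := LieSuperalgebra.exists_component_projection hi h
  have hπ : ∀ i x, π i (θ x) = c i • π i x := by
    intro i x
    have : π i ∘ₗ θ = c i • π i := LieSuperalgebra.eqOn_of_iSup_eq_top h fun j y hy => by
      rw [LinearMap.comp_apply, hθ j y hy, map_smul, LinearMap.smul_apply]
      by_cases hji : j = i
      · rw [hji]
      · rw [h2 j i hji y hy, smul_zero, smul_zero]
    exact LinearMap.congr_fun this x
  intro d x hx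
  rw [← sub_eq_zero]
  refine h4 _ fun i => ?_
  have := congrArg (π i) hx
  rw [map_add, map_sub, map_smul, map_smul, hπ, hπ, map_zero] at this
  rw [map_sub, map_smul, hπ, ← sub_smul]
  have h5 : (c i - d) • (c i - d) • π i x = 0 := by
    rw [← this]
    module
  rcases smul_eq_zero.1 h5 with h6 | h6
  · rw [h6, zero_smul]
  · exact h6

variable [CharZero F] {I : Type*} [Fintype I] [DecidableEq I]

/-- A Jordan chain u x = c x, u y = c y + x gives one for the conjugation: the symmetric product xy
is sent to c² xy + c xx, while xx has eigenvalue c². Hence xx = 0 and x = 0. -/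
theorem isReduced_of_ad (u : (Matrix I I F)ˣ)
    (hu : IsReduced (ad u 1 : space F I →ₗ[F] space F I)) : IsReduced (toLin' u.val) := by
  intro c y hy
  simp only [toLin'_apply] at hy ⊢
  obtain ⟨x, hx⟩ : ∃ x, x = u.val *ᵥ y - c • y := ⟨_, rfl⟩
  have huy : u.val *ᵥ y = c • y + x := by rw [hx]; abel
  have hux : u.val *ᵥ x = c • x := by
    rw [← sub_eq_zero, ← hy, hx, mulVec_sub, mulVec_smul]
    module
  rw [huy, add_eq_left]
  have hinj : ∀ z, u.val *ᵥ z = 0 → z = 0 := fun z hz => by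
    rw [← one_mulVec z, ← u.inv_mul, ← mulVec_mulVec, hz, mulVec_zero]
  by_cases hc : c = 0
  · subst hc
    exact hinj x (by rw [hux, zero_smul])
  have hD : ∀ v w : I → F, ad u 1 (symElt (symTensor v w)) =
      symElt (symTensor (u.val *ᵥ v) (u.val *ᵥ w)) := by
    intro v w
    rw [symElt_of_symm (transpose_symTensor v w), symElt_of_symm (transpose_symTensor _ _),
      ad_oddElt]
    refine Subtype.ext ?_
    simp [oddElt, symTensor, mul_add, add_mul, mul_vecMulVec, vecMulVec_mul, vecMul_transpose]
  have e1 : symTensor (c • x) (c • y + x) = (c * c) • symTensor x y + c • symTensor x x := by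
    ext i j
    simp [symTensor_apply]
    ring
  have e2 : symTensor (c • x) (c • x) = (c * c) • symTensor x x := by
    ext i j
    simp [symTensor_apply]
    ring
  have h1 : ad u 1 (symElt (symTensor x y)) =
      (c * c) • symElt (symTensor x y) + c • symElt (symTensor x x) := by
    rw [hD, hux, huy, e1, map_add, map_smul, map_smul]
  have h2 : ad u 1 (symElt (symTensor x x)) = (c * c) • symElt (symTensor x x) := by
    rw [hD, hux, e2, map_smul]
  have h3 := hu (c * c) (symElt (symTensor x y)) (by
    simp only [LinearEquiv.coe_coe]
    rw [h1, map_add, map_smul, map_smul, h1, h2]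
    module)
  rw [LinearEquiv.coe_coe, h1, add_eq_left, smul_eq_zero] at h3
  have h4 := h3.resolve_left hc
  rw [symElt_of_symm (transpose_symTensor _ _)] at h4
  ext i
  have h5 : symTensor x x i i = 0 :=
    congrFun (congrFun (congrArg (fun z : space F I => (z : Mat F I).toBlocks₁₂) h4) i) i
  rw [symTensor_apply] at h5
  have h6 : 2 * (x i * x i) = 0 := by rw [← h5]; ring
  simpa using h6

end Reduced

section Conjugation

variable {F : Type*} [Field F] [CharZero F] {I : Type*} [Fintype I] [DecidableEq I]

/-- The base change from the standard basis. -/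
noncomputable def basisUnit (b : Basis I F (I → F)) : (Matrix I I F)ˣ where
  val := (Pi.basisFun F I).toMatrix b
  inv := b.toMatrix (Pi.basisFun F I)
  val_inv := Basis.toMatrix_mul_toMatrix_flip _ _
  inv_val := Basis.toMatrix_mul_toMatrix_flip _ _

theorem basisUnit_val_apply (b : Basis I F (I → F)) (x y : I) :
    (basisUnit b).val x y = b y x := by
  simp [basisUnit, Basis.toMatrix_apply]

theorem exists_mul_basisUnit {ℓ k : ℕ} (lab : Fin k × B ℓ ≃ I)
    (b : Basis (Fin k × B ℓ) F (I → F)) (u : (Matrix I I F)ˣ) {p : Fin k → F} {α β : B ℓ}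
    (hu : ∀ i c, u.val *ᵥ b (i, c) = (p i * sgn F (α ⬝ᵥ c)) • b (i, β + c)) :
    ∃ (p' : Fin k → Fˣ) (s : T ℓ),
      u * basisUnit (b.reindex lab) = basisUnit (b.reindex lab) * monomialUnit lab p' s := by
  have hp : ∀ i, p i ≠ 0 := by
    intro i hi
    have := hu i 0
    rw [hi, zero_mul, zero_smul] at this
    refine b.ne_zero (i, 0) ?_
    rw [← one_mulVec (b (i, 0)), ← u.inv_mul, ← mulVec_mulVec, this, mulVec_zero]
  -- The sign in X_t depends on the row β + c rather than the column c, hence the correction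
  -- sgn(α·β).
  refine ⟨fun i => sgn F (α ⬝ᵥ β) * Units.mk0 (p i) (hp i), ofCoord α β, Units.ext ?_⟩
  ext x y
  obtain ⟨⟨i, c⟩, rfl⟩ := lab.surjective y
  rw [Units.val_mul, Units.val_mul, monomialUnit_val, mul_blockMat_diagonal_apply,
    Finset.sum_eq_single (β + c)]
  · have h1 : (u.val * (basisUnit (b.reindex lab)).val) x (lab (i, c)) =
        (u.val *ᵥ b (i, c)) x := by
      rw [mul_apply, mulVec, dotProduct]
      refine Finset.sum_congr rfl fun z _ => ?_
      rw [basisUnit_val_apply, Basis.reindex_apply, Equiv.symm_apply_apply]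
    rw [h1, hu, X_apply, projB_ofCoord, coordA_ofCoord, if_pos rfl, basisUnit_val_apply,
      Basis.reindex_apply, Equiv.symm_apply_apply, dotProduct_add, sgn_add]
    have h2 := congrArg Units.val (sgn_mul_self F (α ⬝ᵥ β))
    simp only [Units.val_mul, Units.val_one] at h2
    simp only [Units.val_mul, Units.val_mk0, Pi.smul_apply, smul_eq_mul]
    linear_combination (-(p i * sgn F (α ⬝ᵥ c) * b (i, β + c) x)) * h2
  · intro r _ hr
    rw [X_apply, projB_ofCoord, if_neg hr, mul_zero]
  · simp

end Conjugation

section Classification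

variable {F : Type*} [Field F] [IsAlgClosed F] [CharZero F] {n : ℕ}

/-- Every grading is refined by a grading equivalent to some `Γ_P(ℓ)`. -/
theorem exists_refinement (hn : 2 ≤ n) {G : Type*} [AddCommGroup G]
    {Γ : G → Submodule F (space F (Fin (n + 1)))}
    (hΓ : (periplectic F (Fin (n + 1))).IsGrading Γ) :
    ∃ (ℓ k : ℕ) (h : k * 2 ^ ℓ = n + 1) (φ : space F (Fin (n + 1)) ≃ₗ[F] space F (Fin (n + 1))),
      (periplectic F (Fin (n + 1))).IsAut φ ∧ ∀ t, ∃ s,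
        (fineGammaP F h t).map (φ : _ →ₗ[F] space F (Fin (n + 1))) ≤ Γ s := by
  -- The matrices whose conjugations are the automorphisms attached to characters of G. They are
  -- diagonalizable, commute up to sign and are closed under squaring.
  let Q : Set (Matrix (Fin (n + 1)) (Fin (n + 1)) F)ˣ := {u | ∃ χ : G →+ Additive Fˣ,
    ∀ g, ∀ x ∈ Γ g, ad u 1 x = ((χ g).toMul : F) • x}
  have hQ : ∀ u ∈ Q, IsReduced (toLin' u.val) := fun u ⟨χ, hχ⟩ =>
    isReduced_of_ad u (isReduced_of_scalar hΓ.indep hΓ.iSup_eq_top hχ)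
  have hsq : ∀ u ∈ Q, u * u ∈ Q := fun u ⟨χ, hχ⟩ => ⟨χ + χ, fun g x hx => by
    have := ad_mul u u 1 1 x
    rw [mul_one] at this
    rw [this, hχ g x hx, map_smul, hχ g x hx, smul_smul, AddMonoidHom.add_apply, toMul_add,
      Units.val_mul]⟩
  have hcomm : ∀ u ∈ Q, ∀ v ∈ Q, u * v = v * u ∨ u * v = -(v * u) := by
    rintro u ⟨χ, hχ⟩ v ⟨ψ, hψ⟩
    refine eq_or_eq_neg_of_ad_eq (LinearEquiv.toLinearMap_injective
      (LieSuperalgebra.eqOn_of_iSup_eq_top hΓ.iSup_eq_top fun g x hx => ?_))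
    have h1 := ad_mul u v 1 1 x
    have h2 := ad_mul v u 1 1 x
    rw [mul_one] at h1 h2
    rw [LinearEquiv.coe_coe, LinearEquiv.coe_coe, h1, h2, hχ g x hx, hψ g x hx, map_smul, map_smul,
      hχ g x hx, hψ g x hx, smul_comm]
  obtain ⟨ℓ, k, b, hb⟩ := exists_monomial_basis (V := Fin (n + 1) → F)
    {q | ∃ u ∈ Q, q = toLin' u.val}
    (by
      rintro _ ⟨u, _, rfl⟩ x hx
      rw [toLin'_apply] at hx
      rw [← one_mulVec x, ← u.inv_mul, ← mulVec_mulVec, hx, mulVec_zero])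
    (by
      rintro _ ⟨u, hu, rfl⟩
      have := hQ _ (hsq u hu)
      rwa [Units.val_mul, toLin'_mul] at this)
    (by
      rintro _ ⟨u, hu, rfl⟩ _ ⟨v, hv, rfl⟩
      refine (hcomm u hu v hv).imp (fun h => ?_) fun h => ?_
      · change _ ∘ₗ _ = _ ∘ₗ _
        rw [← toLin'_mul, ← toLin'_mul, ← Units.val_mul, h, Units.val_mul]
      · change _ ∘ₗ _ = -(_ ∘ₗ _)
        rw [← toLin'_mul, ← toLin'_mul, ← Units.val_mul, h, Units.val_neg, Units.val_mul, map_neg])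
  have h : k * 2 ^ ℓ = n + 1 := by
    have := finrank_eq_card_basis b
    simp at this
    omega
  let lab := labelling h
  refine ⟨ℓ, k, h, ad (basisUnit (b.reindex lab)) 1, isAut_ad _ _, fun t => ?_⟩
  -- If P is the base change and u comes from a character, then uP = P(diag(p') ⊗ X_s). So u acts on
  -- the image under P of a component of Γ_P(ℓ) by the same scalar as diag(p') ⊗ X_s on that
  -- component.
  refine LieSuperalgebra.le_component_of_scalar (S := periplectic F (Fin (n + 1)))
    hΓ.indep hΓ.iSup_eq_top _ (fun χ θ hθ hA => ?_) hΓ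
  obtain ⟨u, rfl⟩ := exists_eq_ad (by rw [Fintype.card_fin]; omega) hA
  obtain ⟨p, α, β, hp⟩ := hb _ ⟨u, ⟨χ, hθ⟩, rfl⟩
  obtain ⟨p', s, hps⟩ := exists_mul_basisUnit lab b u hp
  refine ⟨chi p' 1 s t, ?_⟩
  rintro _ ⟨x, hx, rfl⟩
  have h1 := ad_mul u (basisUnit (b.reindex lab)) 1 1 x
  have h2 := ad_mul (basisUnit (b.reindex lab)) (monomialUnit lab p' s) 1 1 x
  rw [mul_one] at h1 h2
  rw [LinearEquiv.coe_coe, ← h1, hps, h2, ad_fineGammaP h p' 1 s t hx, map_smul]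

theorem exists_equivalent_fineGammaP (hn : 2 ≤ n) {G : Type*} [AddCommGroup G]
    {Γ : G → Submodule F (space F (Fin (n + 1)))}
    (hΓ : LieSuperalgebra.IsFine.{w} (periplectic F (Fin (n + 1))) Γ) :
    ∃ (ℓ k : ℕ) (h : k * 2 ^ ℓ = n + 1),
      (periplectic F (Fin (n + 1))).Equivalent Γ (fineGammaP F h) := by
  obtain ⟨ℓ, k, h, φ, hφ, href⟩ := exists_refinement hn hΓ.1
  exact ⟨ℓ, k, h, LieSuperalgebra.IsFine.equivalent hΓ (isGrading_fineGammaP h) hφ href⟩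

end Classification

end Periplectic

/-! ### Universal groups -/

namespace LieSuperalgebra

section Universal

variable {F : Type*} {L : Type*} [Field F] [AddCommGroup L] [Module F L] {S : LieSuperalgebra F L}

theorem image_universalRelations_subset {G H : Type*} {Γ : G → Submodule F L}
    {Δ : H → Submodule F L} {φ : L ≃ₗ[F] L} (hφ : S.IsAut φ) (α : support Γ ≃ support Δ)
    (h : ∀ s : support Γ, (Γ s).map (φ : L →ₗ[F] L) = Δ (α s)) :
    FreeAbelianGroup.equivOfEquiv α '' S.universalRelations Γ ⊆ S.universalRelations Δ := by
  have hmem : ∀ (s : support Γ) x, x ∈ Γ s → φ x ∈ Δ (α s) := fun s x hx =>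
    h s ▸ Submodule.mem_map_of_mem hx
  rintro _ ⟨_, ⟨s₁, s₂, s₃, ⟨x, hx, y, hy, hxy⟩, hs, rfl⟩, rfl⟩
  refine ⟨α s₁, α s₂, α s₃, ⟨φ x, hmem _ x hx, φ y, hmem _ y hy, ?_⟩, ?_, ?_⟩
  · rw [← hφ.2]
    exact fun h0 => hxy (φ.map_eq_zero_iff.1 h0)
  · intro x' hx' y' hy'
    rw [← h] at hx' hy'
    obtain ⟨x, hx, rfl⟩ := hx'
    obtain ⟨y, hy, rfl⟩ := hy'
    rw [LinearEquiv.coe_coe, ← hφ.2]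
    exact hmem _ _ (hs x hx y hy)
  · simp [FreeAbelianGroup.equivOfEquiv]

/-- Equivalent gradings have isomorphic universal groups. -/
theorem Equivalent.nonempty_universalGroup {G H : Type*} {Γ : G → Submodule F L}
    {Δ : H → Submodule F L} (h : S.Equivalent Γ Δ) :
    Nonempty (S.UniversalGroup Γ ≃+ S.UniversalGroup Δ) := by
  obtain ⟨φ, hφ, α, hα⟩ := h
  have h1 := image_universalRelations_subset hφ α hα
  have h2 := image_universalRelations_subset hφ.symm α.symm fun s => by
    have := hα (α.symm s)
    rw [Equiv.apply_symm_apply] at this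
    rw [← this, ← Submodule.map_comp]
    simp
  refine ⟨QuotientAddGroup.congr _ _ (FreeAbelianGroup.equivOfEquiv α) ?_⟩
  rw [AddMonoidHom.map_closure]
  refine congrArg _ (h1.antisymm fun r hr => ?_)
  refine ⟨(FreeAbelianGroup.equivOfEquiv α).symm r, h2 ⟨r, hr, rfl⟩, ?_⟩
  exact AddEquiv.apply_symm_apply _ r

theorem toUniversal_add {G : Type*} [AddCommGroup G] {Γ : G → Submodule F L} (hΓ : S.IsGrading Γ)
    (s₁ s₂ s₃ : support Γ) (h : (s₃ : G) = s₁ + s₂) {x y : L} (hx : x ∈ Γ s₁) (hy : y ∈ Γ s₂)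
    (hxy : S.bracket x y ≠ 0) :
    S.toUniversal Γ s₃ = S.toUniversal Γ s₁ + S.toUniversal Γ s₂ := by
  have : FreeAbelianGroup.of s₁ + FreeAbelianGroup.of s₂ - FreeAbelianGroup.of s₃ ∈
      AddSubgroup.closure (S.universalRelations Γ) :=
    AddSubgroup.subset_closure ⟨s₁, s₂, s₃, ⟨x, hx, y, hy, hxy⟩,
      fun x hx y hy => h ▸ hΓ.bracket_mem _ _ x y hx hy, rfl⟩
  have h1 := (QuotientAddGroup.eq_zero_iff _).2 this
  rw [QuotientAddGroup.mk_sub, sub_eq_zero] at h1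
  exact h1.symm

/-- The homomorphism from the universal group to a grading group. -/
def universalHom {G : Type*} [AddCommGroup G] {Γ : G → Submodule F L} (hΓ : S.IsGrading Γ) :
    S.UniversalGroup Γ →+ G :=
  QuotientAddGroup.lift _ (FreeAbelianGroup.lift fun s : support Γ => (s : G)) (by
    rw [AddSubgroup.closure_le]
    rintro _ ⟨s₁, s₂, s₃, ⟨x, hx, y, hy, hxy⟩, hs, rfl⟩
    change FreeAbelianGroup.lift (fun s : support Γ => (s : G)) _ = 0
    rw [map_sub, map_add, FreeAbelianGroup.lift_apply_of, FreeAbelianGroup.lift_apply_of,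
      FreeAbelianGroup.lift_apply_of, sub_eq_zero]
    -- Otherwise the nonzero bracket would lie in the components of two different degrees.
    by_contra hne
    exact hxy (Submodule.disjoint_def.1 (hΓ.indep.pairwiseDisjoint hne) _
      (hΓ.bracket_mem _ _ x y hx hy) (hs x hx y hy)))

theorem universalHom_toUniversal {G : Type*} [AddCommGroup G] {Γ : G → Submodule F L}
    (hΓ : S.IsGrading Γ) (s : support Γ) : universalHom hΓ (S.toUniversal Γ s) = s := by
  simp [universalHom, toUniversal]

/-- The homomorphism from the universal group is injective if all automorphisms acting by
scalars on the components come from characters of the grading group. -/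
theorem universalHom_injective [IsAlgClosed F] [CharZero F] {G : Type*} [AddCommGroup G]
    {Γ : G → Submodule F L} (hΓ : S.IsGrading Γ)
    (h : ∀ (c : G → F) (θ : L ≃ₗ[F] L), S.IsAut θ → (∀ g, ∀ x ∈ Γ g, θ x = c g • x) →
      ∃ ψ : G →+ Additive Fˣ, ∀ g, ∀ x ∈ Γ g, θ x = ((ψ g).toMul : F) • x) :
    Function.Injective (universalHom hΓ) := by
  classical
  rw [injective_iff_map_eq_zero]
  intro x hx
  by_contra hx0
  obtain ⟨χ, hχ⟩ := exists_character_ne_zero F hx0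
  -- A character of the universal group gives scalars on the support. The value 1 elsewhere is never
  -- used, since multiplicativity is needed only for nonzero brackets.
  let c : G → Fˣ := fun g =>
    if hg : g ∈ support Γ then (χ (S.toUniversal Γ ⟨g, hg⟩)).toMul else 1
  have hmem : ∀ {g x}, x ∈ Γ g → x ≠ 0 → g ∈ support Γ := fun hx h0 => (Submodule.ne_bot_iff _).2
    ⟨_, hx, h0⟩
  obtain ⟨θ, hθ, hθc⟩ := hΓ.exists_isAut c fun g k x hx y hy hxy => by
    have hg := hmem hx fun h0 => hxy (by simp [h0])
    have hk := hmem hy fun h0 => hxy (by simp [h0])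
    have hgk := hmem (hΓ.bracket_mem _ _ x y hx hy) hxy
    have := toUniversal_add hΓ ⟨g, hg⟩ ⟨k, hk⟩ ⟨g + k, hgk⟩ rfl hx hy hxy
    simp only [c, dif_pos hg, dif_pos hk, dif_pos hgk, this, map_add, toMul_add]
  obtain ⟨ψ, hψ⟩ := h _ θ hθ hθc
  -- A character factoring through G is trivial on the kernel element x, contrary to the choice of
  -- χ.
  have key : χ = ψ.comp (universalHom hΓ) := by
    refine QuotientAddGroup.addMonoidHom_ext _ (FreeAbelianGroup.lift_ext _ _ fun s => ?_)
    change χ (S.toUniversal Γ s) = ψ (universalHom hΓ (S.toUniversal Γ s))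
    rw [universalHom_toUniversal]
    obtain ⟨x, hx, hx0⟩ := (Submodule.ne_bot_iff _).1 s.2
    have h1 := (hθc s x hx).symm.trans (hψ s x hx)
    have h2 := Units.ext (smul_left_injective F hx0 h1)
    simp only [c, dif_pos s.2] at h2
    exact Additive.toMul.injective h2
  rw [key, AddMonoidHom.comp_apply, hx, map_zero] at hχ
  exact hχ rfl

end Universal

end LieSuperalgebra

/-! ### The group G_(ℓ) and the universal group of Γ_P(ℓ) -/

namespace Periplectic

open Matrix

section FineGroup

variable {ℓ k : ℕ}

/-- Elements of both summands satisfy the equation. Conversely, adding to a solution its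
e₀-coordinate times 2e_1 - e₀ clears that coordinate and leaves coordinate sum zero. -/
theorem mem_fineGroup (hk : 0 < k) {g : BigGroup ℓ k} :
    g ∈ fineGroup ℓ k hk ↔ ∑ i, g.2.1 i + 2 * g.2.2 = 0 := by
  have he : ∑ i, (Pi.single ⟨0, hk⟩ 1 : Fin k → ℤ) i = 1 := by simp
  constructor
  · intro h
    obtain ⟨x, ⟨hx1, hx2⟩, _, ⟨m, rfl⟩, rfl⟩ := AddSubgroup.mem_sup.1 h
    simp only [e, e₀, Prod.snd_add, Prod.fst_add, Pi.add_apply, Finset.sum_add_distrib, hx1, hx2,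
      Prod.smul_snd, Prod.smul_fst, Prod.snd_sub, Prod.fst_sub, Pi.smul_apply, smul_eq_mul, sub_zero, ← Finset.mul_sum, ← Finset.smul_sum, he]
    simp
    ring
  · intro h
    refine AddSubgroup.mem_sup.2 ⟨g + g.2.2 • (2 • e ⟨0, hk⟩ - e₀), ⟨?_, ?_⟩,
      (-g.2.2) • (2 • e ⟨0, hk⟩ - e₀), ⟨_, rfl⟩, ?_⟩
    · simp only [e, e₀, Prod.snd_add, Prod.fst_add, Pi.add_apply, Finset.sum_add_distrib,
        Prod.smul_snd, Prod.smul_fst, Prod.snd_sub, Prod.fst_sub, Pi.smul_apply, smul_eq_mul, sub_zero, ← Finset.mul_sum, ← Finset.smul_sum, he]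
      rw [← h]
      simp
      ring
    · simp [e, e₀]
    · rw [neg_smul, add_neg_cancel_right]

/-- `G_(ℓ)` is the product of `T_(ℓ)` and a free abelian group of rank `k`. -/
theorem nonempty_fineGroup_addEquiv (hk : 0 < k) :
    Nonempty (fineGroup ℓ k hk ≃+ T ℓ × (Fin k → ℤ)) := by
  obtain ⟨m, rfl⟩ : ∃ m, k = m + 1 := ⟨k - 1, by omega⟩
  have hsum : ∀ g ∈ fineGroup ℓ (m + 1) hk,
      g.2.1 0 = -(2 * g.2.2) - ∑ i : Fin m, g.2.1 i.succ := fun g hg => by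
    have := (mem_fineGroup hk).1 hg
    rw [Fin.sum_univ_succ] at this
    linarith
  -- The defining equation determines the first coordinate from the others, so its place is taken by
  -- the e₀-coordinate.
  refine ⟨AddEquiv.mk' ⟨fun g => (g.1.1, vecCons g.1.2.2 (vecTail g.1.2.1)),
    fun x => ⟨(x.1, vecCons (-(2 * x.2 0) - ∑ i : Fin m, x.2 i.succ) (vecTail x.2), x.2 0),
      (mem_fineGroup hk).2 ?_⟩, ?_, ?_⟩ ?_⟩
  · rw [Fin.sum_univ_succ]
    simp [vecTail]
  · rintro ⟨⟨t, z, y⟩, hg⟩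
    have h0 := hsum _ hg
    simp only [] at h0
    refine Subtype.ext (Prod.ext rfl (Prod.ext ?_ rfl))
    funext i
    refine Fin.cases ?_ (fun i => ?_) i
    · exact h0.symm
    · rfl
  · rintro ⟨t, z⟩
    refine Prod.ext rfl ?_
    funext i
    refine Fin.cases rfl (fun i => rfl) i
  · rintro ⟨⟨t, z, y⟩, hg⟩ ⟨⟨t', z', y'⟩, hg'⟩
    refine Prod.ext rfl ?_
    funext i
    refine Fin.cases rfl (fun i => rfl) i

/-- T_(ℓ) consists of torsion elements, whose images have no free part. So it embeds into T_(ℓ'),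
and the orders are compared. -/
theorem le_of_addEquiv {ℓ' k' : ℕ} (f : T ℓ × (Fin k → ℤ) ≃+ T ℓ' × (Fin k' → ℤ)) : ℓ ≤ ℓ' := by
  have h2 : ∀ t : T ℓ, (f (t, 0)).2 = 0 := fun t => by
    have h1 : f (t, 0) + f (t, 0) = 0 := by
      rw [← map_add, Prod.mk_add_mk, add_self_T, add_zero]
      exact map_zero f
    funext i
    have h3 : (f (t, 0)).2 i + (f (t, 0)).2 i = 0 := congrFun (congrArg Prod.snd h1) i
    have h4 : (f (t, 0)).2 i = 0 := by omega
    exact h4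
  have hinj : Function.Injective fun t : T ℓ => (f (t, 0)).1 := fun t t' h =>
    congrArg Prod.fst (f.injective (Prod.ext h ((h2 t).trans (h2 t').symm)))
  have := Fintype.card_le_of_injective _ hinj
  simp only [Fintype.card_pi, ZMod.card, Finset.prod_const, Finset.card_univ, Fintype.card_fin]
    at this
  have := (Nat.pow_le_pow_iff_right one_lt_two).1 this
  omega

end FineGroup

section Support

variable {F : Type*} [Field F] [CharZero F] {n ℓ k : ℕ}

theorem support_subset_fineGroup (h : k * 2 ^ ℓ = n + 1) {g : BigGroup ℓ k}
    (hg : g ∈ LieSuperalgebra.support (fineGammaP F h)) :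
    g ∈ fineGroup ℓ k (pos_of_mul_eq h) := by
  rw [mem_fineGroup]
  obtain ⟨x, hx, hx0⟩ := (Submodule.ne_bot_iff _).1 hg
  have hx' : x.1 ∈ matComponent (X F ℓ) (fun t => (t, 0, 0)) e e₀ (labelling h) g := hx
  by_contra hne
  refine hx0 (Subtype.ext ?_)
  have hempty : matComponent (X F ℓ) (fun t => (t, 0, 0)) e e₀ (labelling h) g = ⊥ := by
    unfold matComponent
    rw [Submodule.span_eq_bot]
    rintro y (((⟨i, j, t, rfl, rfl⟩ | ⟨i, j, t, rfl, rfl⟩) | ⟨i, j, t, rfl, rfl⟩) |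
      ⟨i, j, t, rfl, rfl⟩) <;>
    · refine absurd ?_ hne
      simp [e, e₀, Finset.sum_add_distrib, Finset.sum_sub_distrib]
  rw [hempty] at hx'
  exact (Submodule.mem_bot F).1 hx'

theorem basisMat_ne_zero {I : Type*} [Fintype I] (lab : Fin k × B ℓ ≃ I) (i j : Fin k) (t : T ℓ) :
    (basisMat lab i j t : Matrix I I F) ≠ 0 := by
  intro h
  have := congrFun (congrFun h (lab (i, projB t))) (lab (j, 0))
  rw [basisMat, blockMat_apply, X_apply] at this
  simp at this

theorem tracelessElt_mem_support (h : k * 2 ^ ℓ = n + 1) (i j : Fin k) (t : T ℓ)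
    (hne : i ≠ j ∨ t ≠ 0) :
    e i + (t, 0, 0) - e j ∈ LieSuperalgebra.support (fineGammaP F h) := by
  refine (Submodule.ne_bot_iff _).2 ⟨_, tracelessElt_basisMat_mem h i j t, fun h0 => ?_⟩
  have htr : (basisMat (labelling h) i j t : Matrix _ _ F).trace = 0 := by
    rw [basisMat, trace_blockMat]
    rcases hne with hij | ht
    · rw [trace_single_eq_of_ne _ _ _ hij, zero_mul]
    · rw [trace_X F ht, mul_zero]
  rw [tracelessElt_of_trace_eq_zero htr] at h0
  exact basisMat_ne_zero (labelling h) i j t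
    (congrArg (fun z : space F (Fin (n + 1)) => (z : Mat F (Fin (n + 1))).toBlocks₁₁) h0)

theorem symElt_mem_support (h : k * 2 ^ ℓ = n + 1) (i : Fin k) :
    2 • e i - e₀ ∈ LieSuperalgebra.support (fineGammaP F h) := by
  refine (Submodule.ne_bot_iff _).2 ⟨symElt (basisMat (labelling h) i i 0), ?_, fun h0 => ?_⟩
  · convert symElt_basisMat_mem (F := F) h i i 0 using 2
    rw [show ((0, 0, 0) : BigGroup ℓ k) = 0 from rfl, add_zero, two_nsmul]
  · have hsym : (basisMat (labelling h) i i 0 : Matrix _ _ F)ᵀ = basisMat (labelling h) i i 0 := by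
      rw [basisMat_transpose, coordA_zero, zero_dotProduct, sgn_zero, Units.val_one, one_smul]
    rw [symElt_of_symm hsym] at h0
    exact basisMat_ne_zero (labelling h) i i 0
      (congrArg (fun z : space F (Fin (n + 1)) => (z : Mat F (Fin (n + 1))).toBlocks₁₂) h0)

theorem fineGroup_le_closure_support (h : k * 2 ^ ℓ = n + 1) :
    fineGroup ℓ k (pos_of_mul_eq h) ≤
      AddSubgroup.closure (LieSuperalgebra.support (fineGammaP F h)) := by
  intro g hg
  rw [mem_fineGroup] at hg
  let o : Fin k := ⟨0, pos_of_mul_eq h⟩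
  have hT : ∀ t : T ℓ, ((t, 0, 0) : BigGroup ℓ k) ∈
      AddSubgroup.closure (LieSuperalgebra.support (fineGammaP F h)) := fun t => by
    by_cases ht : t = 0
    · rw [ht]
      exact zero_mem _
    · have := tracelessElt_mem_support (F := F) h o o t (Or.inr ht)
      rw [add_sub_cancel_left] at this
      exact AddSubgroup.subset_closure this
  have he : ∀ i, (e i - e o : BigGroup ℓ k) ∈
      AddSubgroup.closure (LieSuperalgebra.support (fineGammaP F h)) := fun i => by
    by_cases hi : i = o
    · rw [hi, sub_self]
      exact zero_mem _
    · have := tracelessElt_mem_support (F := F) h i o 0 (Or.inl hi)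
      rw [show ((0, 0, 0) : BigGroup ℓ k) = 0 from rfl, add_zero] at this
      exact AddSubgroup.subset_closure this
  -- The coefficient of e_o on the right is correct exactly because of the equation defining G_(ℓ).
  have hg' : g = (g.1, 0, 0) + ∑ i, g.2.1 i • (e i - e o) + (-g.2.2) • (2 • e o - e₀) := by
    refine Prod.ext ?_ (Prod.ext ?_ ?_)
    · simp [e, e₀, Prod.fst_sum]
    · funext j
      simp only [e, e₀, Prod.fst_add, Prod.snd_add, Prod.snd_sum, Prod.fst_sum, Prod.smul_snd,
        Prod.smul_fst, Prod.fst_sub, Prod.snd_sub, Pi.add_apply, Finset.sum_apply, Pi.smul_apply,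
        Pi.sub_apply, smul_eq_mul, mul_sub, Finset.sum_sub_distrib,
        ← Finset.sum_mul, sub_zero, zero_add]
      rw [eq_neg_of_add_eq_zero_left hg]
      simp [Pi.single_apply]
      split_ifs <;> ring
    · simp [e, e₀, Prod.snd_sum]
  rw [hg']
  exact add_mem (add_mem (hT _) (sum_mem fun i _ => zsmul_mem (he i) _))
    (zsmul_mem (AddSubgroup.subset_closure (symElt_mem_support h o)) _)

end Support

section UniversalGroup

variable {F : Type*} [Field F] [IsAlgClosed F] [CharZero F] {n ℓ k : ℕ}

/-- The universal group of `Γ_P(ℓ)` is `G_(ℓ)`. -/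
theorem exists_universalGroup_addEquiv (hn : 2 ≤ n) (h : k * 2 ^ ℓ = n + 1) :
    ∃ φ : (periplectic F (Fin (n + 1))).UniversalGroup (fineGammaP F h) ≃+
        fineGroup ℓ k (pos_of_mul_eq h),
      ∀ s : LieSuperalgebra.support (fineGammaP F h),
        (φ ((periplectic F (Fin (n + 1))).toUniversal (fineGammaP F h) s) : BigGroup ℓ k) = s := by
  have hΓ := isGrading_fineGammaP (F := F) h
  -- An automorphism scalar on all components is conjugation by some diag(p) ⊗ X_s, so its scalars
  -- are the values of the character `chi p 1 s`.
  have hinj := LieSuperalgebra.universalHom_injective hΓ fun c θ hθ hc => by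
    obtain ⟨p, s, hps⟩ := exists_character_of_scalar hn h hθ (fineGammaP F h) hΓ.iSup_eq_top
      (fun i => ⟨i, le_rfl⟩) c hc
    exact ⟨AddMonoidHom.mk' (fun g => Additive.ofMul (chi p 1 s g)) fun a b =>
      congrArg Additive.ofMul (chi_add p 1 s a b), hps⟩
  have hrange : (LieSuperalgebra.universalHom hΓ).range = fineGroup ℓ k (pos_of_mul_eq h) := by
    refine le_antisymm ?_ ((fineGroup_le_closure_support (F := F) h).trans ?_)
    · rintro _ ⟨x, rfl⟩
      obtain ⟨x, rfl⟩ := QuotientAddGroup.mk_surjective x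
      induction x using FreeAbelianGroup.induction_on with
      | zero => exact zero_mem _
      | of s =>
        change LieSuperalgebra.universalHom hΓ
          ((periplectic F (Fin (n + 1))).toUniversal (fineGammaP F h) s) ∈ _
        rw [LieSuperalgebra.universalHom_toUniversal]
        exact support_subset_fineGroup h s.2
      | neg s hs =>
        rw [QuotientAddGroup.mk_neg, map_neg]
        exact neg_mem hs
      | add x y hx hy =>
        rw [QuotientAddGroup.mk_add, map_add]
        exact add_mem hx hy
    · rw [AddSubgroup.closure_le]
      exact fun s hs => ⟨_, LieSuperalgebra.universalHom_toUniversal hΓ ⟨s, hs⟩⟩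
  refine ⟨(AddMonoidHom.ofInjective hinj).trans (AddEquiv.addSubgroupCongr hrange), fun s => ?_⟩
  exact LieSuperalgebra.universalHom_toUniversal hΓ s

/-- The parameter `ℓ` is determined by the equivalence class of `Γ_P(ℓ)`. -/
theorem le_of_equivalent (hn : 2 ≤ n) (h : k * 2 ^ ℓ = n + 1) {ℓ' k' : ℕ}
    (h' : k' * 2 ^ ℓ' = n + 1)
    (heq : (periplectic F (Fin (n + 1))).Equivalent (fineGammaP F h) (fineGammaP F h')) :
    ℓ ≤ ℓ' := by
  obtain ⟨f⟩ := heq.nonempty_universalGroup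
  obtain ⟨φ, -⟩ := exists_universalGroup_addEquiv (F := F) hn h
  obtain ⟨φ', -⟩ := exists_universalGroup_addEquiv (F := F) hn h'
  obtain ⟨ψ⟩ := nonempty_fineGroup_addEquiv (ℓ := ℓ) (pos_of_mul_eq h)
  obtain ⟨ψ'⟩ := nonempty_fineGroup_addEquiv (ℓ := ℓ') (pos_of_mul_eq h')
  exact le_of_addEquiv (ψ.symm.trans (φ.symm.trans (f.trans (φ'.trans ψ'))))

end UniversalGroup

end Periplectic

theorem mainTheorem2 {F : Type u} [Field F] [IsAlgClosed F] [CharZero F] (n : ℕ) (hn : 2 ≤ n) :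
    (∀ (G : Type v) [AddCommGroup G]
      (Γ : G → Submodule F (Periplectic.space F (Fin (n + 1)))),
      LieSuperalgebra.IsFine.{w} (Periplectic.P F n) Γ →
        ∃! ℓ : ℕ, ∃ h : 2 ^ ℓ ∣ n + 1,
          (Periplectic.P F n).Equivalent Γ
            (Periplectic.fineGammaP F (k := (n + 1) / 2 ^ ℓ) (Nat.div_mul_cancel h))) ∧
    (∀ (ℓ k : ℕ) (h : k * 2 ^ ℓ = n + 1),
      LieSuperalgebra.IsFine.{w} (Periplectic.P F n) (Periplectic.fineGammaP F h) ∧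
      (∃ φ : (Periplectic.P F n).UniversalGroup (Periplectic.fineGammaP F h) ≃+
          Periplectic.fineGroup ℓ k (Periplectic.pos_of_mul_eq h),
        ∀ s : LieSuperalgebra.support (Periplectic.fineGammaP F h),
          (φ ((Periplectic.P F n).toUniversal (Periplectic.fineGammaP F h) s) :
            Periplectic.BigGroup ℓ k) = s) ∧
      Nonempty (Periplectic.fineGroup ℓ k (Periplectic.pos_of_mul_eq h) ≃+
        (Fin (2 * ℓ) → ZMod 2) × (Fin k → ℤ))) := by
  refine ⟨fun G _ Γ hΓ => ?_, fun ℓ k h => ⟨Periplectic.isFine_fineGammaP hn h,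
    Periplectic.exists_universalGroup_addEquiv hn h, Periplectic.nonempty_fineGroup_addEquiv _⟩⟩
  obtain ⟨ℓ, k, h, heq⟩ := Periplectic.exists_equivalent_fineGammaP hn hΓ
  obtain rfl : k = (n + 1) / 2 ^ ℓ := (Nat.div_eq_of_eq_mul_left (by positivity) h.symm).symm
  refine ⟨ℓ, ⟨⟨_, by rw [mul_comm, h]⟩, heq⟩, ?_⟩
  -- Two admissible parameters give equivalent gradings, hence isomorphic universal groups, and the
  -- torsion comparison applies in both directions.
  rintro ℓ' ⟨h', heq'⟩
  exact le_antisymm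
    (Periplectic.le_of_equivalent hn (Nat.div_mul_cancel h') h (heq'.symm.trans heq))
    (Periplectic.le_of_equivalent hn h (Nat.div_mul_cancel h') (heq.symm.trans heq'))
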